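/- Let $\mathfrak g$ be a finite-dimensional simple Lie algebra over $\mathbb C$ with Cartan subalgebra $\mathfrak h$ and Chevalley generators $e_i,f_i$ $(i=1,\dots,\ell)$. Let $G$ be the connected algebraic group of adjoint type with Lie algebra $\mathfrak g$, let $N\subset B\subset G$ be the subgroups with Lie algebras $\mathfrak n=\langle e_1,\dots,e_\ell\rangle$ and $\mathfrak b=\mathfrak h\oplus\mathfrak n$, and put $p_{-1}=\sum_i f_i$. (In the setting of the Langlands correspondence, $G$ is the Langlands dual of a simple simply-connected group.) Let $\mathrm{Loc}_G(D^\times)$ be the set of operators $\partial_t+A(t)$, $A\in\mathfrak g((t))$, modulo gauge transformations $A\mapsto gAg^{-1}-(\partial_tg)g^{-1}$ by $g\in G((t))$, and let $\mathrm{Loc}_G^{RS,uni}$ be the subset of classes having a representative $A$ with a pole of order at most one and unipotent monodromy. Let $\mathrm{Op}_G(D^\times)$ be the set of operators $\partial_t+\sum_i\psi_i(t)f_i+\mathbf v(t)$ with $0\neq\psi_i\in\mathbb C((t))$ and $\mathbf v\in\mathfrak b((t))$, modulo gauge transformations by $B((t))$, and let $\alpha:\mathrm{Op}_G(D^\times)\to\mathrm{Loc}_G(D^\times)$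 send a class to the class it generates. Let $\varpi:\mathfrak g\to\mathfrak g/\!/G=\mathrm{Spec}\,(\mathrm{Fun}\,\mathfrak g)^G\simeq\mathfrak h/W$ be the projection. For $c\in\mathfrak g/\!/G$ let $\mathrm{Op}^{RS}_G(D)_c\subset\mathrm{Op}_G(D^\times)$ be the set of classes of operators $\partial_t+t^{-1}(p_{-1}+\mathbf v(t))$ with $\mathbf v\in\mathfrak b[[t]]$ and $\varpi(p_{-1}+\mathbf v(0))=c$. Let $P=\{\nu\in\mathfrak h:\ \alpha_i(\nu)\in\mathbb Z\text{ for all simple roots }\alpha_i\}$ (the integral weights of the Langlands dual Lie algebra), and identify $P/W$ with the set $\varpi(P)$ of points $\varpi(\nu)$, $\nu\in P$. Then, if $\chi\in\mathrm{Op}_G(D^\times)$ and $\alpha(\chi)\in\mathrm{Loc}_G^{RS,uni}$, the oper $\chi$ belongs to $$\bigsqcup_{\nu\in P/W}\mathrm{Op}^{RS}_G(D)_{\varpi(\nu)}.$$ Moreover the sets $\mathrm{Op}^{RS}_G(D)_{\varpi(\nu)}$ with distinct $\varpi(\nu)$ are pairwise disjoint, and their union is exactly the preimage $\alpha^{-1}(\mathrm{Loc}_G^{RS,uni})$.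 -/

import Mathlib

open scoped TensorProduct ComplexOrder

noncomputable section

namespace FormalOper

section Groups

variable {ι 𝔤 : Type*} [Fintype ι] [LieRing 𝔤] [LieAlgebra ℂ 𝔤] {𝔥 : LieSubalgebra ℂ 𝔤}

/-- The nilradical `𝔫 = 𝔫₊` of the Borel subalgebra: the Lie subalgebra generated by the `eᵢ`. -/
def nilradical (b : LieAlgebra.Basis ι 𝔥) : Submodule ℂ 𝔤 :=
  (LieSubalgebra.lieSpan ℂ 𝔤 (Set.range b.e)).toSubmodule

/-- The Borel subalgebra `𝔟 = 𝔥 ⊕ 𝔫`. -/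
def borel (b : LieAlgebra.Basis ι 𝔥) : Submodule ℂ 𝔤 :=
  𝔥.toSubmodule ⊔ nilradical b

/-- `p₋₁ = ∑ fᵢ`. -/
def pMinusOne (b : LieAlgebra.Basis ι 𝔥) : 𝔤 := ∑ i, b.f i

/-- `P`, as a lattice in `𝔥`: the elements on which all simple roots (equivalently, all roots) of
`(𝔤, 𝔥)` take integral values. It is the coweight lattice of `𝔤`, that is, the cocharacter lattice
of the adjoint group of `𝔤`, that is, the weight lattice of the Langlands dual Lie algebra. -/
def coweightLattice (b : LieAlgebra.Basis ι 𝔥) : Set 𝔤 :=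
  {ν | ν ∈ 𝔥 ∧ ∀ i, ∃ n : ℤ, ⁅ν, b.e i⁆ = n • b.e i}

variable (K : Type*) [Field K] [Algebra ℂ K]

/-- `g = exp (ad x)`, where `x ∈ 𝔤(K)` is ad-nilpotent. -/
def IsAdExp {K : Type*} [Field K] [Algebra ℂ K] (x : K ⊗[ℂ] 𝔤)
    (g : (K ⊗[ℂ] 𝔤) ≃ₗ[K] (K ⊗[ℂ] 𝔤)) : Prop :=
  ∃ m : ℕ, LieAlgebra.ad K (K ⊗[ℂ] 𝔤) x ^ m = 0 ∧
    (g : Module.End K (K ⊗[ℂ] 𝔤)) =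
      ∑ n ∈ Finset.range m, (n.factorial : K)⁻¹ • LieAlgebra.ad K (K ⊗[ℂ] 𝔤) x ^ n

/-- The `K`-points `H(K) ⊂ GL(𝔤)(K)` of the maximal torus of the adjoint group of `𝔤` with Lie
algebra `𝔥`: the automorphisms of the Lie algebra `K ⊗ 𝔤` that fix `𝔥` pointwise. Such an
automorphism acts on the root space of `α` by a scalar `χ(α)`, and this identifies the group with
`Hom(Q, Kˣ)`, where `Q` is the root lattice. -/
def torusPoints (_b : LieAlgebra.Basis ι 𝔥) :
    Subgroup ((K ⊗[ℂ] 𝔤) ≃ₗ[K] (K ⊗[ℂ] 𝔤)) where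
  carrier := {g | (∀ x y, g ⁅x, y⁆ = ⁅g x, g y⁆) ∧ ∀ h ∈ 𝔥, g (1 ⊗ₜ[ℂ] h) = 1 ⊗ₜ[ℂ] h}
  mul_mem' := by
    rintro g g' ⟨h1, h2⟩ ⟨h1', h2'⟩
    refine ⟨fun x y => ?_, fun h hh => ?_⟩
    · simp only [LinearEquiv.mul_apply, h1, h1']
    · simp only [LinearEquiv.mul_apply, h2 h hh, h2' h hh]
  one_mem' := ⟨fun _ _ => rfl, fun _ _ => rfl⟩
  inv_mem' := by
    rintro g ⟨h1, h2⟩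
    refine ⟨fun x y => ?_, fun h hh => ?_⟩
    · change g.symm _ = ⁅g.symm x, g.symm y⁆
      rw [LinearEquiv.symm_apply_eq, h1, g.apply_symm_apply, g.apply_symm_apply]
    · change g.symm _ = _
      rw [LinearEquiv.symm_apply_eq, h2 h hh]

/-- The `K`-points `N(K) = exp (ad 𝔫(K))` of the unipotent radical. -/
def unipotentPoints (b : LieAlgebra.Basis ι 𝔥) :
    Subgroup ((K ⊗[ℂ] 𝔤) ≃ₗ[K] (K ⊗[ℂ] 𝔤)) :=
  Subgroup.closure {g | ∃ x ∈ (nilradical b).baseChange K, IsAdExp x g}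

/-- The `K`-points `B(K) = H(K) N(K)` of the Borel subgroup. -/
def borelPoints (b : LieAlgebra.Basis ι 𝔥) :
    Subgroup ((K ⊗[ℂ] 𝔤) ≃ₗ[K] (K ⊗[ℂ] 𝔤)) :=
  torusPoints K b ⊔ unipotentPoints K b

/-- The `K`-points `G(K) ⊂ GL(𝔤)(K)`, for a field `K`, of the algebraic group `G` of adjoint type
with Lie algebra `𝔤`. As `G` is split, `G(K)` is generated by `B(K)` together with the root
subgroups `exp (K ad fᵢ)` of the negative simple roots. -/
def adjointPoints (b : LieAlgebra.Basis ι 𝔥) :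
    Subgroup ((K ⊗[ℂ] 𝔤) ≃ₗ[K] (K ⊗[ℂ] 𝔤)) :=
  borelPoints K b ⊔ Subgroup.closure {g | ∃ (i : ι) (c : K), IsAdExp (c ⊗ₜ[ℂ] b.f i) g}

end Groups

section AdjointQuotient

variable {ι 𝔤 : Type*} [Fintype ι] [LieRing 𝔤] [LieAlgebra ℂ 𝔤] {𝔥 : LieSubalgebra ℂ 𝔤}

/-- `Fun 𝔤`, the algebra of polynomial functions on `𝔤`. -/
def polyFun (𝔤 : Type*) [LieRing 𝔤] [LieAlgebra ℂ 𝔤] : Subalgebra ℂ (𝔤 → ℂ) :=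
  Algebra.adjoin ℂ (Set.range fun φ : Module.Dual ℂ 𝔤 => (φ : 𝔤 → ℂ))

/-- `(Fun 𝔤)^G`, the algebra of polynomial functions on `𝔤` that are invariant under the adjoint
action of `G(ℂ)`. -/
def invFun (b : LieAlgebra.Basis ι 𝔥) : Subalgebra ℂ (𝔤 → ℂ) where
  carrier := {p | p ∈ polyFun 𝔤 ∧ ∀ g ∈ adjointPoints ℂ b, ∀ x y : 𝔤,
    g (1 ⊗ₜ[ℂ] x) = 1 ⊗ₜ[ℂ] y → p y = p x}
  mul_mem' := by
    rintro p q ⟨hp, hp'⟩ ⟨hq, hq'⟩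
    refine ⟨mul_mem hp hq, fun g hg x y h => ?_⟩
    rw [Pi.mul_apply, Pi.mul_apply, hp' g hg x y h, hq' g hg x y h]
  add_mem' := by
    rintro p q ⟨hp, hp'⟩ ⟨hq, hq'⟩
    refine ⟨add_mem hp hq, fun g hg x y h => ?_⟩
    rw [Pi.add_apply, Pi.add_apply, hp' g hg x y h, hq' g hg x y h]
  algebraMap_mem' c := ⟨Subalgebra.algebraMap_mem _ c, fun _ _ _ _ _ => rfl⟩

/-- The (`ℂ`-points of the) adjoint quotient `𝔤/G = Spec (Fun 𝔤)^G`, which is `𝔥/W` by Chevalley's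
restriction theorem. -/
abbrev AdjQuot (b : LieAlgebra.Basis ι 𝔥) : Type _ := invFun b →ₐ[ℂ] ℂ

/-- The projection `𝔤 → 𝔤/G`. On `𝔥` it is the projection `ϖ : 𝔥 → 𝔥/W`, so that two elements of
`𝔥` have the same image if and only if they lie in one `W`-orbit. -/
def varpi (b : LieAlgebra.Basis ι 𝔥) (x : 𝔤) : AdjQuot b :=
  (Pi.evalAlgHom ℂ (fun _ : 𝔤 => ℂ) x).comp (invFun b).val

/-- The image of `P/W` in `𝔥/W = 𝔤/G`: the set of all `ϖ(ν)`, `ν ∈ P`. -/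
def integralPoints (b : LieAlgebra.Basis ι 𝔥) : Set (AdjQuot b) :=
  varpi b '' coweightLattice b

end AdjointQuotient

section Connections

/-- The field `ℂ((t))` of formal Laurent series, as a `ℂ`-algebra with coefficientwise scalar
multiplication. -/
def Laurent : Type := LaurentSeries ℂ

namespace Laurent

instance : Field Laurent := inferInstanceAs (Field (LaurentSeries ℂ))

instance : Algebra ℂ Laurent := (HahnSeries.instAlgebra : Algebra ℂ (HahnSeries ℤ ℂ))

/-- The coordinate `t ∈ ℂ((t))`. -/
def t : Laurent := (HahnSeries.single 1 1 : LaurentSeries ℂ)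

/-- The derivation `∂_t` of `ℂ((t))`. -/
def deriv : Laurent →ₗ[ℂ] Laurent where
  toFun := LaurentSeries.derivative ℂ (V := ℂ)
  map_add' := (LaurentSeries.derivative ℂ (V := ℂ)).map_add
  map_smul' := (LaurentSeries.derivative ℂ (V := ℂ)).map_smul

/-- The inclusion `ℂ[[t]] → ℂ((t))`. -/
def ofPowerSeries : PowerSeries ℂ →ₗ[ℂ] Laurent where
  toFun := HahnSeries.ofPowerSeries ℤ ℂ
  map_add' := (HahnSeries.ofPowerSeries ℤ ℂ).map_add
  map_smul' c f := by
    change HahnSeries.ofPowerSeries ℤ ℂ (c • f) = @HSMul.hSMul ℂ (HahnSeries ℤ ℂ) (HahnSeries ℤ ℂ)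
      (@instHSMul _ _ HahnSeries.instSMul) c (HahnSeries.ofPowerSeries ℤ ℂ f)
    rw [PowerSeries.smul_eq_C_mul, map_mul, HahnSeries.ofPowerSeries_C, HahnSeries.C_mul_eq_smul]

end Laurent

variable {𝔤 : Type*} [LieRing 𝔤] [LieAlgebra ℂ 𝔤]

/-- `∂_t` acting on `𝔤((t))`. -/
def dt : (Laurent ⊗[ℂ] 𝔤) →ₗ[ℂ] (Laurent ⊗[ℂ] 𝔤) :=
  Laurent.deriv.rTensor 𝔤

/-- The gauge transformation by `g` takes `∂_t + A` to `∂_t + A'`, that is,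
`g ∘ (∂_t + ad A) ∘ g⁻¹ = ∂_t + ad A'` as operators on `𝔤((t))`. As `ad` is injective this
amounts to `A' = g A g⁻¹ - (∂_t g) g⁻¹`. -/
def IsGauge (g : (Laurent ⊗[ℂ] 𝔤) ≃ₗ[Laurent] (Laurent ⊗[ℂ] 𝔤))
    (A A' : Laurent ⊗[ℂ] 𝔤) : Prop :=
  ∀ x, g (dt x + ⁅A, x⁆) = dt (g x) + ⁅A', g x⁆

/-- Gauge equivalence under a group `S` of gauge transformations. -/
def gaugeSetoid
    (S : Subgroup ((Laurent ⊗[ℂ] 𝔤) ≃ₗ[Laurent] (Laurent ⊗[ℂ] 𝔤))) :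
    Setoid (Laurent ⊗[ℂ] 𝔤) where
  r A A' := ∃ g ∈ S, IsGauge g A A'
  iseqv :=
    { refl := fun A => ⟨1, S.one_mem, fun _ => rfl⟩
      symm := by
        rintro A A' ⟨g, hg, h⟩
        refine ⟨g⁻¹, S.inv_mem hg, fun x => ?_⟩
        change g.symm _ = dt (g.symm x) + ⁅A, g.symm x⁆
        rw [LinearEquiv.symm_apply_eq, h, g.apply_symm_apply]
      trans := by
        rintro A A' A'' ⟨g, hg, h⟩ ⟨g', hg', h'⟩
        refine ⟨g' * g, S.mul_mem hg' hg, fun x => ?_⟩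
        rw [LinearEquiv.mul_apply, LinearEquiv.mul_apply, h, h'] }

/-- The inclusion `𝔤[[t]] → 𝔤((t))`. -/
def ofIntegral : (PowerSeries ℂ ⊗[ℂ] 𝔤) →ₗ[ℂ] (Laurent ⊗[ℂ] 𝔤) :=
  Laurent.ofPowerSeries.rTensor 𝔤

/-- The evaluation `𝔤[[t]] → 𝔤` at `t = 0`. -/
def evalZero : (PowerSeries ℂ ⊗[ℂ] 𝔤) →ₗ[ℂ] 𝔤 :=
  (TensorProduct.lid ℂ 𝔤).toLinearMap ∘ₗ
    (PowerSeries.coeff (R := ℂ) 0).rTensor 𝔤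

/-- `A` has a pole of order at most one. -/
def HasSimplePole (A : Laurent ⊗[ℂ] 𝔤) : Prop :=
  ∃ X : PowerSeries ℂ ⊗[ℂ] 𝔤, A = Laurent.t⁻¹ • ofIntegral X

end Connections

section Monodromy

/-- A ring of multivalued series `∑ₐ pₐ(log t) t^a`, where `a ∈ ℂ` and `pₐ` is a polynomial, in which
every connection with regular singularity has a fundamental solution. (Exponents are ordered by
`a ≤ a'` if and only if `a' - a` is a non-negative real number.) -/
def MultiSeries : Type := HahnSeries ℂ (Polynomial ℂ)

namespace MultiSeries

instance : CommRing MultiSeries := inferInstanceAs (CommRing (HahnSeries ℂ (Polynomial ℂ)))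

instance : Algebra ℂ MultiSeries :=
  (HahnSeries.instAlgebra : Algebra ℂ (HahnSeries ℂ (Polynomial ℂ)))

/-- The coefficient `pₐ` of `t^a`. -/
def coeff (f : MultiSeries) (a : ℂ) : Polynomial ℂ := HahnSeries.coeff f a

@[ext] theorem ext {f g : MultiSeries} (h : ∀ a, f.coeff a = g.coeff a) : f = g :=
  HahnSeries.ext (funext h)

theorem coeff_add (f g : MultiSeries) (a : ℂ) : (f + g).coeff a = f.coeff a + g.coeff a := rfl

theorem coeff_smul (c : ℂ) (f : MultiSeries) (a : ℂ) : (c • f).coeff a = c • f.coeff a := rfl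

/-- An operator on series given by a family of linear operators on coefficients. -/
def coeffwise (T : ℂ → Polynomial ℂ →ₗ[ℂ] Polynomial ℂ) : MultiSeries →ₗ[ℂ] MultiSeries where
  toFun f := (
    { coeff := fun a => T a (f.coeff a)
      isPWO_support' := (HahnSeries.isPWO_support f).mono fun a ha h0 =>
        ha ((congrArg (T a) h0).trans (map_zero (T a))) } : HahnSeries ℂ (Polynomial ℂ))
  map_add' f g := ext fun a => by
    change T a ((f + g).coeff a) = T a (f.coeff a) + T a (g.coeff a)
    rw [coeff_add, map_add]
  map_smul' c f := ext fun a => by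
    change T a ((c • f).coeff a) = c • T a (f.coeff a)
    rw [coeff_smul, map_smul]

/-- The derivation `t d/dt`, with `t d/dt (t^a) = a t^a` and `t d/dt (log t) = 1`. -/
def tdt : MultiSeries →ₗ[ℂ] MultiSeries :=
  coeffwise fun a => a • LinearMap.id + Polynomial.derivative

/-- Analytic continuation once around `t = 0`: `t^a ↦ exp (2πia) t^a`, `log t ↦ log t + 2πi`. -/
def continuation : MultiSeries →ₗ[ℂ] MultiSeries :=
  coeffwise fun a => Complex.exp (2 * Real.pi * Complex.I * a) •
    (Polynomial.aeval (Polynomial.X + Polynomial.C (2 * Real.pi * Complex.I) :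
      Polynomial ℂ)).toLinearMap

/-- The inclusion of `ℂ((t))` into the ring of multivalued series. -/
def ofLaurent : Laurent →ₗ[ℂ] MultiSeries where
  toFun f := (((HahnSeries.embDomain ⟨⟨fun n : ℤ => (n : ℂ), Int.cast_injective⟩, Int.cast_le⟩
    (f : LaurentSeries ℂ)).map (Polynomial.C : ℂ →+* Polynomial ℂ)) : HahnSeries ℂ (Polynomial ℂ))
  map_add' f g := by
    refine Eq.trans (congrArg (fun h : HahnSeries ℂ ℂ => h.map (Polynomial.C : ℂ →+* Polynomial ℂ))
      (HahnSeries.embDomain_add _ (f : LaurentSeries ℂ) g)) (HahnSeries.ext ?_)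
    funext a
    exact Polynomial.C_add
  map_smul' c f := by
    refine Eq.trans (congrArg (fun h : HahnSeries ℂ ℂ => h.map (Polynomial.C : ℂ →+* Polynomial ℂ))
      (HahnSeries.embDomain_smul _ c (f : LaurentSeries ℂ))) (HahnSeries.ext ?_)
    funext a
    exact (Polynomial.smul_C c _).symm

end MultiSeries

variable {𝔤 : Type*} [LieRing 𝔤] [LieAlgebra ℂ 𝔤]

/-- `Φ` is a fundamental solution, in the adjoint representation, of the connection `∂_t + A`: it
is invertible, and `Φ(x)` is annihilated by `t (∂_t + ad A)` for every constant vector `x ∈ 𝔤`. -/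
def IsFundamental (A : Laurent ⊗[ℂ] 𝔤)
    (Φ : (MultiSeries ⊗[ℂ] 𝔤) ≃ₗ[MultiSeries] (MultiSeries ⊗[ℂ] 𝔤)) : Prop :=
  ∀ x : 𝔤, MultiSeries.tdt.rTensor 𝔤 (Φ (1 ⊗ₜ[ℂ] x)) +
    ⁅MultiSeries.ofLaurent.rTensor 𝔤 (Laurent.t • A), Φ (1 ⊗ₜ[ℂ] x)⁆ = 0

/-- `M ∈ GL(𝔤)` is the monodromy of the fundamental solution `Φ`: the analytic continuation of `Φ`
around `t = 0` is `Φ M`. -/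
def IsMonodromy (Φ : (MultiSeries ⊗[ℂ] 𝔤) ≃ₗ[MultiSeries] (MultiSeries ⊗[ℂ] 𝔤))
    (M : 𝔤 ≃ₗ[ℂ] 𝔤) : Prop :=
  ∀ x : 𝔤, MultiSeries.continuation.rTensor 𝔤 (Φ (1 ⊗ₜ[ℂ] x)) = Φ (1 ⊗ₜ[ℂ] M x)

/-- The monodromy of `∂_t + A` is unipotent. Different fundamental solutions have conjugate
monodromies. The adjoint representation of a group of adjoint type is faithful, so that an element
of the group is unipotent if and only if it is unipotent in `GL(𝔤)`. -/
def HasUnipotentMonodromy (A : Laurent ⊗[ℂ] 𝔤) : Prop :=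
  ∃ (Φ : (MultiSeries ⊗[ℂ] 𝔤) ≃ₗ[MultiSeries] (MultiSeries ⊗[ℂ] 𝔤)) (M : 𝔤 ≃ₗ[ℂ] 𝔤),
    IsFundamental A Φ ∧ IsMonodromy Φ M ∧ IsNilpotent ((M : Module.End ℂ 𝔤) - 1)

end Monodromy

section Opers

variable {ι 𝔤 : Type*} [Fintype ι] [LieRing 𝔤] [LieAlgebra ℂ 𝔤] {𝔥 : LieSubalgebra ℂ 𝔤}

/-- `Loc_G(D^×)`: the connections `∂_t + A`, `A ∈ 𝔤((t))`, modulo `G((t))`. -/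
def Loc (b : LieAlgebra.Basis ι 𝔥) : Type _ :=
  Quotient (gaugeSetoid (adjointPoints (Laurent) b))

/-- `Loc_G^{RS,uni}`: the local systems with regular singularity (some representative has a pole of
order at most one) and unipotent monodromy. -/
def LocRSuni (b : LieAlgebra.Basis ι 𝔥) : Set (Loc b) :=
  {σ | ∃ A, HasSimplePole A ∧ HasUnipotentMonodromy A ∧
    Quotient.mk (gaugeSetoid (adjointPoints (Laurent) b)) A = σ}

/-- The oper condition: `A = ∑ ψᵢ(t) fᵢ + v(t)` with all `ψᵢ ∈ ℂ((t))` non-zero and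
`v ∈ 𝔟((t))`. -/
def IsOperForm (b : LieAlgebra.Basis ι 𝔥) (A : Laurent ⊗[ℂ] 𝔤) : Prop :=
  ∃ ψ : ι → Laurent, (∀ i, ψ i ≠ 0) ∧
    ∃ v ∈ (borel b).baseChange (Laurent), A = ∑ i, ψ i ⊗ₜ[ℂ] b.f i + v

/-- The `B((t))`-gauge equivalence on operators satisfying the oper condition. -/
def operSetoid (b : LieAlgebra.Basis ι 𝔥) : Setoid {A // IsOperForm b A} :=
  (gaugeSetoid (borelPoints (Laurent) b)).comap Subtype.val

/-- `Op_G(D^×)`: the operators `∂_t + ∑ ψᵢ(t) fᵢ + v(t)` as above, modulo `B((t))`. -/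
def Op (b : LieAlgebra.Basis ι 𝔥) : Type _ := Quotient (operSetoid b)

/-- The map `α : Op_G(D^×) → Loc_G(D^×)` taking an oper to the underlying local system. -/
def toLoc (b : LieAlgebra.Basis ι 𝔥) : Op b → Loc b :=
  Quotient.map' Subtype.val fun _ _ ⟨g, hg, h⟩ => ⟨g, Subgroup.mem_sup_left hg, h⟩

/-- `Op_G^{RS}(D)_c`, as a subset of `Op_G(D^×)`: the opers with regular singularity and residue
`c ∈ 𝔤/G`, that is, the classes of operators `∂_t + t⁻¹ (p₋₁ + v(t))` with `v ∈ 𝔟[[t]]` such that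
`p₋₁ + v(0)` projects to `c`. -/
def OpRS (b : LieAlgebra.Basis ι 𝔥) (c : AdjQuot b) : Set (Op b) :=
  {χ | ∃ (A : {A // IsOperForm b A}), ∃ v ∈ (borel b).baseChange (PowerSeries ℂ),
    A.1 = Laurent.t⁻¹ • ((1 : Laurent) ⊗ₜ[ℂ] pMinusOne b + ofIntegral v) ∧
    varpi b (pMinusOne b + evalZero v) = c ∧
    Quotient.mk (operSetoid b) A = χ}

end Opers

end FormalOper

end

/-!
Three facts have to be established: an oper whose local system has regular singularity is an oper
with regular singularity; its residue in `𝔤/G` is well defined; and the monodromy is unipotent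
exactly if the residue lies in the image of `P`.

**Normal form.** Let `A` be an oper that a gauge transformation by `g ∈ G((t))` takes to a connection
with a simple pole. By the Iwasawa decomposition `G((t)) = B((t)) G[[t]]` (`exists_iwasawa`) one may
take `g ∈ B((t))`, since `G[[t]]` preserves connections with a simple pole. The decomposition reduces
to the one for `SL₂`, for the simple roots. Powers of fundamental coweights then turn the coefficients
of the `fᵢ` into `t⁻¹`, which gives a representative `t⁻¹ (p₋₁ + v)` with `v ∈ 𝔟[[t]]`
(`exists_normalForm_of_isGauge`).

**Residues.** Consider a gauge transformation by `B((t))` between two such representatives. Its torus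
part is trivial, as seen from the coefficients of the `fᵢ`. Grade `𝔤` by height, by means of the
coweight `ρ` with `αᵢ(ρ) = 1`. The bracket with `p₋₁` is injective in positive degrees, so the leading
term of the transformation is recovered from the two connections and is integral
(`exists_integral_leading_term`). Splitting off its exponential does not change the projection of the
residue to `𝔤/G`, and raises the degree; as `𝔫` is nilpotent, this ends (`varpi_eq_of_isGauge`). This
proves that the sets of opers with distinct residues are disjoint.

**Integral points.** The coefficients of the characteristic polynomial of `ad x` are invariant
functions of `x`. Hence the property that all eigenvalues of `ad x` are integers depends only on the
image of `x` in `𝔤/G` (`hasIntegralSpectrum_of_varpi_eq`), and for `x ∈ 𝔥` it means that `x ∈ P`. It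
remains to see that the image of `x = p₋₁ + β`, `β ∈ 𝔟`, is the image of an element of `𝔥`.
Polynomial functions on `𝔥` are integral over the invariant functions on `𝔤`, because the simple
roots are roots of the characteristic polynomial of `ad`. By lying over, the image of `𝔥` in `𝔤/G`
is therefore given by the vanishing of the invariant functions `q` with `q = 0` on `𝔥`
(`exists_varpi_eq`). Such a `q` vanishes on `p₋₁ + 𝔟` (`invFun_pMinusOne_add`): along the curve
`ρ + s (p₋₁ + β - ρ)`, which takes the value `p₋₁ + β` at `s = 1`, conjugation by elements of `N`
moves the component in `𝔫` to arbitrarily high order in `s`. Dropping it leaves a point of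
`s p₋₁ + 𝔥`, which the torus contracts to a point of `𝔥`, so that `q` vanishes there. Thus the
polynomial `q (ρ + s (p₋₁ + β - ρ))` in `s` vanishes to infinite order at `s = 0`.

**Monodromy.** Let `A = t⁻¹ W` with `W ∈ 𝔤[[t]]`. By the Frobenius method an eigenvector or generalized
eigenvector of `ad W(0)` with eigenvalue `μ` is the leading coefficient of some `Y ∈ 𝔤[[t]]` that is
annihilated by a power of `T = t d/dt + ad W - μ` (`exists_shiftedConn_pow_eq_zero`). In particular
`T` has a nonzero kernel for each eigenvalue `μ`, which gives a horizontal section in `t^{-μ} 𝔤[[t]]`.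
Continuation around `t = 0` multiplies it by `exp (-2πiμ)`, so that `μ ∈ ℤ` if the monodromy is
unipotent (`hasIntegralSpectrum_of_isGauge`). Conversely, suppose that all `μ` are integers. The
sections `t^{-μ} exp (-log t · T) Y` are horizontal, and continuation minus the identity lowers their
degree in `log t`. That they form a basis is seen from the invertibility of their Gram matrix for
the Killing form: this matrix is constant, so it may be computed at `log t = 0`, where the sections
become `t^{-μ} Y`, and the values `Y(0)` form a basis of `𝔤` (`hasUnipotentMonodromy_conn`).
-/

open scoped TensorProduct ComplexOrder

noncomputable section

namespace FormalOper

/-! ### Exponentials of ad-nilpotent elements -/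

section Exponential

variable {K L : Type*} [Field K] [LieRing L] [LieAlgebra K L]

variable (K L) in
/-- The group of automorphisms of the Lie algebra `L`, inside `GL(L)`. -/
def lieAut : Subgroup (L ≃ₗ[K] L) where
  carrier := {g | ∀ x y, g ⁅x, y⁆ = ⁅g x, g y⁆}
  mul_mem' h h' x y := by simp only [LinearEquiv.mul_apply, h' x y, h (_) (_)]
  one_mem' _ _ := rfl
  inv_mem' {g} h x y := by
    change g.symm _ = ⁅g.symm x, g.symm y⁆
    rw [LinearEquiv.symm_apply_eq, h, g.apply_symm_apply, g.apply_symm_apply]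

theorem lieAut.map_lie {g : L ≃ₗ[K] L} (hg : g ∈ lieAut K L) (x y : L) : g ⁅x, y⁆ = ⁅g x, g y⁆ :=
  hg x y

theorem ad_pow_mem {x : L} {S : Submodule K L} (hS : ∀ y ∈ S, ⁅x, y⁆ ∈ S) {y : L} (hy : y ∈ S) (n : ℕ) :
    (LieAlgebra.ad K L x ^ n) y ∈ S := by
  induction n with
  | zero => simpa
  | succ n ih => rw [pow_succ']; exact hS _ ih

theorem lieAut.ad_pow {g : L ≃ₗ[K] L} (hg : g ∈ lieAut K L) (x y : L) (n : ℕ) :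
    (LieAlgebra.ad K L (g x) ^ n) (g y) = g ((LieAlgebra.ad K L x ^ n) y) := by
  induction n with
  | zero => simp
  | succ n ih =>
    rw [pow_succ', pow_succ', Module.End.mul_apply, ih, Module.End.mul_apply, LieAlgebra.ad_apply,
      LieAlgebra.ad_apply, lieAut.map_lie hg]

theorem lieAut.ad_pow_eq_zero {g : L ≃ₗ[K] L} (hg : g ∈ lieAut K L) {x : L} {n : ℕ}
    (h : LieAlgebra.ad K L x ^ n = 0) : LieAlgebra.ad K L (g x) ^ n = 0 := by
  ext y
  obtain ⟨y, rfl⟩ := g.surjective y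
  rw [lieAut.ad_pow hg, h]
  simp

theorem lieAut.isNilpotent_ad {g : L ≃ₗ[K] L} (hg : g ∈ lieAut K L) {x : L}
    (h : IsNilpotent (LieAlgebra.ad K L x)) : IsNilpotent (LieAlgebra.ad K L (g x)) :=
  let ⟨n, hn⟩ := h
  ⟨n, lieAut.ad_pow_eq_zero hg hn⟩

variable [CharZero K]

theorem exists_linearEquiv_eq_adExp {x : L} (hx : IsNilpotent (LieAlgebra.ad K L x)) :
    ∃ g ∈ lieAut K L, ∀ m, LieAlgebra.ad K L x ^ m = 0 → (g : Module.End K L) =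
      ∑ n ∈ Finset.range m, (n.factorial : K)⁻¹ • LieAlgebra.ad K L x ^ n := by
  let _ : Module ℚ L := Module.compHom L (algebraMap ℚ K)
  have _ : IsScalarTower ℚ K L := IsScalarTower.of_algebraMap_smul fun _ _ => rfl
  have h_smul (c : ℚ) (y z : L) : ⁅y, c • z⁆ = c • ⁅y, z⁆ := by
    rw [← algebraMap_smul K c z, lie_smul, algebraMap_smul]
  let _ : LieAlgebra ℚ L := { lie_smul := h_smul }
  have hx' : IsNilpotent (LieDerivation.ad K L x).toLinearMap := by
    rwa [LieDerivation.coe_ad_apply_eq_ad_apply]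
  refine ⟨(LieDerivation.exp (LieDerivation.ad K L x) hx').toLinearEquiv,
    fun y z => LieEquiv.map_lie _ y z, fun m hm => ?_⟩
  ext y
  change LieDerivation.exp (LieDerivation.ad K L x) hx' y = _
  rw [LieDerivation.exp_map_apply]
  rw [LieDerivation.coe_ad_apply_eq_ad_apply, IsNilpotent.exp_eq_sum hm,
    LinearMap.sum_apply, LinearMap.sum_apply]
  refine Finset.sum_congr rfl fun n _ => ?_
  rw [LinearMap.smul_apply, LinearMap.smul_apply, ← algebraMap_smul K]
  simp

/-- `exp (ad x)`, for an ad-nilpotent element `x` of a Lie algebra in characteristic zero. -/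
def adExp (x : L) (hx : IsNilpotent (LieAlgebra.ad K L x)) : L ≃ₗ[K] L :=
  (exists_linearEquiv_eq_adExp hx).choose

variable {x : L} (hx : IsNilpotent (LieAlgebra.ad K L x))

theorem adExp_mem_lieAut : adExp x hx ∈ lieAut K L :=
  (exists_linearEquiv_eq_adExp hx).choose_spec.1

theorem coe_adExp {m : ℕ} (hm : LieAlgebra.ad K L x ^ m = 0) :
    (adExp x hx : Module.End K L) =
      ∑ n ∈ Finset.range m, (n.factorial : K)⁻¹ • LieAlgebra.ad K L x ^ n :=
  (exists_linearEquiv_eq_adExp hx).choose_spec.2 m hm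

theorem adExp_apply {m : ℕ} (hm : LieAlgebra.ad K L x ^ m = 0) (y : L) :
    adExp x hx y = ∑ n ∈ Finset.range m, (n.factorial : K)⁻¹ • (LieAlgebra.ad K L x ^ n) y := by
  have := LinearMap.congr_fun (coe_adExp hx hm) y
  simpa using! this

theorem adExp_mem {S : Submodule K L} (hS : ∀ y ∈ S, ⁅x, y⁆ ∈ S) {y : L} (hy : y ∈ S) :
    adExp x hx y ∈ S := by
  obtain ⟨m, hm⟩ := hx
  rw [adExp_apply ⟨m, hm⟩ hm]
  exact Submodule.sum_mem _ fun n _ => S.smul_mem _ (ad_pow_mem hS hy n)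

theorem adExp_sub_mem {S : Submodule K L} (hS : ∀ y ∈ S, ⁅x, y⁆ ∈ S) {y : L} (hy : ⁅x, y⁆ ∈ S) :
    adExp x hx y - y ∈ S := by
  obtain ⟨m, hm⟩ := hx
  have hm' : LieAlgebra.ad K L x ^ (m + 1) = 0 := by rw [pow_succ, hm, zero_mul]
  rw [adExp_apply ⟨m, hm⟩ hm', Finset.sum_range_succ']
  simp only [Nat.factorial_zero, Nat.cast_one, inv_one, pow_zero, one_smul, Module.End.one_apply,
    add_sub_cancel_right]
  refine Submodule.sum_mem _ fun n _ => S.smul_mem _ ?_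
  rw [pow_succ, Module.End.mul_apply]
  exact ad_pow_mem hS hy n

theorem adExp_sub_sub_mem {S : Submodule K L} (hS : ∀ y ∈ S, ⁅x, y⁆ ∈ S) {y : L}
    (hy : ⁅x, ⁅x, y⁆⁆ ∈ S) : adExp x hx y - y - ⁅x, y⁆ ∈ S := by
  obtain ⟨m, hm⟩ := hx
  have hm' : LieAlgebra.ad K L x ^ (m + 2) = 0 := by rw [pow_add, hm, zero_mul]
  rw [adExp_apply ⟨m, hm⟩ hm', Finset.sum_range_succ', Finset.sum_range_succ']
  simp only [Nat.factorial_zero, Nat.cast_one, inv_one, pow_zero, one_smul, Module.End.one_apply,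
    zero_add, Nat.factorial_one, pow_one, LieAlgebra.ad_apply, add_sub_cancel_right]
  refine Submodule.sum_mem _ fun n _ => S.smul_mem _ ?_
  rw [pow_succ, pow_succ, Module.End.mul_apply, Module.End.mul_apply]
  exact ad_pow_mem hS hy n

theorem adExp_apply_of_lie_eq_zero {y : L} (hy : ⁅x, y⁆ = 0) : adExp x hx y = y := by
  have := adExp_sub_mem hx (S := ⊥) (y := y) (by simp) (by simpa using hy)
  simpa [sub_eq_zero] using this

theorem adExp_apply_of_lie_lie_eq_zero {y : L} (hy : ⁅x, ⁅x, y⁆⁆ = 0) :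
    adExp x hx y = y + ⁅x, y⁆ := by
  have := adExp_sub_sub_mem hx (S := ⊥) (y := y) (by simp) (by simpa using hy)
  rw [Submodule.mem_bot, sub_sub, sub_eq_zero] at this
  exact this

theorem adExp_apply_of_lie_lie_lie_eq_zero {y : L} (hy : ⁅x, ⁅x, ⁅x, y⁆⁆⁆ = 0) :
    adExp x hx y = y + ⁅x, y⁆ + (2 : K)⁻¹ • ⁅x, ⁅x, y⁆⁆ := by
  obtain ⟨m, hm⟩ := hx
  have hm' : LieAlgebra.ad K L x ^ (m + 3) = 0 := by rw [pow_add, hm, zero_mul]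
  rw [adExp_apply ⟨m, hm⟩ hm', Finset.sum_range_succ', Finset.sum_range_succ',
    Finset.sum_range_succ', Finset.sum_eq_zero]
  · simp [pow_succ]; abel
  · intro n _
    rw [pow_succ, pow_succ, pow_succ, Module.End.mul_apply, Module.End.mul_apply,
      Module.End.mul_apply]
    simp [hy]

theorem adExp_add {y : L} (hy : IsNilpotent (LieAlgebra.ad K L y)) (hxy : ⁅x, y⁆ = 0)
    (h : IsNilpotent (LieAlgebra.ad K L (x + y))) :
    adExp (x + y) h = adExp x hx * adExp y hy := by
  let _ : Module ℚ L := Module.compHom L (algebraMap ℚ K)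
  have _ : IsScalarTower ℚ K L := IsScalarTower.of_algebraMap_smul fun _ _ => rfl
  have key : ∀ (z : L) (hz : IsNilpotent (LieAlgebra.ad K L z)),
      (adExp z hz : Module.End K L) = IsNilpotent.exp (LieAlgebra.ad K L z) := by
    intro z hz
    obtain ⟨m, hm⟩ := id hz
    rw [coe_adExp _ hm, IsNilpotent.exp_eq_sum hm]
    refine Finset.sum_congr rfl fun n _ => ?_
    ext y
    rw [LinearMap.smul_apply, LinearMap.smul_apply, ← algebraMap_smul K (_ : ℚ)]
    simp
  apply LinearEquiv.toLinearMap_injective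
  change (adExp (x + y) h : Module.End K L) = (adExp x hx : Module.End K L) * adExp y hy
  rw [key, key, key, map_add, IsNilpotent.exp_add_of_commute _ hx hy]
  ext z
  simp only [Module.End.mul_apply, LieAlgebra.ad_apply]
  rw [leibniz_lie, hxy, zero_lie, zero_add]

theorem adExp_zero (h : IsNilpotent (LieAlgebra.ad K L 0)) : adExp (0 : L) h = 1 := by
  ext y
  exact adExp_apply_of_lie_eq_zero h (by simp)

theorem adExp_neg (h : IsNilpotent (LieAlgebra.ad K L (-x))) :
    adExp (-x) h = (adExp x hx)⁻¹ := by
  have h0 : IsNilpotent (LieAlgebra.ad K L (x + -x)) := by simp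
  rw [eq_inv_iff_mul_eq_one, ← adExp_add h hx (by simp) (by simp), ← adExp_zero (K := K) (by simp)]
  congr 1
  simp

theorem lieAut.mul_adExp {g : L ≃ₗ[K] L} (hg : g ∈ lieAut K L) :
    g * adExp x hx = adExp (g x) (lieAut.isNilpotent_ad hg hx) * g := by
  obtain ⟨m, hm⟩ := id hx
  ext y
  rw [LinearEquiv.mul_apply, LinearEquiv.mul_apply, adExp_apply _ hm,
    adExp_apply _ (lieAut.ad_pow_eq_zero hg hm), map_sum]
  simp only [map_smul, lieAut.ad_pow hg]

end Exponential

/-! ### Gradings defined by an ad-diagonalizable element with integral eigenvalues -/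

section Grading

variable {K L : Type*} [Field K] [LieRing L] [LieAlgebra K L]

/-- The degree `k` part of the grading of `L` by the eigenvalues of `ad D`. -/
def wt (D : L) (k : ℤ) : Submodule K L := (LieAlgebra.ad K L D).eigenspace (k : K)

/-- The filtration by the sums of the parts of degree at least `k`. -/
def filt (D : L) (k : ℤ) : Submodule K L := ⨆ j, ⨆ (_ : k ≤ j), wt D j

variable (K) in
/-- `ad D` is diagonalizable, with integral eigenvalues. -/
def IsGrading (D : L) : Prop := ⨆ k, wt (K := K) D k = ⊤

variable {D x y : L} {i j k l : ℤ}

theorem mem_wt : x ∈ wt (K := K) D k ↔ ⁅D, x⁆ = (k : K) • x := by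
  rw [wt, Module.End.mem_eigenspace_iff, LieAlgebra.ad_apply]

theorem mem_wt_zero : x ∈ wt (K := K) D 0 ↔ ⁅D, x⁆ = 0 := by
  rw [mem_wt, Int.cast_zero, zero_smul]

theorem lie_mem_wt (hx : x ∈ wt (K := K) D i) (hy : y ∈ wt (K := K) D j) :
    ⁅x, y⁆ ∈ wt (K := K) D (i + j) := by
  rw [mem_wt] at *
  rw [leibniz_lie, hx, hy, smul_lie, lie_smul, ← add_smul, Int.cast_add]

theorem wt_le_filt (h : k ≤ j) : wt (K := K) D j ≤ filt D k :=
  le_iSup₂_of_le j h le_rfl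

theorem filt_anti (h : k ≤ l) : filt (K := K) D l ≤ filt D k :=
  iSup₂_le fun _ hj => wt_le_filt (h.trans hj)

theorem filt_induction {p : (x : L) → x ∈ filt (K := K) D k → Prop} (zero : p 0 (zero_mem _))
    (add : ∀ x y hx hy, p x hx → p y hy → p (x + y) (add_mem hx hy))
    (wt : ∀ j (hj : k ≤ j) x (hx : x ∈ wt (K := K) D j), p x (wt_le_filt hj hx))
    {x : L} (hx : x ∈ filt (K := K) D k) : p x hx := by
  refine Submodule.iSup_induction' (motive := fun x hx => ∃ h, p x h)
    (fun j => ⨆ (_ : k ≤ j), FormalOper.wt (K := K) D j) ?_ ⟨_, zero⟩ ?_ hx |>.choose_spec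
  · intro j x hx
    by_cases hj : k ≤ j
    · rw [iSup_pos hj] at hx
      exact ⟨_, wt j hj x hx⟩
    · rw [iSup_neg hj, Submodule.mem_bot] at hx
      subst hx
      exact ⟨_, zero⟩
  · rintro x y _ _ ⟨hx, hx'⟩ ⟨hy, hy'⟩
    exact ⟨_, add x y hx hy hx' hy'⟩

theorem filt_le {S : Submodule K L} (h : ∀ j, k ≤ j → wt (K := K) D j ≤ S) : filt D k ≤ S :=
  iSup₂_le h

theorem filt_eq_sup : filt (K := K) D k = wt D k ⊔ filt D (k + 1) := by
  refine le_antisymm (filt_le fun j hj => ?_) (sup_le (wt_le_filt le_rfl) (filt_anti (by omega)))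
  obtain rfl | hj := hj.eq_or_lt
  · exact le_sup_left
  · exact (wt_le_filt (by omega)).trans le_sup_right

theorem exists_wt_add_filt (hx : x ∈ filt (K := K) D k) :
    ∃ y ∈ wt (K := K) D k, ∃ z ∈ filt (K := K) D (k + 1), x = y + z := by
  rw [filt_eq_sup] at hx
  obtain ⟨y, hy, z, hz, rfl⟩ := Submodule.mem_sup.1 hx
  exact ⟨y, hy, z, hz, rfl⟩

theorem lie_mem_filt (hx : x ∈ filt (K := K) D i) (hy : y ∈ filt (K := K) D j) :
    ⁅x, y⁆ ∈ filt (K := K) D (i + j) := by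
  induction hx using filt_induction with
  | zero => simp
  | add x x' _ _ hx hx' => rw [add_lie]; exact add_mem hx hx'
  | wt k hk x hx =>
    induction hy using filt_induction with
    | zero => simp
    | add y y' _ _ hy hy' => rw [lie_add]; exact add_mem hy hy'
    | wt l hl y hy => exact wt_le_filt (by omega) (lie_mem_wt hx hy)

theorem lie_mem_filt' (hx : x ∈ filt (K := K) D i) (hy : y ∈ filt (K := K) D j) (h : k ≤ i + j) :
    ⁅x, y⁆ ∈ filt (K := K) D k :=
  filt_anti h (lie_mem_filt hx hy)

theorem self_mem_wt : D ∈ wt (K := K) D 0 := by simp [mem_wt_zero]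

theorem self_mem_filt : D ∈ filt (K := K) D 0 := wt_le_filt le_rfl self_mem_wt

theorem wt_neg : wt (K := K) (-D) k = wt D (-k) := by
  ext x
  rw [mem_wt, mem_wt, neg_lie, Int.cast_neg, neg_smul, neg_eq_iff_eq_neg]

theorem lieAut.map_wt {g : L ≃ₗ[K] L} (hg : g ∈ lieAut K L) (hD : g D = D)
    (hx : x ∈ wt (K := K) D k) : g x ∈ wt (K := K) D k := by
  rw [mem_wt] at *
  nth_rw 1 [← hD]
  rw [← lieAut.map_lie hg, hx, map_smul]

theorem lieAut.map_filt {g : L ≃ₗ[K] L} (hg : g ∈ lieAut K L) (hD : g D = D)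
    (hx : x ∈ filt (K := K) D k) : g x ∈ filt (K := K) D k := by
  induction hx using filt_induction with
  | zero => simp
  | add x x' _ _ hx hx' => rw [map_add]; exact add_mem hx hx'
  | wt k hk x hx => exact wt_le_filt hk (lieAut.map_wt hg hD hx)

variable [CharZero K]

theorem iSupIndep_wt (D : L) : iSupIndep fun k => wt (K := K) D k :=
  (Module.End.eigenspaces_iSupIndep (LieAlgebra.ad K L D)).comp
    (f := fun k : ℤ => (k : K)) Int.cast_injective

theorem disjoint_filt_of_lt : Disjoint (filt (K := K) D k) (⨆ j, ⨆ (_ : j < k), wt D j) := by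
  have := (iSupIndep_wt (K := K) D).disjoint_biSup_biSup (s := {j | k ≤ j}) (t := {j | j < k})
    (by rw [Set.disjoint_left]; intro a; simp)
  exact this

theorem disjoint_wt_filt (h : j < k) : Disjoint (wt (K := K) D j) (filt D k) :=
  (disjoint_filt_of_lt.mono_right (le_iSup₂_of_le j h le_rfl)).symm

theorem eq_zero_of_mem_wt_of_mem_filt (h : j < k) (hx : x ∈ wt (K := K) D j)
    (hx' : x ∈ filt (K := K) D k) : x = 0 :=
  Submodule.disjoint_def.1 (disjoint_wt_filt h) x hx hx'

/-- An eigenvector modulo a step of the filtration, for a degree below that step. -/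
theorem mem_filt_of_lie_sub_mem {m : ℤ} (hjk : j < k) (hx : x ∈ filt (K := K) D k)
    (h : ⁅D, x⁆ - (j : K) • x ∈ filt (K := K) D m) : x ∈ filt (K := K) D m := by
  obtain hmk | hmk := le_total m k
  · exact filt_anti hmk hx
  induction m, hmk using Int.leInduction with
  | base => exact hx
  | succ m hm ih =>
    have hxm := ih (filt_anti (by omega) h)
    obtain ⟨y, hy, z, hz, rfl⟩ := exists_wt_add_filt hxm
    have h1 : ((m : K) - j) • y ∈ filt (K := K) D (m + 1) := by
      have h2 : ⁅D, z⁆ - (j : K) • z ∈ filt (K := K) D (m + 1) :=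
        sub_mem (lie_mem_filt' self_mem_filt hz (by omega)) (Submodule.smul_mem _ _ hz)
      have h3 := sub_mem h h2
      rw [lie_add, mem_wt.1 hy] at h3
      convert h3 using 1
      module
    have h4 : ((m : K) - j) • y = 0 :=
      eq_zero_of_mem_wt_of_mem_filt (lt_add_one m) (Submodule.smul_mem _ _ hy) h1
    have h5 : (m : K) - j ≠ 0 := by
      rw [sub_ne_zero]
      exact_mod_cast (by omega : m ≠ j)
    rw [(smul_eq_zero_iff_right h5).1 h4, zero_add]
    exact hz

/-- The automorphism acting on the degree `k` part of a grading by `c ^ k`. -/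
theorem IsGrading.exists_scaling (hD : IsGrading K D) {c : K} (hc : c ≠ 0) :
    ∃ g ∈ lieAut K L, ∀ k, ∀ x ∈ wt (K := K) D k, g x = c ^ k • x := by
  have hint : DirectSum.IsInternal fun k => wt (K := K) D k :=
    DirectSum.isInternal_submodule_of_iSupIndep_of_iSup_eq_top (iSupIndep_wt D) hD
  let e := LinearEquiv.ofBijective (DirectSum.coeLinearMap fun k => wt (K := K) D k) hint
  let s : (DirectSum ℤ fun k => wt (K := K) D k) ≃ₗ[K] DirectSum ℤ fun k => wt (K := K) D k :=
    DFinsupp.mapRange.linearEquiv fun k =>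
      LinearEquiv.smulOfNeZero K (wt (K := K) D k) (c ^ k) (zpow_ne_zero k hc)
  let g : L ≃ₗ[K] L := (e.symm.trans s).trans e
  have hg (k : ℤ) (x : L) (hx : x ∈ wt (K := K) D k) : g x = c ^ k • x := by
    have hex : e (DirectSum.lof K ℤ (fun k => wt (K := K) D k) k ⟨x, hx⟩) = x := by
      exact DirectSum.coeLinearMap_lof (A := fun k => wt (K := K) D k) k ⟨x, hx⟩
    have hsx : s (DirectSum.lof K ℤ (fun k => wt (K := K) D k) k ⟨x, hx⟩) =
        c ^ k • DirectSum.lof K ℤ (fun k => wt (K := K) D k) k ⟨x, hx⟩ := by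
      rw [← map_smul]
      exact DFinsupp.mapRange_single (hf := fun _ => map_zero _)
    change e (s (e.symm x)) = _
    conv_lhs => rw [← hex, e.symm_apply_apply, hsx, map_smul, hex]
  refine ⟨g, fun x y => ?_, hg⟩
  have hx : x ∈ ⨆ k, wt (K := K) D k := hD ▸ Submodule.mem_top
  have hy : y ∈ ⨆ k, wt (K := K) D k := hD ▸ Submodule.mem_top
  induction hx using Submodule.iSup_induction' with
  | zero => simp
  | add x x' _ _ h h' => rw [add_lie, map_add, map_add, h, h', add_lie]
  | mem i x hx =>
    induction hy using Submodule.iSup_induction' with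
    | zero => simp
    | add y y' _ _ h h' => rw [lie_add, map_add, map_add, h, h', lie_add]
    | mem j y hy =>
      rw [hg i x hx, hg j y hy, hg _ _ (lie_mem_wt hx hy), zpow_add₀ hc, smul_lie, lie_smul,
        smul_smul]

variable [FiniteDimensional K L]

theorem exists_wt_eq_bot (D : L) : ∃ N : ℕ, ∀ k : ℤ, N < |k| → wt (K := K) D k = ⊥ := by
  have hfin : {k : ℤ | wt (K := K) D k ≠ ⊥}.Finite :=
    WellFoundedGT.finite_ne_bot_of_iSupIndep (iSupIndep_wt (K := K) D)
  obtain ⟨N, hN⟩ := (hfin.image Int.natAbs).bddAbove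
  refine ⟨N, fun k hk => by_contra fun h => ?_⟩
  have : k.natAbs ≤ N := hN ⟨k, h, rfl⟩
  rw [Int.abs_eq_natAbs] at hk
  omega

theorem exists_filt_eq_bot (D : L) : ∃ N : ℕ, filt (K := K) D N = ⊥ := by
  obtain ⟨N, hN⟩ := exists_wt_eq_bot (K := K) D
  refine ⟨N + 1, eq_bot_iff.2 (filt_le fun j hj => (hN j ?_).le)⟩
  push_cast at hj
  exact lt_of_lt_of_le (by omega) (le_abs_self j)

theorem IsGrading.exists_filt_eq_top (hD : IsGrading K D) : ∃ N : ℕ, filt (K := K) D (-N) = ⊤ := by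
  obtain ⟨N, hN⟩ := exists_wt_eq_bot (K := K) D
  refine ⟨N, eq_top_iff.2 (hD ▸ iSup_le fun j => ?_)⟩
  by_cases h : (N : ℤ) < |j|
  · rw [hN j h]; exact bot_le
  · exact wt_le_filt (by have := neg_abs_le j; omega)

theorem isNilpotent_ad_of_mem_filt (hD : IsGrading K D) (hx : x ∈ filt (K := K) D 1) :
    IsNilpotent (LieAlgebra.ad K L x) := by
  obtain ⟨N, hN⟩ := hD.exists_filt_eq_top
  obtain ⟨M, hM⟩ := exists_filt_eq_bot (K := K) D
  have key (n : ℕ) (y : L) : (LieAlgebra.ad K L x ^ n) y ∈ filt (K := K) D (-N + n) := by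
    induction n with
    | zero => simp [hN]
    | succ n ih =>
      rw [pow_succ', Module.End.mul_apply]
      exact lie_mem_filt' hx ih (by push_cast; omega)
  refine ⟨N + M, LinearMap.ext fun y => ?_⟩
  have := key (N + M) y
  rw [show (-(N : ℤ) + ((N + M : ℕ) : ℤ)) = (M : ℤ) by push_cast; ring, hM] at this
  simpa using this

end Grading

/-! ### Coweights and triangular decomposition -/

section Triangular

variable {ι K L : Type*} [Fintype ι] [Field K] [LieRing L] [LieAlgebra K L]
  {H : LieSubalgebra K L} (b : LieAlgebra.Basis ι H)

/-- The Lie subalgebra generated by the `eᵢ`. -/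
def posPart : Submodule K L := (LieSubalgebra.lieSpan K L (Set.range b.e)).toSubmodule

/-- `D` is the element of the Cartan subalgebra on which the simple root `αᵢ` takes the integral
value `m i`. -/
structure IsCoweight (m : ι → ℤ) (D : L) : Prop where
  mem : D ∈ H
  e_mem : ∀ i, b.e i ∈ wt (K := K) D (m i)
  f_mem : ∀ i, b.f i ∈ wt (K := K) D (-m i)

variable {b} {m : ι → ℤ} {D x y : L} {i : ι}

theorem e_mem_posPart : b.e i ∈ posPart b := LieSubalgebra.subset_lieSpan ⟨i, rfl⟩

theorem lie_mem_posPart (hx : x ∈ posPart b) (hy : y ∈ posPart b) : ⁅x, y⁆ ∈ posPart b :=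
  (LieSubalgebra.lieSpan K L (Set.range b.e)).lie_mem hx hy

theorem posPart_le {S : Submodule K L} (he : ∀ i, b.e i ∈ S)
    (hS : ∀ x ∈ posPart b, ∀ y ∈ posPart b, x ∈ S → y ∈ S → ⁅x, y⁆ ∈ S) : posPart b ≤ S := by
  intro x hx
  have hx' : x ∈ LieSubalgebra.lieSpan K L (Set.range b.e) := hx
  induction hx' using LieSubalgebra.lieSpan_induction with
  | mem u hu => obtain ⟨i, rfl⟩ := hu; exact he i
  | zero => exact zero_mem _
  | add u v hu hv hu' hv' => exact add_mem (hu' hu) (hv' hv)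
  | smul t u hu hu' => exact S.smul_mem _ (hu' hu)
  | lie u v hu hv hu' hv' => exact hS u hu v hv (hu' hu) (hv' hv)

theorem lie_mem_iSup_wt (hx : x ∈ ⨆ k, wt (K := K) D k) (hy : y ∈ ⨆ k, wt (K := K) D k) :
    ⁅x, y⁆ ∈ ⨆ k, wt (K := K) D k := by
  induction hx using Submodule.iSup_induction' with
  | zero => simp
  | add x x' _ _ h h' => rw [add_lie]; exact add_mem h h'
  | mem i x hx =>
    induction hy using Submodule.iSup_induction' with
    | zero => simp
    | add y y' _ _ h h' => rw [lie_add]; exact add_mem h h'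
    | mem j y hy => exact Submodule.mem_iSup_of_mem (i + j) (lie_mem_wt hx hy)

/-- A subspace containing the generators and closed under the bracket is everything. -/
theorem mem_of_generators {S : Submodule K L} (he : ∀ i, b.e i ∈ S) (hf : ∀ i, b.f i ∈ S)
    (hS : ∀ x ∈ S, ∀ y ∈ S, ⁅x, y⁆ ∈ S) (x : L) : x ∈ S := by
  have hx : x ∈ LieSubalgebra.lieSpan K L (Set.range b.e ∪ Set.range b.f) := by simp [b.span_ef]
  induction hx using LieSubalgebra.lieSpan_induction with
  | mem u hu => obtain ⟨i, rfl⟩ | ⟨i, rfl⟩ := hu; exacts [he i, hf i]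
  | zero => exact zero_mem _
  | add u v _ _ hu hv => exact add_mem hu hv
  | smul t u _ hu => exact S.smul_mem _ hu
  | lie u v _ _ hu hv => exact hS u hu v hv

theorem exists_triangular (b : LieAlgebra.Basis ι H) (x : L) :
    ∃ h ∈ H, ∃ y ∈ posPart b.symm, ∃ z ∈ posPart b, x = h + y + z := by
  have hx : x ∈ H.toLieSubmodule ⊔ b.borelLower ⊔ b.borelUpper := by
    have := b.iSup_cartan_borelLower_borelUpper_eq_top
    have h2 : H.toLieSubmodule ⊔ b.borelLower ⊔ b.borelUpper = ⊤ := by simpa using this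
    rw [h2]
    trivial
  obtain ⟨a, ha, z, hz, rfl⟩ := (LieSubmodule.mem_sup _ _ _).1 hx
  obtain ⟨h, hh, y, hy, rfl⟩ := (LieSubmodule.mem_sup _ _ _).1 ha
  exact ⟨h, hh, y, hy, z, hz, rfl⟩

theorem lie_eq_zero_of_mem_cartan (b : LieAlgebra.Basis ι H) (hx : x ∈ H) (hy : y ∈ H) :
    ⁅x, y⁆ = 0 := by
  have := b.isLieAbelian_cartan
  exact congrArg Subtype.val (LieModule.IsTrivial.trivial (⟨x, hx⟩ : H) (⟨y, hy⟩ : H))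

theorem lie_e_of_mem_cartan (b : LieAlgebra.Basis ι H) (hx : x ∈ H) (i : ι) :
    ⁅x, b.e i⁆ = b.baseSupp i ⟨x, hx⟩ • b.e i :=
  (b.baseSupp_apply_smul_e i ⟨x, hx⟩).symm

theorem lie_f_of_mem_cartan (b : LieAlgebra.Basis ι H) (hx : x ∈ H) (i : ι) :
    ⁅x, b.f i⁆ = -(b.baseSupp i ⟨x, hx⟩ • b.f i) := by
  rw [b.baseSupp_apply_smul_f i ⟨x, hx⟩, neg_neg]
  rfl

theorem h_mem_cartan (b : LieAlgebra.Basis ι H) (i : ι) : b.h i ∈ H := (b.h' i).2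

theorem IsCoweight.isGrading (hD : IsCoweight b m D) : IsGrading K D :=
  eq_top_iff.2 fun x _ => mem_of_generators (b := b)
    (fun i => Submodule.mem_iSup_of_mem _ (hD.e_mem i))
    (fun i => Submodule.mem_iSup_of_mem _ (hD.f_mem i))
    (fun _ hx _ hy => lie_mem_iSup_wt hx hy) x

theorem IsCoweight.cartan_le (hD : IsCoweight b m D) (hx : x ∈ H) : x ∈ wt (K := K) D 0 :=
  mem_wt_zero.2 (lie_eq_zero_of_mem_cartan b hD.mem hx)

theorem IsCoweight.symm (hD : IsCoweight b m D) : IsCoweight b.symm m (-D) where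
  mem := neg_mem hD.mem
  e_mem i := by rw [wt_neg]; exact hD.f_mem i
  f_mem i := by rw [wt_neg, neg_neg]; exact hD.e_mem i

theorem IsCoweight.posPart_le_filt {k : ℤ} (hD : IsCoweight b m D) (hk : 0 ≤ k)
    (hm : ∀ i, k ≤ m i) : posPart b ≤ filt D k :=
  posPart_le (fun i => wt_le_filt (hm i) (hD.e_mem i)) fun _ _ _ _ hx hy =>
    lie_mem_filt' hx hy (by omega)

/-- `𝔫` is the sum of its part in a Levi subalgebra and its part in the nilradical of the
corresponding parabolic subalgebra. -/
theorem IsCoweight.posPart_le_sup (hD : IsCoweight b m D) (hm : ∀ i, 0 ≤ m i) :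
    posPart b ≤ (posPart b ⊓ wt D 0) ⊔ (posPart b ⊓ filt D 1) := by
  refine posPart_le (fun i => ?_) fun x _ y _ hx hy => ?_
  · obtain h | h := (hm i).eq_or_lt
    · have h1 := hD.e_mem i
      rw [← h] at h1
      exact Submodule.mem_sup_left ⟨e_mem_posPart, h1⟩
    · exact Submodule.mem_sup_right ⟨e_mem_posPart, wt_le_filt h (hD.e_mem i)⟩
  · obtain ⟨x0, ⟨hx0, hx0'⟩, x1, ⟨hx1, hx1'⟩, rfl⟩ := Submodule.mem_sup.1 hx
    obtain ⟨y0, ⟨hy0, hy0'⟩, y1, ⟨hy1, hy1'⟩, rfl⟩ := Submodule.mem_sup.1 hy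
    have hx0'' := wt_le_filt le_rfl hx0'
    have hy0'' := wt_le_filt le_rfl hy0'
    rw [add_lie, lie_add, lie_add, add_assoc]
    refine add_mem (Submodule.mem_sup_left ⟨lie_mem_posPart hx0 hy0, by simpa using lie_mem_wt hx0' hy0'⟩)
      (Submodule.mem_sup_right (add_mem ⟨lie_mem_posPart hx0 hy1, ?_⟩
        (add_mem ⟨lie_mem_posPart hx1 hy0, ?_⟩ ⟨lie_mem_posPart hx1 hy1, ?_⟩)))
    exacts [lie_mem_filt' hx0'' hy1' (by omega), lie_mem_filt' hx1' hy0'' (by omega),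
      lie_mem_filt' hx1' hy1' (by omega)]

/-- `𝔫` is spanned by `eᵢ` and elements of positive degree with respect to a coweight that vanishes
on `αᵢ` and is positive on the other simple roots. -/
theorem IsCoweight.posPart_le_span_sup (hD : IsCoweight b m D) (hm0 : m i = 0)
    (hm : ∀ j, j ≠ i → 1 ≤ m j) :
    posPart b ≤ K ∙ b.e i ⊔ filt D 1 := by
  refine posPart_le (fun j => ?_) fun x _ y _ hx hy => ?_
  · obtain rfl | h := eq_or_ne j i
    · exact Submodule.mem_sup_left (Submodule.mem_span_singleton_self _)
    · exact Submodule.mem_sup_right (wt_le_filt (hm j h) (hD.e_mem j))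
  · obtain ⟨x0, hx0, x1, hx1, rfl⟩ := Submodule.mem_sup.1 hx
    obtain ⟨y0, hy0, y1, hy1, rfl⟩ := Submodule.mem_sup.1 hy
    obtain ⟨a, rfl⟩ := Submodule.mem_span_singleton.1 hx0
    obtain ⟨c, rfl⟩ := Submodule.mem_span_singleton.1 hy0
    have he : b.e i ∈ filt (K := K) D 0 := wt_le_filt (by rw [hm0]) (hD.e_mem i)
    rw [add_lie, lie_add, lie_add, smul_lie, lie_smul, lie_self, smul_zero, smul_zero, zero_add]
    refine Submodule.mem_sup_right (add_mem ?_ (add_mem ?_ ?_))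
    exacts [lie_mem_filt' (Submodule.smul_mem _ _ he) hy1 (by omega),
      lie_mem_filt' hx1 (Submodule.smul_mem _ _ he) (by omega),
      lie_mem_filt' hx1 hy1 (by omega)]

variable [CharZero K]

/-- The Cartan matrix being invertible, the values of a coweight on the simple roots are
arbitrary. -/
theorem exists_isCoweight (b : LieAlgebra.Basis ι H) (m : ι → ℤ) : ∃ D, IsCoweight b m D := by
  classical
  let A : Matrix ι ι K := b.A.map (Int.castRingHom K)
  have hA : A.det ≠ 0 := by
    have : A = (Int.castRingHom K).mapMatrix b.A := rfl
    rw [this, ← RingHom.map_det]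
    simpa using b.nondegen.det_ne_zero
  have hA' : IsUnit A.det := hA.isUnit
  let v : ι → K := A⁻¹.mulVec fun j => (m j : K)
  have hv : A.mulVec v = fun j => (m j : K) := by
    rw [Matrix.mulVec_mulVec, Matrix.mul_nonsing_inv _ hA', Matrix.one_mulVec]
  have hv' (j : ι) : ∑ k, v k * (b.A j k : K) = m j := by
    rw [← congrFun hv j]
    exact Finset.sum_congr rfl fun k _ => mul_comm _ _
  refine ⟨∑ k, v k • b.h k, ?_, fun j => ?_, fun j => ?_⟩
  · exact sum_mem fun k _ => H.smul_mem _ (h_mem_cartan b k)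
  · rw [mem_wt, ← hv' j, sum_lie, Finset.sum_smul]
    refine Finset.sum_congr rfl fun k _ => ?_
    rw [smul_lie, b.lie_h_e, mul_smul, Int.cast_smul_eq_zsmul]
  · rw [mem_wt, Int.cast_neg, ← hv' j, sum_lie, neg_smul, Finset.sum_smul,
      ← Finset.sum_neg_distrib]
    refine Finset.sum_congr rfl fun k _ => ?_
    rw [smul_lie, b.lie_h_f, mul_smul, Int.cast_smul_eq_zsmul, neg_smul, smul_neg]

theorem disjoint_filt_one : Disjoint (filt (K := K) D 1) (wt D 0 ⊔ filt (-D) 1) := by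
  refine disjoint_filt_of_lt.mono_right (sup_le (le_iSup₂_of_le 0 (by omega) le_rfl) ?_)
  refine filt_le fun j hj => ?_
  rw [wt_neg]
  exact le_iSup₂_of_le (-j) (by omega) le_rfl

/-- The nilradical of a standard parabolic subalgebra is contained in `𝔫`. -/
theorem IsCoweight.filt_one_le_posPart (hD : IsCoweight b m D) (hm : ∀ i, 0 ≤ m i) :
    filt D 1 ≤ posPart b := by
  intro x hx
  obtain ⟨h, hh, y, hy, z, hz, rfl⟩ := exists_triangular b x
  obtain ⟨z0, hz0, z1, hz1, rfl⟩ := Submodule.mem_sup.1 (hD.posPart_le_sup hm hz)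
  obtain ⟨y0, hy0, y1, hy1, rfl⟩ := Submodule.mem_sup.1 (hD.symm.posPart_le_sup hm hy)
  have h1 : h + (y0 + y1) + z0 ∈ filt (K := K) D 1 := by
    have := sub_mem hx hz1.2
    convert this using 1
    abel
  have h2 : h + (y0 + y1) + z0 ∈ wt (K := K) D 0 ⊔ filt (-D) 1 := by
    have hy0' : y0 ∈ wt (K := K) D 0 := by simpa [wt_neg] using hy0.2
    have e : h + (y0 + y1) + z0 = (h + y0 + z0) + y1 := by abel
    rw [e]
    exact add_mem (Submodule.mem_sup_left (add_mem (add_mem (hD.cartan_le hh) hy0') hz0.2))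
      (Submodule.mem_sup_right hy1.2)
  have h3 := Submodule.disjoint_def.1 disjoint_filt_one _ h1 h2
  have e : h + (y0 + y1) + (z0 + z1) = (h + (y0 + y1) + z0) + z1 := by abel
  rw [e, h3, zero_add]
  exact hz1.1

/-- For the grading by height, `𝔫` is the positive part. -/
theorem IsCoweight.posPart_eq (hD : IsCoweight b 1 D) : posPart b = filt D 1 :=
  le_antisymm (hD.posPart_le_filt zero_le_one fun _ => le_rfl)
    (hD.filt_one_le_posPart fun _ => zero_le_one)

/-- For the grading by height, `𝔥` is the degree zero part. -/
theorem IsCoweight.mem_cartan (hD : IsCoweight b 1 D) (hx : x ∈ wt (K := K) D 0) : x ∈ H := by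
  obtain ⟨h, hh, y, hy, z, hz, rfl⟩ := exists_triangular b x
  rw [hD.posPart_eq] at hz
  rw [hD.symm.posPart_eq] at hy
  have h1 := sub_mem hx (hD.cartan_le hh)
  have e1 : z = (h + y + z - h) + -y := by abel
  have hz0 : z = 0 := by
    refine Submodule.disjoint_def.1 disjoint_filt_one _ hz ?_
    rw [e1]
    exact add_mem (Submodule.mem_sup_left h1) (Submodule.mem_sup_right (neg_mem hy))
  subst hz0
  have hy0 : y = 0 := by
    refine eq_zero_of_mem_wt_of_mem_filt (D := -D) (k := 1) (j := 0) (by omega) ?_ hy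
    rw [wt_neg, neg_zero]
    convert h1 using 1
    abel
  simpa [hy0] using hh

theorem IsCoweight.filt_zero_le (hD : IsCoweight b 1 D) :
    filt D 0 ≤ H.toSubmodule ⊔ posPart b := by
  rw [filt_eq_sup, zero_add, hD.posPart_eq]
  exact sup_le_sup_right (fun x hx => hD.mem_cartan hx) _

theorem IsCoweight.cartan_sup_posPart (hD : IsCoweight b 1 D) :
    H.toSubmodule ⊔ posPart b = filt D 0 := by
  refine le_antisymm (sup_le (fun x hx => wt_le_filt le_rfl (hD.cartan_le hx)) ?_) hD.filt_zero_le
  rw [hD.posPart_eq]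
  exact filt_anti zero_le_one

/-- An element of `𝔫₋` of degree zero for a coweight vanishing on `αᵢ` only. -/
theorem IsCoweight.exists_eq_smul_f (hD : IsCoweight b m D) (hm0 : m i = 0)
    (hm : ∀ j, j ≠ i → 1 ≤ m j) (hx : x ∈ posPart b.symm) (hx' : x ∈ wt (K := K) D 0) :
    ∃ c : K, x = c • b.f i := by
  obtain ⟨y, hy, z, hz, rfl⟩ := Submodule.mem_sup.1 (hD.symm.posPart_le_span_sup hm0 hm hx)
  obtain ⟨c, rfl⟩ := Submodule.mem_span_singleton.1 hy
  have h1 : c • b.f i ∈ wt (K := K) D 0 := by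
    have := hD.f_mem i
    rw [hm0] at this
    exact Submodule.smul_mem _ _ this
  have h2 : z ∈ wt (K := K) (-D) 0 := by
    rw [wt_neg, neg_zero]
    have := sub_mem hx' h1
    simpa using this
  refine ⟨c, ?_⟩
  rw [eq_zero_of_mem_wt_of_mem_filt (by omega) h2 hz, add_zero]
  rfl

end Triangular

/-! ### The Borel subgroup -/

section BorelGroup

variable {ι K L : Type*} [Fintype ι] [Field K] [CharZero K] [LieRing L] [LieAlgebra K L]
  {H : LieSubalgebra K L} (b : LieAlgebra.Basis ι H)

/-- The maximal torus of the adjoint group: the automorphisms fixing the Cartan subalgebra. -/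
def torusGroup (_b : LieAlgebra.Basis ι H) : Subgroup (L ≃ₗ[K] L) where
  carrier := {g | g ∈ lieAut K L ∧ ∀ h ∈ H, g h = h}
  mul_mem' := by
    rintro g g' ⟨h1, h2⟩ ⟨h1', h2'⟩
    exact ⟨mul_mem h1 h1', fun h hh => by rw [LinearEquiv.mul_apply, h2' h hh, h2 h hh]⟩
  one_mem' := ⟨one_mem _, fun _ _ => rfl⟩
  inv_mem' := by
    rintro g ⟨h1, h2⟩
    refine ⟨inv_mem h1, fun h hh => ?_⟩
    change g.symm _ = _
    rw [LinearEquiv.symm_apply_eq, h2 h hh]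

/-- The group generated by the exponentials of the elements of `𝔫`. -/
def unipotentGroup : Subgroup (L ≃ₗ[K] L) :=
  Subgroup.closure {g | ∃ x ∈ posPart b, ∃ hx, g = adExp x hx}

/-- The Borel subgroup of the adjoint group. -/
def borelGroup : Subgroup (L ≃ₗ[K] L) := torusGroup b ⊔ unipotentGroup b

variable {b} {m : ι → ℤ} {D x y : L} {i : ι} {g : L ≃ₗ[K] L}

theorem adExp_mem_unipotentGroup (hx : x ∈ posPart b) (h : IsNilpotent (LieAlgebra.ad K L x)) :
    adExp x h ∈ unipotentGroup b :=
  Subgroup.subset_closure ⟨x, hx, h, rfl⟩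

theorem unipotentGroup_le_lieAut : unipotentGroup b ≤ lieAut K L :=
  (Subgroup.closure_le _).2 fun g hg => by
    obtain ⟨x, _, h, rfl⟩ := hg
    exact adExp_mem_lieAut h

theorem borelGroup_le_lieAut : borelGroup b ≤ lieAut K L :=
  sup_le (fun _ hg => hg.1) unipotentGroup_le_lieAut

variable (b) in
theorem isNilpotent_ad_of_mem_posPart [FiniteDimensional K L] (hx : x ∈ posPart b) :
    IsNilpotent (LieAlgebra.ad K L x) := by
  obtain ⟨D, hD⟩ := exists_isCoweight b 1
  exact isNilpotent_ad_of_mem_filt hD.isGrading (hD.posPart_eq ▸ hx)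

variable [FiniteDimensional K L]

theorem isNilpotent_ad_smul_e (b : LieAlgebra.Basis ι H) (c : K) (i : ι) :
    IsNilpotent (LieAlgebra.ad K L (c • b.e i)) :=
  isNilpotent_ad_of_mem_posPart b (Submodule.smul_mem _ _ e_mem_posPart)

theorem isNilpotent_ad_smul_f (b : LieAlgebra.Basis ι H) (c : K) (i : ι) :
    IsNilpotent (LieAlgebra.ad K L (c • b.f i)) :=
  isNilpotent_ad_smul_e b.symm c i

/-- The generators of `N` are closed under inversion, which simplifies the induction principle. -/
theorem unipotentGroup_induction {p : (g : L ≃ₗ[K] L) → g ∈ unipotentGroup b → Prop}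
    (mem : ∀ x (hx : x ∈ posPart b) (h : IsNilpotent (LieAlgebra.ad K L x)),
      p (adExp x h) (adExp_mem_unipotentGroup hx h))
    (one : p 1 (one_mem _))
    (mul : ∀ g g' hg hg', p g hg → p g' hg' → p (g * g') (mul_mem hg hg'))
    (hg : g ∈ unipotentGroup b) : p g hg := by
  induction hg using Subgroup.closure_induction'' with
  | mem g hg => obtain ⟨x, hx, h, rfl⟩ := hg; exact mem x hx h
  | inv_mem g hg =>
    obtain ⟨x, hx, h, rfl⟩ := hg
    have hx' := neg_mem hx
    have := mem (-x) hx' (isNilpotent_ad_of_mem_posPart b hx')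
    simpa only [adExp_neg h] using this
  | one => exact one
  | mul g g' hg hg' h h' => exact mul g g' _ _ h h'

theorem IsCoweight.sub_mem_filt_of_mem_unipotentGroup (hD : IsCoweight b 1 D)
    (hg : g ∈ unipotentGroup b) {k : ℤ} (hy : y ∈ filt (K := K) D k) :
    g y - y ∈ filt (K := K) D (k + 1) := by
  induction hg using unipotentGroup_induction generalizing k y with
  | mem x hx h =>
    rw [hD.posPart_eq] at hx
    exact adExp_sub_mem h (fun z hz => lie_mem_filt' hx hz (by omega))
      (lie_mem_filt' hx hy (by omega))
  | one => simp
  | mul g g' _ _ h h' =>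
    have h1 := h' hy
    have h2 := h hy
    have h3 := h h1
    have e : (g * g') y - y = (g (g' y - y) - (g' y - y)) + (g' y - y) + (g y - y) := by
      rw [LinearEquiv.mul_apply, map_sub]; abel
    rw [e]
    exact add_mem (add_mem (filt_anti (by omega) h3) h1) h2

theorem IsCoweight.map_mem_filt_of_mem_unipotentGroup (hD : IsCoweight b 1 D)
    (hg : g ∈ unipotentGroup b) {k : ℤ} (hy : y ∈ filt (K := K) D k) :
    g y ∈ filt (K := K) D k := by
  have := add_mem (filt_anti (by omega) (hD.sub_mem_filt_of_mem_unipotentGroup hg hy)) hy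
  simpa using this

theorem IsCoweight.map_mem_filt_of_mem_torusGroup (hD : IsCoweight b m D)
    (hg : g ∈ torusGroup b) {k : ℤ} (hy : y ∈ filt (K := K) D k) :
    g y ∈ filt (K := K) D k :=
  lieAut.map_filt hg.1 (hg.2 _ hD.mem) hy

/-- Elements of the Borel subgroup preserve the filtration by height and act trivially on
`𝔟 / 𝔫`. -/
theorem IsCoweight.map_of_mem_borelGroup (hD : IsCoweight b 1 D) (hg : g ∈ borelGroup b) :
    (∀ k, ∀ y ∈ filt (K := K) D k, g y ∈ filt (K := K) D k) ∧
      ∀ h ∈ H, g h - h ∈ filt (K := K) D 1 := by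
  have key : ∀ g, g ∈ torusGroup b ∨ g ∈ unipotentGroup b →
      (∀ k, ∀ y ∈ filt (K := K) D k, g y ∈ filt (K := K) D k) ∧
      ∀ h ∈ H, g h - h ∈ filt (K := K) D 1 := by
    rintro g (hg | hg)
    · exact ⟨fun k y hy => hD.map_mem_filt_of_mem_torusGroup hg hy,
        fun h hh => by simp [hg.2 h hh]⟩
    · refine ⟨fun k y hy => hD.map_mem_filt_of_mem_unipotentGroup hg hy, fun h hh => ?_⟩
      simpa using hD.sub_mem_filt_of_mem_unipotentGroup hg (wt_le_filt le_rfl (hD.cartan_le hh))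
  rw [borelGroup, Subgroup.sup_eq_closure] at hg
  induction hg using Subgroup.closure_induction'' with
  | mem g hg => exact key g hg
  | inv_mem g hg => exact key _ (hg.imp inv_mem inv_mem)
  | one => simp
  | mul g g' _ _ h h' =>
    refine ⟨fun k y hy => h.1 k _ (h'.1 k y hy), fun x hx => ?_⟩
    have e : (g * g') x - x = g (g' x - x) + (g x - x) := by
      rw [LinearEquiv.mul_apply, map_sub]; abel
    rw [e]
    exact add_mem (h.1 1 _ (h'.2 x hx)) (h.2 x hx)

/-- All elements of `D + 𝔫` are conjugate under `N`, for `D` regular in the Cartan subalgebra; here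
`D` defines the grading by height. -/
theorem IsCoweight.exists_map_add_eq (hD : IsCoweight b 1 D) (hy : y ∈ filt (K := K) D 1) :
    ∃ u ∈ unipotentGroup b, u (D + y) = D := by
  obtain ⟨N, hN⟩ := exists_filt_eq_bot (K := K) D
  suffices h : ∀ k : ℕ, ∀ r : ℤ, 1 ≤ r → (N : ℤ) ≤ r + k → ∀ y ∈ filt (K := K) D r,
      ∃ u ∈ unipotentGroup b, u (D + y) = D from h N 1 le_rfl (by omega) y hy
  intro k
  induction k with
  | zero =>
    intro r _ hr y hy
    have hy0 : y ∈ filt (K := K) D N := filt_anti (by simpa using hr) hy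
    rw [hN, Submodule.mem_bot] at hy0
    exact ⟨1, one_mem _, by simp [hy0]⟩
  | succ k ih =>
    intro r hr hr' y hy
    obtain ⟨w, hw, z, hz, rfl⟩ := exists_wt_add_filt hy
    have hr0 : (r : K) ≠ 0 := by exact_mod_cast (by omega : r ≠ 0)
    let x := (r : K)⁻¹ • w
    have hx : x ∈ wt (K := K) D r := Submodule.smul_mem _ _ hw
    have hxD : ⁅x, D⁆ = -w := by
      rw [← lie_skew, mem_wt.1 hx, smul_inv_smul₀ hr0]
    have hx1 : x ∈ filt (K := K) D r := wt_le_filt le_rfl hx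
    have hxn : x ∈ posPart b := hD.posPart_eq ▸ filt_anti hr hx1
    have hnil := isNilpotent_ad_of_mem_posPart b hxn
    have hS : ∀ y ∈ filt (K := K) D (r + 1), ⁅x, y⁆ ∈ filt (K := K) D (r + 1) :=
      fun y hy => lie_mem_filt' hx1 hy (by omega)
    have h1 : adExp x hnil D - D - ⁅x, D⁆ ∈ filt (K := K) D (r + 1) := by
      refine adExp_sub_sub_mem hnil hS (lie_mem_filt' hx1 (?_ : _ ∈ filt (K := K) D r) (by omega))
      rw [hxD]
      exact neg_mem (wt_le_filt le_rfl hw)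
    have h2 : adExp x hnil (w + z) - (w + z) ∈ filt (K := K) D (r + 1) :=
      adExp_sub_mem hnil hS (lie_mem_filt' hx1 hy (by omega))
    obtain ⟨u, hu, hu'⟩ := ih (r + 1) (by omega) (by push_cast at hr'; omega)
      (adExp x hnil (D + (w + z)) - D) (by
        have := add_mem (add_mem h1 h2) hz
        rw [hxD] at this
        convert this using 1
        rw [map_add]
        abel)
    refine ⟨u * adExp x hnil, mul_mem hu (adExp_mem_unipotentGroup hxn hnil), ?_⟩
    rw [LinearEquiv.mul_apply]
    simpa using hu'

/-- An automorphism belongs to the Borel subgroup as soon as it maps every `h ∈ 𝔥` into `h + 𝔫`. -/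
theorem exists_eq_mul_of_sub_mem (hg : g ∈ lieAut K L) (h : ∀ x ∈ H, g x - x ∈ posPart b) :
    ∃ u ∈ unipotentGroup b, ∃ t ∈ torusGroup b, g = u * t := by
  obtain ⟨D, hD⟩ := exists_isCoweight b 1
  rw [hD.posPart_eq] at h
  obtain ⟨u, hu, huD⟩ := hD.exists_map_add_eq (h D hD.mem)
  rw [add_sub_cancel] at huD
  have hu' := unipotentGroup_le_lieAut hu
  refine ⟨u⁻¹, inv_mem hu, u * g, ⟨mul_mem hu' hg, fun x hx => ?_⟩, by group⟩
  have h0 : (u * g) x ∈ wt (K := K) D 0 :=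
    lieAut.map_wt (mul_mem hu' hg) huD (hD.cartan_le hx)
  have h1 : (u * g) x - x ∈ filt (K := K) D 1 := by
    have e : (u * g) x - x = u (g x - x) + (u x - x) := by
      rw [LinearEquiv.mul_apply, map_sub]; abel
    rw [e]
    refine add_mem (hD.map_mem_filt_of_mem_unipotentGroup hu (h x hx)) ?_
    simpa using hD.sub_mem_filt_of_mem_unipotentGroup hu (wt_le_filt le_rfl (hD.cartan_le hx))
  exact sub_eq_zero.1 (eq_zero_of_mem_wt_of_mem_filt zero_lt_one
    (sub_mem h0 (hD.cartan_le hx)) h1)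

theorem mem_borelGroup_of_sub_mem (hg : g ∈ lieAut K L) (h : ∀ x ∈ H, g x - x ∈ posPart b) :
    g ∈ borelGroup b := by
  obtain ⟨u, hu, t, ht, rfl⟩ := exists_eq_mul_of_sub_mem hg h
  exact mul_mem (Subgroup.mem_sup_right hu) (Subgroup.mem_sup_left ht)

theorem exists_eq_unipotent_mul_torus (hg : g ∈ borelGroup b) :
    ∃ u ∈ unipotentGroup b, ∃ t ∈ torusGroup b, g = u * t := by
  obtain ⟨D, hD⟩ := exists_isCoweight b 1
  exact exists_eq_mul_of_sub_mem (borelGroup_le_lieAut hg)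
    (hD.posPart_eq ▸ (hD.map_of_mem_borelGroup hg).2)

theorem exists_eq_torus_mul_unipotent (hg : g ∈ borelGroup b) :
    ∃ u ∈ unipotentGroup b, ∃ t ∈ torusGroup b, g = t * u := by
  obtain ⟨u, hu, t, ht, h⟩ := exists_eq_unipotent_mul_torus (inv_mem hg)
  exact ⟨u⁻¹, inv_mem hu, t⁻¹, inv_mem ht, by rw [← mul_inv_rev, ← h, inv_inv]⟩

/-- The torus acts on each `fᵢ` by a nonzero scalar. -/
theorem exists_torus_smul_f (hg : g ∈ torusGroup b) (i : ι) :
    ∃ c : K, c ≠ 0 ∧ g (b.f i) = c • b.f i := by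
  classical
  obtain ⟨D, hD⟩ := exists_isCoweight b 1
  obtain ⟨D', hD'⟩ := exists_isCoweight b fun j => if j = i then 0 else 1
  have h1 : g (b.f i) ∈ posPart b.symm := by
    rw [hD.symm.posPart_eq]
    refine lieAut.map_filt hg.1 (hg.2 _ (neg_mem hD.mem)) ?_
    rw [← hD.symm.posPart_eq]
    exact e_mem_posPart (b := b.symm)
  have h2 : g (b.f i) ∈ wt (K := K) D' 0 := by
    refine lieAut.map_wt hg.1 (hg.2 _ hD'.mem) ?_
    simpa using hD'.f_mem i
  obtain ⟨c, hc⟩ := hD'.exists_eq_smul_f (i := i) (by simp) (fun j hj => by simp [hj]) h1 h2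
  refine ⟨c, ?_, hc⟩
  rintro rfl
  rw [zero_smul] at hc
  exact (b.sl2 i).f_ne_zero (g.map_eq_zero_iff.1 hc)

/-! ### The Iwasawa decomposition -/

/-- An element of the Borel subgroup of the `SL₂` of a simple root: in terms of matrices,
`(1 0; c 1) (1 a; 0 1) (1 0; -r 1)` is upper triangular if `r (1 + a c) = c`. -/
theorem adExp_mul_mul_mem_borelGroup (b : LieAlgebra.Basis ι H) (i : ι) {a c r : K}
    (hr : r * (1 + a * c) = c) :
    adExp (c • b.f i) (isNilpotent_ad_smul_f b c i) *
      adExp (a • b.e i) (isNilpotent_ad_smul_e b a i) *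
      adExp (-r • b.f i) (isNilpotent_ad_smul_f b (-r) i) ∈ borelGroup b := by
  have hef : ⁅b.e i, b.f i⁆ = b.h i := (b.sl2 i).lie_e_f
  have hfe : ⁅b.f i, b.e i⁆ = -b.h i := by rw [← lie_skew, hef]
  have heh : ⁅b.e i, b.h i⁆ = -((2 : K) • b.e i) := by
    rw [← lie_skew, (b.sl2 i).lie_h_e_smul K]
  have hfh : ⁅b.f i, b.h i⁆ = (2 : K) • b.f i := by
    rw [← lie_skew, (b.sl2 i).lie_lie_smul_f K, neg_neg]
  refine mem_borelGroup_of_sub_mem (mul_mem (mul_mem (adExp_mem_lieAut _) (adExp_mem_lieAut _))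
    (adExp_mem_lieAut _)) fun x hx => ?_
  set α : K := b.baseSupp i ⟨x, hx⟩
  have hex : ⁅b.e i, x⁆ = -(α • b.e i) := by rw [← lie_skew, lie_e_of_mem_cartan b hx]
  have hfx : ⁅b.f i, x⁆ = α • b.f i := by
    rw [← lie_skew, lie_f_of_mem_cartan b hx, neg_neg]
  have e1 : adExp (-r • b.f i) (isNilpotent_ad_smul_f b (-r) i) x = x + (-r * α) • b.f i := by
    rw [adExp_apply_of_lie_lie_eq_zero]
    · simp [hfx, smul_smul]
    · simp [hfx]
  have e2 : adExp (a • b.e i) (isNilpotent_ad_smul_e b a i) x = x + (-a * α) • b.e i := by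
    rw [adExp_apply_of_lie_lie_eq_zero]
    · simp [hex, smul_smul]
    · simp [hex]
  have e3 : adExp (a • b.e i) (isNilpotent_ad_smul_e b a i) (b.f i) =
      b.f i + a • b.h i - (a * a) • b.e i := by
    rw [adExp_apply_of_lie_lie_lie_eq_zero]
    · simp only [smul_lie, lie_smul, hef, heh, smul_neg]
      module
    · simp [hef, heh]
  have e4 : adExp (c • b.f i) (isNilpotent_ad_smul_f b c i) x = x + (c * α) • b.f i := by
    rw [adExp_apply_of_lie_lie_eq_zero]
    · simp [hfx, smul_smul]
    · simp [hfx]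
  have e5 : adExp (c • b.f i) (isNilpotent_ad_smul_f b c i) (b.e i) =
      b.e i - c • b.h i - (c * c) • b.f i := by
    rw [adExp_apply_of_lie_lie_lie_eq_zero]
    · simp only [smul_lie, lie_smul, hfe, hfh, smul_neg, lie_neg]
      module
    · simp [hfe, hfh]
  have e6 : adExp (c • b.f i) (isNilpotent_ad_smul_f b c i) (b.h i) =
      b.h i + (2 * c) • b.f i := by
    rw [adExp_apply_of_lie_lie_eq_zero]
    · simp only [smul_lie, hfh]
      module
    · simp [hfh]
  have e7 : adExp (c • b.f i) (isNilpotent_ad_smul_f b c i) (b.f i) = b.f i :=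
    adExp_apply_of_lie_eq_zero _ (by simp)
  rw [LinearEquiv.mul_apply, LinearEquiv.mul_apply, e1, map_add, map_smul, e2, e3, map_add, map_add,
    map_smul, map_smul, map_sub, map_add, map_smul, map_smul, e4, e5, e6, e7]
  -- the coefficients of `f i` and `h i` vanish
  have c1 : c + a * c * c - r * (1 + 2 * a * c + a * a * c * c) = 0 := by
    linear_combination (-(1 + a * c)) * hr
  have c2 : a * c - r * (a + a * a * c) = 0 := by linear_combination (-a) * hr
  have key : x + (c * α) • b.f i + (-a * α) • (b.e i - c • b.h i - (c * c) • b.f i) +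
      (-r * α) • (b.f i + a • (b.h i + (2 * c) • b.f i) -
        (a * a) • (b.e i - c • b.h i - (c * c) • b.f i)) - x =
      (α * (c + a * c * c - r * (1 + 2 * a * c + a * a * c * c))) • b.f i +
      (α * (a * c - r * (a + a * a * c))) • b.h i + (-a * α + r * α * a * a) • b.e i := by
    module
  rw [key, c1, c2, mul_zero, zero_smul, zero_smul, zero_add, zero_add]
  exact Submodule.smul_mem _ _ e_mem_posPart

end BorelGroup

section Iwasawa

variable {ι K L : Type*} [Fintype ι] [Field K] [CharZero K] [LieRing L] [LieAlgebra K L]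
  {H : LieSubalgebra K L}

/-- The group generated by the elements `exp (a ad eᵢ)` and `exp (a ad fᵢ)`, with `a` in a subring
`O` of the base field. -/
def integralGroup (b : LieAlgebra.Basis ι H) (O : Subring K) : Subgroup (L ≃ₗ[K] L) :=
  Subgroup.closure {g | ∃ i, ∃ a ∈ O, (∃ h, g = adExp (a • b.e i) h) ∨ ∃ h, g = adExp (a • b.f i) h}

/-- The adjoint group, generated by the Borel subgroup and the negative simple root subgroups. -/
def adjointGroup (b : LieAlgebra.Basis ι H) : Subgroup (L ≃ₗ[K] L) :=
  borelGroup b ⊔ Subgroup.closure {g | ∃ (i : ι) (c : K) (h : _), g = adExp (c • b.f i) h}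

/-- Automorphisms acting trivially on a Levi subalgebra, the degree zero part, modulo the nilradical
of the corresponding parabolic subalgebra, the part of positive degree. -/
def IsParabolicUnipotent (D : L) (w : L ≃ₗ[K] L) : Prop :=
  w ∈ lieAut K L ∧ (∀ y ∈ filt (K := K) D 1, w y ∈ filt (K := K) D 1) ∧
    ∀ y ∈ wt (K := K) D 0, w y - y ∈ filt (K := K) D 1

/-- Automorphisms preserving a Levi subalgebra and the nilradical of the parabolic subalgebra. -/
def leviGroup (D : L) : Subgroup (L ≃ₗ[K] L) where
  carrier := {g | g ∈ lieAut K L ∧ (∀ y, g y ∈ filt (K := K) D 1 ↔ y ∈ filt (K := K) D 1) ∧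
    ∀ y, g y ∈ wt (K := K) D 0 ↔ y ∈ wt (K := K) D 0}
  mul_mem' := by
    rintro g g' ⟨h1, h2, h3⟩ ⟨h1', h2', h3'⟩
    exact ⟨mul_mem h1 h1', fun y => by rw [LinearEquiv.mul_apply, h2, h2'],
      fun y => by rw [LinearEquiv.mul_apply, h3, h3']⟩
  one_mem' := ⟨one_mem _, fun _ => Iff.rfl, fun _ => Iff.rfl⟩
  inv_mem' := by
    rintro g ⟨h1, h2, h3⟩
    refine ⟨inv_mem h1, fun y => ?_, fun y => ?_⟩
    · rw [← h2]; exact iff_of_eq (congrArg (· ∈ _) (g.apply_symm_apply y))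
    · rw [← h3]; exact iff_of_eq (congrArg (· ∈ _) (g.apply_symm_apply y))

variable {D x y : L} {w w' g : L ≃ₗ[K] L}

theorem IsParabolicUnipotent.mul (hw : IsParabolicUnipotent D w) (hw' : IsParabolicUnipotent D w') :
    IsParabolicUnipotent D (w * w') := by
  refine ⟨mul_mem hw.1 hw'.1, fun y hy => hw.2.1 _ (hw'.2.1 y hy), fun y hy => ?_⟩
  have e : (w * w') y - y = w (w' y - y) + (w y - y) := by
    rw [LinearEquiv.mul_apply, map_sub]; abel
  rw [e]
  exact add_mem (hw.2.1 _ (hw'.2.2 y hy)) (hw.2.2 y hy)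

theorem IsParabolicUnipotent.conj (hw : IsParabolicUnipotent D w) (hg : g ∈ leviGroup D) :
    IsParabolicUnipotent D (g * w * g⁻¹) := by
  have hg' := inv_mem hg
  refine ⟨mul_mem (mul_mem hg.1 hw.1) (inv_mem hg.1), fun y hy => ?_, fun y hy => ?_⟩
  · exact (hg.2.1 _).2 (hw.2.1 _ ((hg'.2.1 y).2 hy))
  · have h1 := hw.2.2 _ ((hg'.2.2 y).2 hy)
    have e : (g * w * g⁻¹) y - y = g (w (g⁻¹ y) - g⁻¹ y) := by
      rw [map_sub]
      exact congrArg _ (g.apply_symm_apply y).symm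
    rw [e]
    exact (hg.2.1 _).2 h1

theorem adExp_mem_leviGroup (hx : x ∈ wt (K := K) D 0) (h : IsNilpotent (LieAlgebra.ad K L x)) :
    adExp x h ∈ leviGroup D := by
  have hx0 : x ∈ filt (K := K) D 0 := wt_le_filt le_rfl hx
  have key : ∀ x ∈ wt (K := K) D 0, ∀ h : IsNilpotent (LieAlgebra.ad K L x),
      (∀ y ∈ filt (K := K) D 1, adExp x h y ∈ filt (K := K) D 1) ∧
      ∀ y ∈ wt (K := K) D 0, adExp x h y ∈ wt (K := K) D 0 := fun x hx h =>
    ⟨fun y hy => adExp_mem h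
      (fun z hz => lie_mem_filt' (wt_le_filt (le_refl 0) hx) hz (by omega)) hy,
      fun y hy => adExp_mem h (fun z hz => by simpa using lie_mem_wt hx hz) hy⟩
  have h' : IsNilpotent (LieAlgebra.ad K L (-x)) := by simpa using h.neg
  have hinv (y : L) : adExp (-x) h' (adExp x h y) = y := by
    rw [adExp_neg h]
    exact (adExp x h).symm_apply_apply y
  obtain ⟨h1, h2⟩ := key x hx h
  obtain ⟨h3, h4⟩ := key (-x) (neg_mem hx) h'
  exact ⟨adExp_mem_lieAut h, fun y => ⟨fun hy => hinv y ▸ h3 _ hy, h1 y⟩,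
    fun y => ⟨fun hy => hinv y ▸ h4 _ hy, h2 y⟩⟩

/-- The exponentials of two elements of the Levi subalgebra and of the parabolic subalgebra which
agree modulo the nilradical. -/
theorem adExp_sub_adExp_mem (hx : x ∈ wt (K := K) D 0) (hxy : y - x ∈ filt (K := K) D 1)
    (h : IsNilpotent (LieAlgebra.ad K L x)) (h' : IsNilpotent (LieAlgebra.ad K L y)) {z : L}
    (hz : z ∈ wt (K := K) D 0) : adExp y h' z - adExp x h z ∈ filt (K := K) D 1 := by
  obtain ⟨m, hm⟩ := id h
  obtain ⟨m', hm'⟩ := id h'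
  rw [adExp_apply h (pow_eq_zero_of_le (le_max_left m m') hm),
    adExp_apply h' (pow_eq_zero_of_le (le_max_right m m') hm'), ← Finset.sum_sub_distrib]
  refine Submodule.sum_mem _ fun n hn => ?_
  clear hn
  rw [← smul_sub]
  refine Submodule.smul_mem _ _ ?_
  have hx0 : x ∈ filt (K := K) D 0 := wt_le_filt le_rfl hx
  have hy0 : y ∈ filt (K := K) D 0 := by simpa using add_mem (filt_anti zero_le_one hxy) hx0
  induction n with
  | zero => simp
  | succ n ih =>
    have h1 : (LieAlgebra.ad K L x ^ n) z ∈ wt (K := K) D 0 :=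
      ad_pow_mem (fun z hz => by simpa using lie_mem_wt hx hz) hz n
    rw [pow_succ', pow_succ', Module.End.mul_apply, Module.End.mul_apply, LieAlgebra.ad_apply,
      LieAlgebra.ad_apply]
    have e : ⁅y, (LieAlgebra.ad K L y ^ n) z⁆ - ⁅x, (LieAlgebra.ad K L x ^ n) z⁆ =
        ⁅y, (LieAlgebra.ad K L y ^ n) z - (LieAlgebra.ad K L x ^ n) z⁆ +
          ⁅y - x, (LieAlgebra.ad K L x ^ n) z⁆ := by
      rw [lie_sub, sub_lie]; abel
    rw [e]
    exact add_mem (lie_mem_filt' hy0 ih (by omega))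
      (lie_mem_filt' hxy (wt_le_filt le_rfl h1) (by omega))

variable [FiniteDimensional K L] {b : LieAlgebra.Basis ι H} {m : ι → ℤ} {i : ι}

/-- The unipotent radical of a standard parabolic subgroup lies in the Borel subgroup. -/
theorem IsParabolicUnipotent.mem_borelGroup (hD : IsCoweight b m D) (hm : ∀ i, 0 ≤ m i)
    (hw : IsParabolicUnipotent D w) : w ∈ borelGroup b :=
  mem_borelGroup_of_sub_mem hw.1 fun x hx =>
    hD.filt_one_le_posPart hm (hw.2.2 x (hD.cartan_le hx))

/-- `N` is the product of a simple root subgroup and the unipotent radical of the corresponding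
minimal parabolic subgroup. -/
theorem IsCoweight.exists_eq_adExp_mul (hD : IsCoweight b m D) (hm0 : m i = 0)
    (hm : ∀ j, j ≠ i → 1 ≤ m j) (hg : g ∈ unipotentGroup b) :
    ∃ (a : K) (w : L ≃ₗ[K] L), IsParabolicUnipotent D w ∧
      g = adExp (a • b.e i) (isNilpotent_ad_smul_e b a i) * w := by
  have he : ∀ a : K, a • b.e i ∈ wt (K := K) D 0 := fun a =>
    Submodule.smul_mem _ _ (by simpa [hm0] using hD.e_mem i)
  have hm' : ∀ j, 0 ≤ m j := fun j => by
    obtain rfl | h := eq_or_ne j i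
    · exact hm0.ge
    · exact zero_le_one.trans (hm j h)
  induction hg using unipotentGroup_induction with
  | mem x hx h =>
    obtain ⟨z, hz, y, hy, rfl⟩ := Submodule.mem_sup.1 (hD.posPart_le_span_sup hm0 hm hx)
    obtain ⟨a, rfl⟩ := Submodule.mem_span_singleton.1 hz
    have ha := isNilpotent_ad_smul_e b a i
    have hl := adExp_mem_leviGroup (he a) ha
    have hx0 : a • b.e i + y ∈ filt (K := K) D 0 :=
      add_mem (wt_le_filt le_rfl (he a)) (filt_anti zero_le_one hy)
    refine ⟨a, (adExp (a • b.e i) ha)⁻¹ * adExp _ h, ⟨mul_mem (inv_mem (adExp_mem_lieAut _))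
      (adExp_mem_lieAut _), fun z hz => ?_, fun z hz => ?_⟩, by group⟩
    · refine ((inv_mem hl).2.1 _).2 ?_
      exact adExp_mem h (fun z hz => lie_mem_filt' hx0 hz (by omega)) hz
    · have h1 := adExp_sub_adExp_mem (he a) (y := a • b.e i + y) (by simpa using hy) ha h hz
      have h2 := ((inv_mem hl).2.1 _).2 h1
      rw [map_sub] at h2
      have e : (adExp (a • b.e i) ha)⁻¹ (adExp (a • b.e i) ha z) = z :=
        (adExp (a • b.e i) ha).symm_apply_apply z
      rwa [e] at h2
  | one =>
    refine ⟨0, 1, ⟨one_mem _, fun _ h => h, by simp⟩, ?_⟩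
    ext y
    rw [mul_one, adExp_apply_of_lie_eq_zero _ (by simp)]
    rfl
  | mul g g' _ _ h h' =>
    obtain ⟨a, w, hw, rfl⟩ := h
    obtain ⟨a', w', hw', rfl⟩ := h'
    have ha := isNilpotent_ad_smul_e b a i
    have ha' := isNilpotent_ad_smul_e b a' i
    have haa' := isNilpotent_ad_smul_e b (a + a') i
    have hl := inv_mem (adExp_mem_leviGroup (he a') ha')
    refine ⟨a + a', _, (hw.conj hl).mul hw', ?_⟩
    have e : adExp ((a + a') • b.e i) haa' = adExp (a • b.e i) ha * adExp (a' • b.e i) ha' := by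
      rw [← adExp_add ha ha' (by simp) (by rw [← add_smul]; exact haa')]
      congr 1
      exact add_smul _ _ _
    rw [e]
    group

/-- The Iwasawa decomposition for `SL₂`. -/
theorem exists_sl2_iwasawa (b : LieAlgebra.Basis ι H) {O : Subring K} (hO : ∀ x : K, x ∈ O ∨ x⁻¹ ∈ O)
    (hD : IsCoweight b m D) (hm0 : m i = 0) (a c : K) :
    ∃ g ∈ borelGroup b, ∃ k ∈ integralGroup b O, k ∈ leviGroup D ∧
      adExp (c • b.f i) (isNilpotent_ad_smul_f b c i) *
        adExp (a • b.e i) (isNilpotent_ad_smul_e b a i) = g * k := by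
  have he : ∀ a : K, a • b.e i ∈ wt (K := K) D 0 := fun a =>
    Submodule.smul_mem _ _ (by simpa [hm0] using hD.e_mem i)
  have hf : ∀ a : K, a • b.f i ∈ wt (K := K) D 0 := fun a =>
    Submodule.smul_mem _ _ (by simpa [hm0] using hD.f_mem i)
  have hkf (r : K) (hr : r ∈ O) :
      adExp (r • b.f i) (isNilpotent_ad_smul_f b r i) ∈ integralGroup b O :=
    Subgroup.subset_closure ⟨i, r, hr, Or.inr ⟨_, rfl⟩⟩
  have hke (r : K) (hr : r ∈ O) :
      adExp (r • b.e i) (isNilpotent_ad_smul_e b r i) ∈ integralGroup b O :=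
    Subgroup.subset_closure ⟨i, r, hr, Or.inl ⟨_, rfl⟩⟩
  have hlf (r : K) := adExp_mem_leviGroup (hf r) (isNilpotent_ad_smul_f b r i)
  have hle (r : K) := adExp_mem_leviGroup (he r) (isNilpotent_ad_smul_e b r i)
  -- if `r = c / (1 + a c)` is integral, then `exp (r f)` is the integral factor
  have key (a c r : K) (hrO : r ∈ O) (hr : r * (1 + a * c) = c) :
      ∃ g ∈ borelGroup b, ∃ k ∈ integralGroup b O, k ∈ leviGroup D ∧
        adExp (c • b.f i) (isNilpotent_ad_smul_f b c i) *
        adExp (a • b.e i) (isNilpotent_ad_smul_e b a i) = g * k := by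
    refine ⟨_, adExp_mul_mul_mem_borelGroup b i hr, _, hkf r hrO, hlf r, ?_⟩
    have : adExp (-r • b.f i) (isNilpotent_ad_smul_f b (-r) i) =
        (adExp (r • b.f i) (isNilpotent_ad_smul_f b r i))⁻¹ := by
      rw [← adExp_neg _ (by rw [← neg_smul]; exact isNilpotent_ad_smul_f b (-r) i)]
      congr 1
      exact neg_smul _ _
    rw [this]
    group
  by_cases hc : c = 0
  · exact key a c 0 O.zero_mem (by simp [hc])
  by_cases h1 : 1 + a * c ≠ 0 ∧ c / (1 + a * c) ∈ O
  · exact key a c _ h1.2 (div_mul_cancel₀ _ h1.1)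
  · -- otherwise `s = (1 + a c) / c` is integral, and `a` may be changed by `1 - s`
    have hs : (1 + a * c) / c ∈ O := by
      by_cases h0 : 1 + a * c = 0
      · rw [h0, zero_div]
        exact O.zero_mem
      · rw [← inv_div]
        exact (hO (c / (1 + a * c))).resolve_left fun h => h1 ⟨h0, h⟩
    set s := (1 + a * c) / c with hsdef
    obtain ⟨g, hg, k, hk, hk', h⟩ := key (a + (1 - s)) c 1 O.one_mem (by
      rw [hsdef]; field_simp; ring)
    have h1s : 1 - s ∈ O := sub_mem O.one_mem hs
    refine ⟨g, hg, k * (adExp ((1 - s) • b.e i) (isNilpotent_ad_smul_e b (1 - s) i))⁻¹,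
      mul_mem hk (inv_mem (hke _ h1s)), mul_mem hk' (inv_mem (hle _)), ?_⟩
    rw [← mul_assoc, ← h]
    have e : adExp ((a + (1 - s)) • b.e i) (isNilpotent_ad_smul_e b _ i) =
        adExp (a • b.e i) (isNilpotent_ad_smul_e b a i) *
          adExp ((1 - s) • b.e i) (isNilpotent_ad_smul_e b _ i) := by
      rw [← adExp_add (isNilpotent_ad_smul_e b a i) (isNilpotent_ad_smul_e b _ i) (by simp)
        (by rw [← add_smul]; exact isNilpotent_ad_smul_e b _ i)]
      congr 1
      exact add_smul _ _ _
    rw [e]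
    group

/-- The **Iwasawa decomposition** of the adjoint group over the field of fractions of a valuation
ring. -/
theorem exists_iwasawa (b : LieAlgebra.Basis ι H) {O : Subring K} (hO : ∀ x : K, x ∈ O ∨ x⁻¹ ∈ O)
    (hg : g ∈ adjointGroup b) :
    ∃ p ∈ borelGroup b, ∃ k ∈ integralGroup b O, g = p * k := by
  classical
  -- `B K` is stable under left multiplication by the negative simple root subgroups: `N` is the
  -- product of the root subgroup of `αᵢ` and a group normalized by the `SL₂` of `αᵢ`.
  have key (i : ι) (c : K) (p : L ≃ₗ[K] L) (hp : p ∈ borelGroup b) :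
      ∃ p' ∈ borelGroup b, ∃ k ∈ integralGroup b O,
        adExp (c • b.f i) (isNilpotent_ad_smul_f b c i) * p = p' * k := by
    obtain ⟨D, hD⟩ := exists_isCoweight b fun j => if j = i then 0 else 1
    obtain ⟨u, hu, t, ht, rfl⟩ := exists_eq_torus_mul_unipotent hp
    obtain ⟨a, w, hw, rfl⟩ := hD.exists_eq_adExp_mul (i := i) (by simp)
      (fun j hj => by simp [hj]) hu
    obtain ⟨d, -, hd⟩ := exists_torus_smul_f (inv_mem ht) i
    obtain ⟨p, hp, k, hk, hk', h⟩ := exists_sl2_iwasawa (i := i) b hO hD (by simp) a (c * d)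
    refine ⟨t * (p * (k * w * k⁻¹)), mul_mem (Subgroup.mem_sup_left ht)
      (mul_mem hp ((hw.conj hk').mem_borelGroup hD fun j => by split_ifs <;> simp)), k, hk, ?_⟩
    have e : t⁻¹ * adExp (c • b.f i) (isNilpotent_ad_smul_f b c i) =
        adExp ((c * d) • b.f i) (isNilpotent_ad_smul_f b (c * d) i) * t⁻¹ := by
      rw [lieAut.mul_adExp _ (inv_mem ht.1)]
      congr 2
      rw [map_smul, hd, smul_smul]
    calc _ = t * (t⁻¹ * adExp (c • b.f i) (isNilpotent_ad_smul_f b c i)) * t *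
          (adExp (a • b.e i) (isNilpotent_ad_smul_e b a i) * w) := by group
      _ = t * (adExp ((c * d) • b.f i) (isNilpotent_ad_smul_f b (c * d) i) *
          adExp (a • b.e i) (isNilpotent_ad_smul_e b a i)) * w := by rw [e]; group
      _ = _ := by rw [h]; group
  rw [adjointGroup, ← Subgroup.closure_eq (borelGroup b), ← Subgroup.closure_union] at hg
  induction hg using Subgroup.closure_induction_left with
  | one => exact ⟨1, one_mem _, 1, one_mem _, by simp⟩
  | mul_left x hx y _ h =>
    obtain ⟨p, hp, k, hk, rfl⟩ := h
    obtain hx | ⟨i, c, hc, rfl⟩ := hx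
    · exact ⟨x * p, mul_mem hx hp, k, hk, by group⟩
    · obtain ⟨p', hp', k', hk', h⟩ := key i c p hp
      exact ⟨p', hp', k' * k, mul_mem hk' hk, by rw [← mul_assoc, h, mul_assoc]⟩
  | inv_mul_cancel x hx y _ h =>
    obtain ⟨p, hp, k, hk, rfl⟩ := h
    obtain hx | ⟨i, c, hc, rfl⟩ := hx
    · exact ⟨x⁻¹ * p, mul_mem (inv_mem hx) hp, k, hk, by group⟩
    · obtain ⟨p', hp', k', hk', h⟩ := key i (-c) p hp
      refine ⟨p', hp', k' * k, mul_mem hk' hk, ?_⟩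
      have e : adExp (-c • b.f i) (isNilpotent_ad_smul_f b (-c) i) = (adExp (c • b.f i) hc)⁻¹ := by
        rw [← adExp_neg _ (by rw [← neg_smul]; exact isNilpotent_ad_smul_f b (-c) i)]
        congr 1
        exact neg_smul _ _
      rw [← mul_assoc, ← e, h, mul_assoc]

end Iwasawa

/-! ### Extension of scalars -/

section SubmoduleBaseChange

variable {R A M : Type*} [CommRing R] [CommRing A] [Algebra R A] [AddCommGroup M] [Module R M]

theorem baseChange_le_iff {p : Submodule R M} {S : Submodule A (A ⊗[R] M)} :
    p.baseChange A ≤ S ↔ ∀ x ∈ p, (1 : A) ⊗ₜ[R] x ∈ S := by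
  rw [Submodule.baseChange_eq_span, Submodule.span_le]
  exact ⟨fun h x hx => h ⟨x, hx, rfl⟩, fun h _ ⟨x, hx, e⟩ => e ▸ h x hx⟩

theorem baseChange_induction {p : Submodule R M}
    {motive : (x : A ⊗[R] M) → x ∈ p.baseChange A → Prop} (zero : motive 0 (zero_mem _))
    (add : ∀ x y hx hy, motive x hx → motive y hy → motive (x + y) (add_mem hx hy))
    (tmul : ∀ (a : A), ∀ x (hx : x ∈ p),
      motive (a ⊗ₜ x) (Submodule.tmul_mem_baseChange_of_mem a hx))
    {x : A ⊗[R] M} (hx : x ∈ p.baseChange A) : motive x hx := by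
  have key (y : A ⊗[R] p) : ∃ h, motive (p.subtype.baseChange A y) h := by
    induction y using TensorProduct.induction_on with
    | zero => rw [map_zero]; exact ⟨_, zero⟩
    | tmul a y => exact ⟨_, tmul a y y.2⟩
    | add y z hy hz => rw [map_add]; exact ⟨_, add _ _ _ _ hy.2 hz.2⟩
  obtain ⟨y, rfl⟩ := hx
  exact (key y).2

theorem baseChange_sup (p q : Submodule R M) :
    (p ⊔ q).baseChange A = p.baseChange A ⊔ q.baseChange A := by
  refine le_antisymm (baseChange_le_iff.2 fun x hx => ?_)
    (sup_le (Submodule.baseChange_mono A le_sup_left) (Submodule.baseChange_mono A le_sup_right))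
  obtain ⟨y, hy, z, hz, rfl⟩ := Submodule.mem_sup.1 hx
  rw [TensorProduct.tmul_add]
  exact add_mem (Submodule.mem_sup_left (Submodule.tmul_mem_baseChange_of_mem _ hy))
    (Submodule.mem_sup_right (Submodule.tmul_mem_baseChange_of_mem _ hz))

end SubmoduleBaseChange

section KillingBaseChange

variable (F : Type*) {K L : Type*} [Field K] [Field F] [Algebra K F] [LieRing L] [LieAlgebra K L]
  [FiniteDimensional K L]

theorem isKilling_baseChange [LieAlgebra.IsKilling K L] : LieAlgebra.IsKilling F (F ⊗[K] L) where
  killingCompl_top_eq_bot := by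
    classical
    rw [eq_bot_iff]
    intro x hx
    rw [LieIdeal.mem_killingCompl] at hx
    let v := Module.finBasis K L
    let v' := (killingForm K L).dualBasis (LieAlgebra.IsKilling.killingForm_nondegenerate K L) v
    have hv (i j) : killingForm K L (v i) (v' j) = if i = j then 1 else 0 := by
      rw [LieModule.traceForm_comm, LinearMap.BilinForm.apply_dualBasis_left]
    rw [LieSubmodule.mem_bot]
    apply (v.baseChange F).repr.map_eq_zero_iff.1
    ext j
    have h1 := hx ((1 : F) ⊗ₜ v' j) trivial
    rw [LieModule.traceForm_comm, ← (v.baseChange F).sum_repr x, LieModule.traceForm_baseChange,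
      map_sum] at h1
    simpa [LinearMap.BilinForm.baseChange_tmul, hv, Finset.sum_apply, Algebra.smul_def,
      apply_ite] using h1

end KillingBaseChange

section BasisBaseChange

variable {ι 𝔤 : Type*} [Fintype ι] [LieRing 𝔤] [LieAlgebra ℂ 𝔤] {𝔥 : LieSubalgebra ℂ 𝔤}

theorem one_tmul_injective (K : Type*) [Field K] [Algebra ℂ K] {M : Type*} [AddCommGroup M]
    [Module ℂ M] : Function.Injective fun x : M => (1 : K) ⊗ₜ[ℂ] x :=
  Module.Flat.tensorProduct_mk_injective (R := ℂ) M K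

theorem one_tmul_zsmul {K : Type*} [Field K] [Algebra ℂ K] {M : Type*} [AddCommGroup M]
    [Module ℂ M] (n : ℤ) (x : M) : (1 : K) ⊗ₜ[ℂ] (n • x) = n • (1 : K) ⊗ₜ[ℂ] x :=
  map_zsmul (TensorProduct.mk ℂ K M 1) n x

theorem one_tmul_lie {K : Type*} [CommRing K] [Algebra ℂ K] (x y : 𝔤) :
    ⁅(1 : K) ⊗ₜ[ℂ] x, (1 : K) ⊗ₜ[ℂ] y⁆ = (1 : K) ⊗ₜ[ℂ] ⁅x, y⁆ := by
  rw [LieAlgebra.ExtendScalars.bracket_tmul, one_mul]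

variable (K : Type*) [Field K] [Algebra ℂ K] (b : LieAlgebra.Basis ι 𝔥)

theorem charZero_of_algebra_complex : CharZero K :=
  charZero_of_injective_algebraMap (algebraMap ℂ K).injective

/-- The Chevalley generators of `K ⊗ 𝔤`. -/
def extendBasis : LieAlgebra.Basis ι
    (LieSubalgebra.lieSpan K (K ⊗[ℂ] 𝔤) (Set.range fun i => (1 : K) ⊗ₜ[ℂ] b.h i)) where
  A := b.A
  h i := 1 ⊗ₜ b.h i
  e i := 1 ⊗ₜ b.e i
  f i := 1 ⊗ₜ b.f i
  cartan_eq_lieSpan := rfl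
  span_ef := by
    have := charZero_of_algebra_complex K
    let T := LieSubalgebra.lieSpan K (K ⊗[ℂ] 𝔤) (Set.range (fun i => (1 : K) ⊗ₜ[ℂ] b.e i) ∪
      Set.range (fun i => (1 : K) ⊗ₜ[ℂ] b.f i))
    have key (x : 𝔤) : (1 : K) ⊗ₜ[ℂ] x ∈ T := by
      refine mem_of_generators (b := b)
        (S := (T.toSubmodule.restrictScalars ℂ).comap (TensorProduct.mk ℂ K 𝔤 1))
        (fun i => ?_) (fun i => ?_) (fun x hx y hy => ?_) x
      · exact LieSubalgebra.subset_lieSpan (Or.inl ⟨i, rfl⟩)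
      · exact LieSubalgebra.subset_lieSpan (Or.inr ⟨i, rfl⟩)
      · change (1 : K) ⊗ₜ[ℂ] ⁅x, y⁆ ∈ T
        rw [← one_tmul_lie]
        exact T.lie_mem hx hy
    refine eq_top_iff.2 fun x _ => ?_
    induction x using TensorProduct.induction_on with
    | zero => exact zero_mem T
    | tmul c x =>
      have := T.smul_mem c (key x)
      rwa [TensorProduct.smul_tmul', smul_eq_mul, mul_one] at this
    | add x y hx hy => exact add_mem (hx trivial) (hy trivial)
  linInd := Module.Flat.linearIndependent_one_tmul b.linInd
  nondegen := b.nondegen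
  sl2 i :=
    { h_ne_zero := fun h => (b.sl2 i).h_ne_zero (one_tmul_injective K (by simpa using h))
      lie_e_f := by rw [one_tmul_lie, (b.sl2 i).lie_e_f]
      lie_h_e_nsmul := by
        rw [one_tmul_lie, (b.sl2 i).lie_h_e_nsmul]
        exact map_nsmul (TensorProduct.mk ℂ K 𝔤 1) 2 _
      lie_h_f_nsmul := by
        rw [one_tmul_lie, (b.sl2 i).lie_h_f_nsmul]
        exact (map_neg (TensorProduct.mk ℂ K 𝔤 1) _).trans
          (congrArg _ (map_nsmul (TensorProduct.mk ℂ K 𝔤 1) 2 _)) }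
  lie_h_h i j := by rw [one_tmul_lie, b.lie_h_h, TensorProduct.tmul_zero]
  lie_h_e i j := by rw [one_tmul_lie, b.lie_h_e, one_tmul_zsmul]
  lie_h_f i j := by rw [one_tmul_lie, b.lie_h_f, one_tmul_zsmul]
  lie_e_f_ne i j hij := by rw [one_tmul_lie, b.lie_e_f_ne i j hij, TensorProduct.tmul_zero]

theorem extendBasis_e (i : ι) : (extendBasis K b).e i = 1 ⊗ₜ b.e i := rfl

theorem extendBasis_f (i : ι) : (extendBasis K b).f i = 1 ⊗ₜ b.f i := rfl

theorem smul_extendBasis_e (c : K) (i : ι) : c • (extendBasis K b).e i = c ⊗ₜ b.e i := by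
  rw [extendBasis_e, TensorProduct.smul_tmul', smul_eq_mul, mul_one]

theorem smul_extendBasis_f (c : K) (i : ι) : c • (extendBasis K b).f i = c ⊗ₜ b.f i := by
  rw [extendBasis_f, TensorProduct.smul_tmul', smul_eq_mul, mul_one]

theorem lie_mem_baseChange {R : Type*} [CommRing R] [Algebra ℂ R] {p q r : Submodule ℂ 𝔤}
    (h : ∀ x ∈ p, ∀ y ∈ q, ⁅x, y⁆ ∈ r) {x y : R ⊗[ℂ] 𝔤} (hx : x ∈ p.baseChange R)
    (hy : y ∈ q.baseChange R) : ⁅x, y⁆ ∈ r.baseChange R := by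
  induction hx using baseChange_induction with
  | zero => simp
  | add x x' _ _ hx hx' => rw [add_lie]; exact add_mem hx hx'
  | tmul a x hx =>
    induction hy using baseChange_induction with
    | zero => simp
    | add y y' _ _ hy hy' => rw [lie_add]; exact add_mem hy hy'
    | tmul c y hy =>
      rw [LieAlgebra.ExtendScalars.bracket_tmul]
      exact Submodule.tmul_mem_baseChange_of_mem _ (h x hx y hy)

theorem posPart_extendBasis : posPart (extendBasis K b) = (nilradical b).baseChange K := by
  refine le_antisymm (posPart_le (fun i => ?_) fun x _ y _ hx hy => ?_)
    (baseChange_le_iff.2 fun x hx => ?_)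
  · exact Submodule.tmul_mem_baseChange_of_mem _ (e_mem_posPart (b := b))
  · exact lie_mem_baseChange (fun _ hx _ hy => lie_mem_posPart (b := b) hx hy) hx hy
  · have h : posPart b ≤ ((posPart (extendBasis K b)).restrictScalars ℂ).comap
        (TensorProduct.mk ℂ K 𝔤 1) :=
      posPart_le (fun i => e_mem_posPart (b := extendBasis K b)) fun x _ y _ hx hy => by
        change (1 : K) ⊗ₜ[ℂ] ⁅x, y⁆ ∈ posPart (extendBasis K b)
        rw [← one_tmul_lie]
        exact lie_mem_posPart hx hy
    exact h hx

theorem one_tmul_mem_cartan {x : 𝔤} (hx : x ∈ 𝔥) : (1 : K) ⊗ₜ[ℂ] x ∈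
    LieSubalgebra.lieSpan K (K ⊗[ℂ] 𝔤) (Set.range fun i => (1 : K) ⊗ₜ[ℂ] b.h i) := by
  rw [← LieSubalgebra.mem_toSubmodule, b.coe_cartan_eq_span] at hx
  induction hx using Submodule.span_induction with
  | mem x hx => obtain ⟨i, rfl⟩ := hx; exact LieSubalgebra.subset_lieSpan ⟨i, rfl⟩
  | zero => rw [TensorProduct.tmul_zero]; exact zero_mem _
  | add x y _ _ hx hy => rw [TensorProduct.tmul_add]; exact add_mem hx hy
  | smul c x _ hx =>
    rw [TensorProduct.tmul_smul, algebra_compatible_smul K]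
    exact LieSubalgebra.smul_mem _ _ hx

theorem cartan_extendBasis : (LieSubalgebra.lieSpan K (K ⊗[ℂ] 𝔤)
      (Set.range fun i => (1 : K) ⊗ₜ[ℂ] b.h i)).toSubmodule = 𝔥.toSubmodule.baseChange K := by
  refine le_antisymm ?_ (baseChange_le_iff.2 fun x hx => one_tmul_mem_cartan K b hx)
  rw [(extendBasis K b).coe_cartan_eq_span, Submodule.span_le]
  rintro _ ⟨i, rfl⟩
  exact Submodule.tmul_mem_baseChange_of_mem _ (h_mem_cartan b i)

variable {K} in
theorem mem_wt_extend {D x : 𝔤} {k : ℤ} (h : x ∈ wt (K := ℂ) D k) (c : K) :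
    c ⊗ₜ[ℂ] x ∈ wt (K := K) ((1 : K) ⊗ₜ[ℂ] D) k := by
  rw [mem_wt] at *
  rw [LieAlgebra.ExtendScalars.bracket_tmul, one_mul, h, Int.cast_smul_eq_zsmul,
    Int.cast_smul_eq_zsmul]
  exact map_zsmul (TensorProduct.mk ℂ K 𝔤 c) k x

theorem IsCoweight.extend {b : LieAlgebra.Basis ι 𝔥} {m : ι → ℤ} {D : 𝔤} (hD : IsCoweight b m D) :
    IsCoweight (extendBasis K b) m ((1 : K) ⊗ₜ[ℂ] D) where
  mem := one_tmul_mem_cartan K b hD.mem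
  e_mem i := mem_wt_extend (hD.e_mem i) 1
  f_mem i := mem_wt_extend (hD.f_mem i) 1

theorem wt_extend {D : 𝔤} (hD : IsGrading ℂ D) (k : ℤ) :
    wt (K := K) ((1 : K) ⊗ₜ[ℂ] D) k = (wt (K := ℂ) D k).baseChange K := by
  have := charZero_of_algebra_complex K
  have hle (k : ℤ) : (wt (K := ℂ) D k).baseChange K ≤ wt (K := K) ((1 : K) ⊗ₜ[ℂ] D) k :=
    baseChange_le_iff.2 fun x hx => mem_wt_extend hx 1
  have htop : ⨆ k, (wt (K := ℂ) D k).baseChange K = ⊤ := by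
    rw [eq_top_iff, ← Submodule.baseChange_top (R := ℂ), ← hD, baseChange_le_iff]
    intro x hx
    induction hx using Submodule.iSup_induction' with
    | mem i x hx =>
      exact Submodule.mem_iSup_of_mem i (Submodule.tmul_mem_baseChange_of_mem _ hx)
    | zero => simp
    | add x y _ _ hx hy => rw [TensorProduct.tmul_add]; exact add_mem hx hy
  exact congrFun (((iSupIndep_wt (K := K) ((1 : K) ⊗ₜ[ℂ] D)).le_iff_eq_of_iSup_eq_top htop).1
    hle).symm k

theorem filt_extend {D : 𝔤} (hD : IsGrading ℂ D) (k : ℤ) :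
    filt (K := K) ((1 : K) ⊗ₜ[ℂ] D) k = (filt (K := ℂ) D k).baseChange K := by
  refine le_antisymm (filt_le fun j hj => ?_) (baseChange_le_iff.2 fun x hx => ?_)
  · rw [wt_extend K hD]
    exact Submodule.baseChange_mono K (wt_le_filt hj)
  · induction hx using filt_induction with
    | zero => simp
    | add x y _ _ hx hy => rw [TensorProduct.tmul_add]; exact add_mem hx hy
    | wt j hj x hx => exact wt_le_filt hj (mem_wt_extend hx 1)

variable [CharZero K]

theorem isAdExp_iff {x : K ⊗[ℂ] 𝔤} {g : (K ⊗[ℂ] 𝔤) ≃ₗ[K] (K ⊗[ℂ] 𝔤)} :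
    IsAdExp x g ↔ ∃ hx, g = adExp x hx := by
  constructor
  · rintro ⟨m, hm, h⟩
    exact ⟨⟨m, hm⟩, LinearEquiv.toLinearMap_injective (h.trans (coe_adExp _ hm).symm)⟩
  · rintro ⟨⟨m, hm⟩, rfl⟩
    exact ⟨m, hm, coe_adExp _ hm⟩

theorem torusPoints_eq : torusPoints K b = torusGroup (extendBasis K b) := by
  ext g
  refine ⟨fun h => ⟨h.1, fun x hx => ?_⟩, fun h => ⟨h.1, fun x hx => ?_⟩⟩
  · rw [← LieSubalgebra.mem_toSubmodule, cartan_extendBasis] at hx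
    induction hx using baseChange_induction with
    | zero => exact map_zero g
    | add x y _ _ hx hy => rw [map_add, hx, hy]
    | tmul a x hx =>
      have : a ⊗ₜ[ℂ] x = a • (1 : K) ⊗ₜ[ℂ] x := by
        rw [TensorProduct.smul_tmul', smul_eq_mul, mul_one]
      rw [this, map_smul, h.2 x hx]
  · exact h.2 _ (one_tmul_mem_cartan K b hx)

theorem unipotentPoints_eq : unipotentPoints K b = unipotentGroup (extendBasis K b) := by
  rw [unipotentPoints, unipotentGroup, posPart_extendBasis]
  simp only [isAdExp_iff]

theorem borelPoints_eq : borelPoints K b = borelGroup (extendBasis K b) := by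
  rw [borelPoints, borelGroup, torusPoints_eq, unipotentPoints_eq]

theorem adjointPoints_eq : adjointPoints K b = adjointGroup (extendBasis K b) := by
  rw [adjointPoints, adjointGroup, borelPoints_eq]
  simp only [isAdExp_iff, smul_extendBasis_f]

end BasisBaseChange

/-! ### Laurent series and multivalued series -/

section HahnSeriesOperators

variable {Γ R : Type*} [PartialOrder Γ] [AddCommMonoid Γ] [IsOrderedCancelAddMonoid Γ] [CommRing R]
  {f g f' g' : HahnSeries Γ R}

theorem hahnSeries_coeff_leibniz (T : Γ → R →+ R)
    (hT : ∀ a b x y, T (a + b) (x * y) = T a x * y + x * T b y)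
    (hf : ∀ a, f'.coeff a = T a (f.coeff a)) (hg : ∀ a, g'.coeff a = T a (g.coeff a)) (c : Γ) :
    T c ((f * g).coeff c) = (f' * g + f * g').coeff c := by
  have hf' : f'.support ⊆ f.support := fun a ha h0 => ha (by
    rw [hf, show f.coeff a = 0 from h0, map_zero])
  have hg' : g'.support ⊆ g.support := fun a ha h0 => ha (by
    rw [hg, show g.coeff a = 0 from h0, map_zero])
  rw [HahnSeries.coeff_add, HahnSeries.coeff_mul_left' f.isPWO_support hf',
    HahnSeries.coeff_mul_right' g.isPWO_support hg', HahnSeries.coeff_mul, map_sum,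
    ← Finset.sum_add_distrib]
  refine Finset.sum_congr rfl fun ij hij => ?_
  obtain ⟨-, -, rfl⟩ := Finset.mem_antidiagonal.1 hij
  rw [hT, hf, hg]

theorem hahnSeries_coeff_mul_of_map_mul (T : Γ → R →+ R)
    (hT : ∀ a b x y, T (a + b) (x * y) = T a x * T b y)
    (hf : ∀ a, f'.coeff a = T a (f.coeff a)) (hg : ∀ a, g'.coeff a = T a (g.coeff a)) (c : Γ) :
    T c ((f * g).coeff c) = (f' * g').coeff c := by
  have hf' : f'.support ⊆ f.support := fun a ha h0 => ha (by
    rw [hf, show f.coeff a = 0 from h0, map_zero])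
  have hg' : g'.support ⊆ g.support := fun a ha h0 => ha (by
    rw [hg, show g.coeff a = 0 from h0, map_zero])
  rw [HahnSeries.coeff_mul, HahnSeries.coeff_mul, map_sum]
  refine (Finset.sum_congr rfl fun ij hij => ?_ : _ = ∑ ij ∈ Finset.antidiagonal
    f.isPWO_support g.isPWO_support c, f'.coeff ij.1 * g'.coeff ij.2).trans
    (Finset.sum_subset (s₁ := Finset.antidiagonal f'.isPWO_support g'.isPWO_support c) ?_ ?_).symm
  · obtain ⟨-, -, rfl⟩ := Finset.mem_antidiagonal.1 hij
    rw [hT, hf, hg]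
  · intro ij hij
    obtain ⟨h1, h2, h3⟩ := Finset.mem_antidiagonal.1 hij
    exact Finset.mem_antidiagonal.2 ⟨hf' h1, hg' h2, h3⟩
  · intro ij hij h
    obtain ⟨-, -, h3⟩ := Finset.mem_antidiagonal.1 hij
    by_contra h0
    exact h (Finset.mem_antidiagonal.2
      ⟨fun h1 => h0 (by rw [h1, zero_mul]), fun h2 => h0 (by rw [h2, mul_zero]), h3⟩)

end HahnSeriesOperators

namespace Laurent

/-- The coefficient of `t ^ n`. -/
def coeff (f : Laurent) (n : ℤ) : ℂ := HahnSeries.coeff (f : LaurentSeries ℂ) n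

@[ext] theorem ext {f g : Laurent} (h : ∀ n, f.coeff n = g.coeff n) : f = g :=
  HahnSeries.ext (funext h)

theorem coeff_deriv (f : Laurent) (n : ℤ) : f.deriv.coeff n = (n + 1) * f.coeff (n + 1) := by
  have h : f.deriv.coeff n = Ring.choose (n + (1 : ℕ)) 1 • f.coeff (n + (1 : ℕ)) := rfl
  rw [h, Ring.choose_one_right, zsmul_eq_mul]
  push_cast
  rfl

theorem coeff_t_mul (f : Laurent) (n : ℤ) : (t * f).coeff n = f.coeff (n - 1) :=
  (HahnSeries.coeff_single_mul (Γ' := ℤ) (R := ℂ) (r := 1) (x := (f : LaurentSeries ℂ))).trans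
    (one_mul _)

theorem coeff_t_mul_deriv (f : Laurent) (n : ℤ) : (t * f.deriv).coeff n = n * f.coeff n := by
  rw [coeff_t_mul, coeff_deriv]
  simp

end Laurent

namespace MultiSeries

theorem coeff_coeffwise (T : ℂ → Polynomial ℂ →ₗ[ℂ] Polynomial ℂ) (f : MultiSeries) (a : ℂ) :
    (coeffwise T f).coeff a = T a (f.coeff a) := rfl

theorem coeffwise_leibniz {T : ℂ → Polynomial ℂ →ₗ[ℂ] Polynomial ℂ}
    (hT : ∀ a b x y, T (a + b) (x * y) = T a x * y + x * T b y) (f g : MultiSeries) :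
    coeffwise T (f * g) = coeffwise T f * g + f * coeffwise T g :=
  ext fun c => @hahnSeries_coeff_leibniz ℂ (Polynomial ℂ) _ _ _ _ f g (coeffwise T f)
    (coeffwise T g) (fun a => (T a).toAddMonoidHom) hT (fun _ => rfl) (fun _ => rfl) c

theorem coeffwise_mul {T : ℂ → Polynomial ℂ →ₗ[ℂ] Polynomial ℂ}
    (hT : ∀ a b x y, T (a + b) (x * y) = T a x * T b y) (f g : MultiSeries) :
    coeffwise T (f * g) = coeffwise T f * coeffwise T g :=
  ext fun c => @hahnSeries_coeff_mul_of_map_mul ℂ (Polynomial ℂ) _ _ _ _ f g (coeffwise T f)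
    (coeffwise T g) (fun a => (T a).toAddMonoidHom) hT (fun _ => rfl) (fun _ => rfl) c

theorem tdt_mul (f g : MultiSeries) : tdt (f * g) = tdt f * g + f * tdt g :=
  coeffwise_leibniz (fun a b x y => by
    simp only [LinearMap.add_apply, LinearMap.smul_apply, LinearMap.id_apply,
      Polynomial.derivative_mul]
    simp only [Polynomial.smul_eq_C_mul, map_add]
    ring) f g

theorem continuation_mul (f g : MultiSeries) :
    continuation (f * g) = continuation f * continuation g :=
  coeffwise_mul (fun a b x y => by
    simp only [LinearMap.smul_apply, AlgHom.toLinearMap_apply, map_mul, mul_add, Complex.exp_add]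
    simp only [Polynomial.smul_eq_C_mul, map_mul]
    ring) f g

/-- The monomial `p(log t) t^a`. -/
def monomial (a : ℂ) (p : Polynomial ℂ) : MultiSeries :=
  (HahnSeries.single a p : HahnSeries ℂ (Polynomial ℂ))

theorem coeff_monomial_same (a : ℂ) (p : Polynomial ℂ) : (monomial a p).coeff a = p :=
  HahnSeries.coeff_single_same a p

theorem coeff_monomial_of_ne {a c : ℂ} (h : c ≠ a) (p : Polynomial ℂ) :
    (monomial a p).coeff c = 0 :=
  HahnSeries.coeff_single_of_ne h

theorem coeffwise_monomial (T : ℂ → Polynomial ℂ →ₗ[ℂ] Polynomial ℂ) (a : ℂ) (p : Polynomial ℂ) :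
    coeffwise T (monomial a p) = monomial a (T a p) := by
  ext1 c
  rw [coeff_coeffwise]
  obtain rfl | h := eq_or_ne c a
  · rw [coeff_monomial_same, coeff_monomial_same]
  · rw [coeff_monomial_of_ne h, coeff_monomial_of_ne h, map_zero]

theorem monomial_mul (a c : ℂ) (p q : Polynomial ℂ) :
    monomial a p * monomial c q = monomial (a + c) (p * q) :=
  @HahnSeries.single_mul_single ℂ (Polynomial ℂ) _ _ _ _ a c p q

theorem monomial_zero_one : monomial 0 1 = 1 := rfl

theorem monomial_add (a : ℂ) (p q : Polynomial ℂ) :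
    monomial a (p + q) = monomial a p + monomial a q := by
  ext1 d
  rw [coeff_add]
  obtain rfl | h := eq_or_ne d a
  · simp only [coeff_monomial_same]
  · simp only [coeff_monomial_of_ne h, add_zero]

theorem algebraMap_eq (c : ℂ) : algebraMap ℂ MultiSeries c = monomial 0 (Polynomial.C c) :=
  @HahnSeries.algebraMap_apply ℂ ℂ _ _ _ _ (Polynomial ℂ) _ _ c

theorem smul_monomial (a c : ℂ) (p : Polynomial ℂ) : c • monomial a p = monomial a (c • p) := by
  ext1 d
  rw [coeff_smul]
  obtain rfl | h := eq_or_ne d a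
  · rw [coeff_monomial_same, coeff_monomial_same]
  · rw [coeff_monomial_of_ne h, coeff_monomial_of_ne h, smul_zero]

theorem tdt_monomial (a : ℂ) (p : Polynomial ℂ) :
    tdt (monomial a p) = monomial a (a • p + Polynomial.derivative p) :=
  coeffwise_monomial _ a p

theorem continuation_monomial (a : ℂ) (p : Polynomial ℂ) :
    continuation (monomial a p) = monomial a (Complex.exp (2 * Real.pi * Complex.I * a) •
      Polynomial.aeval (Polynomial.X + Polynomial.C (2 * Real.pi * Complex.I)) p) :=
  coeffwise_monomial _ a p

/-- The constants of the derivation `t d/dt` are the complex numbers. -/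
theorem exists_eq_algebraMap_of_tdt_eq_zero {f : MultiSeries} (h : tdt f = 0) :
    ∃ c, f = algebraMap ℂ MultiSeries c := by
  have h' (a : ℂ) : a • f.coeff a + Polynomial.derivative (f.coeff a) = 0 :=
    congrArg (fun g : MultiSeries => g.coeff a) h
  have h0 (a : ℂ) (ha : a ≠ 0) : f.coeff a = 0 := by
    by_contra hp
    have h1 := Polynomial.degree_derivative_lt hp
    rw [← neg_eq_of_add_eq_zero_right (h' a), Polynomial.degree_neg,
      Polynomial.degree_smul_of_smul_regular _ (IsSMulRegular.of_ne_zero ha)] at h1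
    exact h1.false
  refine ⟨(f.coeff 0).coeff 0, ?_⟩
  rw [algebraMap_eq]
  ext1 a
  obtain rfl | ha := eq_or_ne a 0
  · rw [coeff_monomial_same]
    have := h' 0
    rw [zero_smul, zero_add] at this
    exact Polynomial.eq_C_of_derivative_eq_zero this
  · rw [h0 a ha, coeff_monomial_of_ne ha]

theorem ofLaurent_mul (f g : Laurent) : ofLaurent (f * g) = ofLaurent f * ofLaurent g := by
  have h := HahnSeries.embDomain_mul (R := ℂ)
    (⟨⟨fun n : ℤ => (n : ℂ), Int.cast_injective⟩, Int.cast_le⟩ : ℤ ↪o ℂ)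
    (fun _ _ => Int.cast_add _ _) (f : LaurentSeries ℂ) g
  exact (congrArg (fun h : HahnSeries ℂ ℂ => h.map (Polynomial.C : ℂ →+* Polynomial ℂ)) h).trans
    (HahnSeries.map_mul (Polynomial.C : ℂ →+* Polynomial ℂ).toNonUnitalRingHom)

theorem coeff_ofLaurent (f : Laurent) (n : ℤ) :
    (ofLaurent f).coeff n = Polynomial.C (f.coeff n) :=
  congrArg Polynomial.C (HahnSeries.embDomain_coeff (a := n)
    (f := (⟨⟨fun n : ℤ => (n : ℂ), Int.cast_injective⟩, Int.cast_le⟩ : ℤ ↪o ℂ))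
    (x := (f : LaurentSeries ℂ)))

theorem coeff_ofLaurent_of_forall_ne (f : Laurent) {a : ℂ} (h : ∀ n : ℤ, a ≠ n) :
    (ofLaurent f).coeff a = 0 :=
  (congrArg Polynomial.C (HahnSeries.embDomain_of_notMem_range
    (f := (⟨⟨fun n : ℤ => (n : ℂ), Int.cast_injective⟩, Int.cast_le⟩ : ℤ ↪o ℂ))
    (x := (f : LaurentSeries ℂ)) fun ⟨n, hn⟩ => h n hn.symm)).trans Polynomial.C_0

theorem ofLaurent_injective : Function.Injective ofLaurent := fun f g h =>
  Laurent.ext fun n => Polynomial.C_injective (by rw [← coeff_ofLaurent, h, coeff_ofLaurent])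

theorem ext_ofLaurent {f : Laurent} {g : MultiSeries}
    (h : ∀ n : ℤ, Polynomial.C (f.coeff n) = g.coeff n)
    (h' : ∀ a : ℂ, (∀ n : ℤ, a ≠ n) → g.coeff a = 0) : ofLaurent f = g := by
  ext1 a
  by_cases ha : ∀ n : ℤ, a ≠ n
  · rw [coeff_ofLaurent_of_forall_ne f ha, h' a ha]
  · push Not at ha
    obtain ⟨n, rfl⟩ := ha
    rw [coeff_ofLaurent, h]

theorem ofLaurent_one : ofLaurent 1 = 1 := by
  refine ext_ofLaurent (fun n => ?_) fun a ha => ?_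
  · obtain rfl | hn := eq_or_ne n 0
    · rw [Int.cast_zero, ← monomial_zero_one, coeff_monomial_same]
      exact congrArg _ (HahnSeries.coeff_single_same (0 : ℤ) (1 : ℂ))
    · rw [← monomial_zero_one, coeff_monomial_of_ne (Int.cast_ne_zero.2 hn)]
      exact (congrArg Polynomial.C
        (HahnSeries.coeff_single_of_ne (a := (0 : ℤ)) (r := (1 : ℂ)) hn)).trans Polynomial.C_0
  · rw [← monomial_zero_one, coeff_monomial_of_ne]
    simpa using ha 0

theorem tdt_ofLaurent (f : Laurent) : tdt (ofLaurent f) = ofLaurent (Laurent.t * f.deriv) := by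
  refine (ext_ofLaurent (fun n => ?_) fun a ha => ?_).symm
  · rw [tdt, coeff_coeffwise, coeff_ofLaurent, Laurent.coeff_t_mul_deriv]
    simp [Polynomial.smul_eq_C_mul]
  · rw [tdt, coeff_coeffwise, coeff_ofLaurent_of_forall_ne _ ha, map_zero]

theorem continuation_ofLaurent (f : Laurent) : continuation (ofLaurent f) = ofLaurent f := by
  refine (ext_ofLaurent (fun n => ?_) fun a ha => ?_).symm
  · rw [continuation, coeff_coeffwise, coeff_ofLaurent]
    have : Complex.exp (2 * Real.pi * Complex.I * n) = 1 :=
      Complex.exp_eq_one_iff.2 ⟨n, by ring⟩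
    simp [this]
  · rw [continuation, coeff_coeffwise, coeff_ofLaurent_of_forall_ne _ ha, map_zero]

end MultiSeries

namespace Laurent

theorem t_ne_zero : t ≠ 0 := fun h => by
  have := congrArg (fun f => coeff f 1) h
  exact one_ne_zero (α := ℂ) ((HahnSeries.coeff_single_same (1 : ℤ) (1 : ℂ)).symm.trans this)

theorem deriv_mul (f g : Laurent) : deriv (f * g) = deriv f * g + f * deriv g := by
  refine mul_left_cancel₀ t_ne_zero (MultiSeries.ofLaurent_injective ?_)
  rw [← MultiSeries.tdt_ofLaurent, MultiSeries.ofLaurent_mul, MultiSeries.tdt_mul,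
    MultiSeries.tdt_ofLaurent, MultiSeries.tdt_ofLaurent, ← MultiSeries.ofLaurent_mul,
    ← MultiSeries.ofLaurent_mul, ← map_add]
  congr 1
  ring

theorem deriv_one : deriv 1 = 0 := by
  have := deriv_mul 1 1
  simpa using this

theorem deriv_t : deriv t = 1 := by
  ext1 n
  rw [coeff_deriv]
  obtain rfl | hn := eq_or_ne n 0
  · have h1 : coeff t 1 = 1 := HahnSeries.coeff_single_same (1 : ℤ) (1 : ℂ)
    have h2 : coeff 1 0 = 1 := HahnSeries.coeff_single_same (0 : ℤ) (1 : ℂ)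
    simp [h1, h2]
  · have h1 : coeff t (n + 1) = 0 := HahnSeries.coeff_single_of_ne (by simpa using hn)
    have h2 : coeff 1 n = 0 := HahnSeries.coeff_single_of_ne hn
    simp [h1, h2]

theorem deriv_inv {f : Laurent} (hf : f ≠ 0) : deriv f⁻¹ = -(f⁻¹ * f⁻¹ * deriv f) := by
  have := deriv_mul f f⁻¹
  rw [mul_inv_cancel₀ hf, deriv_one] at this
  have e : deriv f⁻¹ = f⁻¹ * (f * deriv f⁻¹) := by rw [inv_mul_cancel_left₀ hf]
  rw [e, ← neg_eq_of_add_eq_zero_right this.symm]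
  ring

theorem ofPowerSeries_mul (f g : PowerSeries ℂ) :
    ofPowerSeries (f * g) = ofPowerSeries f * ofPowerSeries g :=
  map_mul (HahnSeries.ofPowerSeries ℤ ℂ) f g

theorem ofPowerSeries_one : ofPowerSeries 1 = 1 := map_one (HahnSeries.ofPowerSeries ℤ ℂ)

theorem ofPowerSeries_X : ofPowerSeries PowerSeries.X = t := HahnSeries.ofPowerSeries_X

theorem ofPowerSeries_injective : Function.Injective ofPowerSeries :=
  HahnSeries.ofPowerSeries_injective

theorem coeff_ofPowerSeries (f : PowerSeries ℂ) (n : ℕ) :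
    coeff (ofPowerSeries f) n = PowerSeries.coeff n f :=
  HahnSeries.ofPowerSeries_apply_coeff f n

theorem coeff_ofPowerSeries_of_neg (f : PowerSeries ℂ) {n : ℤ} (hn : n < 0) :
    coeff (ofPowerSeries f) n = 0 :=
  (PowerSeries.coeff_coe f n).trans (if_pos hn)

/-- The inclusion `ℂ[[t]] → ℂ((t))`, as a ring homomorphism. -/
def ofPowerSeriesHom : PowerSeries ℂ →ₐ[ℂ] Laurent :=
  AlgHom.ofLinearMap ofPowerSeries ofPowerSeries_one ofPowerSeries_mul

theorem deriv_ofPowerSeries (f : PowerSeries ℂ) :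
    deriv (ofPowerSeries f) = ofPowerSeries (PowerSeries.derivative ℂ f) := by
  ext1 n
  rw [coeff_deriv]
  obtain hn | hn := le_or_gt 0 n
  · lift n to ℕ using hn
    rw [coeff_ofPowerSeries, PowerSeries.coeff_derivative, mul_comm, Int.cast_natCast]
    exact congrArg (· * ((n : ℂ) + 1)) (coeff_ofPowerSeries f (n + 1))
  · rw [coeff_ofPowerSeries_of_neg _ hn]
    obtain rfl | hn' := eq_or_ne n (-1)
    · simp
    · rw [coeff_ofPowerSeries_of_neg _ (by omega), mul_zero]

theorem exists_eq_zpow_mul {f : Laurent} (hf : f ≠ 0) :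
    ∃ (n : ℤ) (g : PowerSeries ℂ), PowerSeries.coeff 0 g ≠ 0 ∧ f = t ^ n * ofPowerSeries g := by
  have key (f : LaurentSeries ℂ) (hf : f ≠ 0) : ∃ (n : ℤ) (g : PowerSeries ℂ),
      PowerSeries.coeff 0 g ≠ 0 ∧
      f = (HahnSeries.single 1 1 : LaurentSeries ℂ) ^ n * HahnSeries.ofPowerSeries ℤ ℂ g := by
    refine ⟨f.order, LaurentSeries.powerSeriesPart f, ?_, ?_⟩
    · rw [LaurentSeries.powerSeriesPart_coeff]
      simpa using hf
    · rw [← RatFunc.single_zpow, LaurentSeries.single_order_mul_powerSeriesPart]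
  exact key f hf

theorem inv_ofPowerSeries {g : PowerSeries ℂ} (hg : PowerSeries.coeff 0 g ≠ 0) :
    (ofPowerSeries g)⁻¹ = ofPowerSeries g⁻¹ := by
  refine (eq_inv_of_mul_eq_one_right ?_).symm
  rw [← ofPowerSeries_mul, PowerSeries.mul_inv_cancel _ (by simpa using hg), ofPowerSeries_one]

/-- The subring `ℂ[[t]]` of `ℂ((t))`. -/
def integers : Subring Laurent := ofPowerSeriesHom.toRingHom.range

theorem t_mem_integers : t ∈ integers := ⟨PowerSeries.X, ofPowerSeries_X⟩

theorem ofPowerSeries_mem_integers (f : PowerSeries ℂ) : ofPowerSeries f ∈ integers := ⟨f, rfl⟩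

theorem mem_integers_or_inv_mem_integers (f : Laurent) : f ∈ integers ∨ f⁻¹ ∈ integers := by
  obtain rfl | hf := eq_or_ne f 0
  · exact Or.inl (zero_mem _)
  obtain ⟨n, g, hg, rfl⟩ := exists_eq_zpow_mul hf
  obtain ⟨n, rfl | rfl⟩ := n.eq_nat_or_neg
  · rw [zpow_natCast]
    exact Or.inl (mul_mem (pow_mem t_mem_integers n) (ofPowerSeries_mem_integers g))
  · rw [zpow_neg, zpow_natCast, mul_inv, inv_inv, inv_ofPowerSeries hg]
    exact Or.inr (mul_mem (pow_mem t_mem_integers n) (ofPowerSeries_mem_integers _))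

instance : CharZero Laurent := charZero_of_algebra_complex Laurent

end Laurent

/-! ### Derivations and homomorphisms of the coefficients -/

section Coefficients

variable {R S 𝔤 : Type*} [CommRing R] [Algebra ℂ R] [CommRing S] [Algebra ℂ S]
  [LieRing 𝔤] [LieAlgebra ℂ 𝔤]

theorem rTensor_mem_baseChange (φ : R →ₗ[ℂ] S) {p : Submodule ℂ 𝔤} {X : R ⊗[ℂ] 𝔤}
    (hX : X ∈ p.baseChange R) : φ.rTensor 𝔤 X ∈ p.baseChange S := by
  induction hX using baseChange_induction with
  | zero => rw [map_zero]; exact zero_mem _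
  | add x y _ _ hx hy => rw [map_add]; exact add_mem hx hy
  | tmul a x hx => exact Submodule.tmul_mem_baseChange_of_mem _ hx

section Derivation

variable {δ : R →ₗ[ℂ] R} (hδ : ∀ a c, δ (a * c) = δ a * c + a * δ c)
include hδ

theorem rTensor_derivation_smul (a : R) (X : R ⊗[ℂ] 𝔤) :
    δ.rTensor 𝔤 (a • X) = δ a • X + a • δ.rTensor 𝔤 X := by
  induction X using TensorProduct.induction_on with
  | zero => simp
  | tmul c x =>
    simp only [TensorProduct.smul_tmul', LinearMap.rTensor_tmul, smul_eq_mul, hδ,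
      TensorProduct.add_tmul]
  | add X Y hX hY => simp only [smul_add, map_add, hX, hY]; abel

theorem rTensor_derivation_lie (X Y : R ⊗[ℂ] 𝔤) :
    δ.rTensor 𝔤 ⁅X, Y⁆ = ⁅δ.rTensor 𝔤 X, Y⁆ + ⁅X, δ.rTensor 𝔤 Y⁆ := by
  induction X using TensorProduct.induction_on with
  | zero => simp
  | add X X' hX hX' => simp only [add_lie, map_add, hX, hX']; abel
  | tmul a x =>
    induction Y using TensorProduct.induction_on with
    | zero => simp
    | add X X' hX hX' => simp only [lie_add, map_add, hX, hX']; abel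
    | tmul c y =>
      simp only [LieAlgebra.ExtendScalars.bracket_tmul, LinearMap.rTensor_tmul, hδ,
        TensorProduct.add_tmul]

end Derivation

section Hom

variable {φ : R →ₗ[ℂ] S} (hφ : ∀ a c, φ (a * c) = φ a * φ c)
include hφ

theorem rTensor_hom_smul (a : R) (X : R ⊗[ℂ] 𝔤) : φ.rTensor 𝔤 (a • X) = φ a • φ.rTensor 𝔤 X := by
  induction X using TensorProduct.induction_on with
  | zero => simp
  | tmul c x => simp only [TensorProduct.smul_tmul', LinearMap.rTensor_tmul, smul_eq_mul, hφ]
  | add X Y hX hY => simp only [smul_add, map_add, hX, hY]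

theorem rTensor_hom_lie (X Y : R ⊗[ℂ] 𝔤) :
    φ.rTensor 𝔤 ⁅X, Y⁆ = ⁅φ.rTensor 𝔤 X, φ.rTensor 𝔤 Y⁆ := by
  induction X using TensorProduct.induction_on with
  | zero => simp
  | add X X' hX hX' => simp only [add_lie, map_add, hX, hX']
  | tmul a x =>
    induction Y using TensorProduct.induction_on with
    | zero => simp
    | add X X' hX hX' => simp only [lie_add, map_add, hX, hX']
    | tmul c y => simp only [LieAlgebra.ExtendScalars.bracket_tmul, LinearMap.rTensor_tmul, hφ]

end Hom

end Coefficients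

/-! ### Gauge transformations -/

section Gauge

variable {𝔤 : Type*} [LieRing 𝔤] [LieAlgebra ℂ 𝔤]

theorem dt_tmul (a : Laurent) (x : 𝔤) : dt (a ⊗ₜ[ℂ] x) = a.deriv ⊗ₜ x := rfl

theorem dt_smul (a : Laurent) (X : Laurent ⊗[ℂ] 𝔤) : dt (a • X) = a.deriv • X + a • dt X :=
  rTensor_derivation_smul Laurent.deriv_mul a X

theorem dt_lie (X Y : Laurent ⊗[ℂ] 𝔤) : dt ⁅X, Y⁆ = ⁅dt X, Y⁆ + ⁅X, dt Y⁆ :=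
  rTensor_derivation_lie Laurent.deriv_mul X Y

variable {g g' : (Laurent ⊗[ℂ] 𝔤) ≃ₗ[Laurent] (Laurent ⊗[ℂ] 𝔤)} {A A' A'' θ : Laurent ⊗[ℂ] 𝔤}

theorem IsGauge.mul (h' : IsGauge g' A' A'') (h : IsGauge g A A') : IsGauge (g' * g) A A'' :=
  fun x => by rw [LinearEquiv.mul_apply, LinearEquiv.mul_apply, h, h']

theorem IsGauge.inv (h : IsGauge g A A') : IsGauge g⁻¹ A' A := fun x => by
  change g.symm _ = dt (g.symm x) + ⁅A, g.symm x⁆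
  rw [LinearEquiv.symm_apply_eq, h, g.apply_symm_apply]

theorem isGauge_one (A : Laurent ⊗[ℂ] 𝔤) : IsGauge 1 A A := fun _ => rfl

theorem isGauge_zero_iff : IsGauge g 0 θ ↔ ∀ x, g (dt x) = dt (g x) + ⁅θ, g x⁆ := by
  simp [IsGauge]

theorem IsGauge.of_zero (hg : g ∈ lieAut Laurent (Laurent ⊗[ℂ] 𝔤)) (h : IsGauge g 0 θ)
    (A : Laurent ⊗[ℂ] 𝔤) : IsGauge g A (g A + θ) := fun x => by
  rw [map_add, isGauge_zero_iff.1 h, lieAut.map_lie hg, add_lie]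
  abel

/-- The operator `∂_t + ad A` is conjugate under `exp (ad X)` to `∂_t + ad (exp (ad X) A - ∂_t X)` if
`X` commutes with its derivative. -/
theorem isGauge_adExp {X : Laurent ⊗[ℂ] 𝔤} (hX : IsNilpotent (LieAlgebra.ad Laurent _ X))
    (h : ⁅X, dt X⁆ = 0) : IsGauge (adExp X hX) 0 (-dt X) := by
  obtain ⟨m, hm⟩ := id hX
  have hm' : LieAlgebra.ad Laurent _ X ^ (m + 1) = 0 := by rw [pow_succ, hm, zero_mul]
  have hcomm (Z : Laurent ⊗[ℂ] 𝔤) : ⁅X, ⁅dt X, Z⁆⁆ = ⁅dt X, ⁅X, Z⁆⁆ := by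
    rw [leibniz_lie, h, zero_lie, zero_add]
  have hpow (n : ℕ) (Z : Laurent ⊗[ℂ] 𝔤) : dt ((LieAlgebra.ad Laurent _ X ^ n) Z) =
      (LieAlgebra.ad Laurent _ X ^ n) (dt Z) +
        n • ⁅dt X, (LieAlgebra.ad Laurent _ X ^ (n - 1)) Z⁆ := by
    induction n with
    | zero => simp
    | succ n ih =>
      rw [pow_succ', Module.End.mul_apply, Module.End.mul_apply, LieAlgebra.ad_apply, dt_lie, ih,
        lie_add, LieAlgebra.ad_apply, lie_nsmul, hcomm, succ_nsmul, add_tsub_cancel_right]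
      cases n with
      | zero => simp [add_comm]
      | succ n =>
        rw [add_tsub_cancel_right, pow_succ' _ n, Module.End.mul_apply, LieAlgebra.ad_apply]
        abel
  have hd (n : ℕ) (Z : Laurent ⊗[ℂ] 𝔤) :
      dt ((n.factorial : Laurent)⁻¹ • Z) = (n.factorial : Laurent)⁻¹ • dt Z := by
    have h0 : Laurent.deriv (n.factorial : Laurent)⁻¹ = 0 := by
      have e : (n.factorial : Laurent)⁻¹ = algebraMap ℂ Laurent (n.factorial : ℂ)⁻¹ := by
        rw [map_inv₀, map_natCast]
      rw [e, Algebra.algebraMap_eq_smul_one, map_smul, Laurent.deriv_one, smul_zero]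
    rw [dt_smul, h0, zero_smul, zero_add]
  rw [isGauge_zero_iff]
  intro Z
  rw [neg_lie, ← sub_eq_add_neg, eq_sub_iff_add_eq, adExp_apply hX hm', adExp_apply hX hm' Z, map_sum]
  simp only [hd, hpow, smul_add, Finset.sum_add_distrib]
  rw [add_right_inj, ← adExp_apply hX hm', adExp_apply hX hm, Finset.sum_range_succ', lie_sum]
  simp only [zero_smul, smul_zero, add_zero, add_tsub_cancel_right, lie_smul]
  refine Finset.sum_congr rfl fun n _ => ?_
  rw [← Nat.cast_smul_eq_nsmul Laurent, smul_smul, Nat.factorial_succ]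
  congr 1
  have h1 : ((n + 1 : ℕ) : Laurent) ≠ 0 := Nat.cast_ne_zero.2 n.succ_ne_zero
  rw [Nat.cast_mul, mul_inv, mul_right_comm, inv_mul_cancel₀ h1, one_mul]

theorem isGauge_adExp_tmul {a : Laurent} {y : 𝔤}
    (hX : IsNilpotent (LieAlgebra.ad Laurent (Laurent ⊗[ℂ] 𝔤) (a ⊗ₜ y))) :
    IsGauge (adExp (a ⊗ₜ[ℂ] y) hX) 0 (-(a.deriv ⊗ₜ y)) :=
  isGauge_adExp hX (by
    rw [dt_tmul, LieAlgebra.ExtendScalars.bracket_tmul, lie_self, TensorProduct.tmul_zero])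

variable [FiniteDimensional ℂ 𝔤] [LieAlgebra.IsKilling ℂ 𝔤]

theorem eq_of_forall_lie_eq (K : Type*) [Field K] [Algebra ℂ K] {X Y : K ⊗[ℂ] 𝔤}
    (h : ∀ Z : K ⊗[ℂ] 𝔤, ⁅X, Z⁆ = ⁅Y, Z⁆) : X = Y := by
  have := charZero_of_algebra_complex K
  have := isKilling_baseChange K (K := ℂ) (L := 𝔤)
  have h1 : X - Y ∈ LieAlgebra.center K (K ⊗[ℂ] 𝔤) := by
    rw [LieModule.mem_maxTrivSubmodule]
    intro Z
    rw [← lie_skew, sub_lie, h, sub_self, neg_zero]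
  rw [LieAlgebra.center_eq_bot, LieSubmodule.mem_bot] at h1
  exact sub_eq_zero.1 h1

theorem IsGauge.unique (h : IsGauge g A A') (h' : IsGauge g A A'') : A' = A'' :=
  eq_of_forall_lie_eq Laurent fun Z => by
    have h1 := h (g.symm Z)
    rw [h' (g.symm Z), g.apply_symm_apply, add_right_inj] at h1
    exact h1.symm

/-- Every derivation of `𝔤((t))` is inner, so that automorphisms act on connections. -/
theorem exists_isGauge_zero (hg : g ∈ lieAut Laurent (Laurent ⊗[ℂ] 𝔤)) : ∃ θ, IsGauge g 0 θ := by
  have := isKilling_baseChange Laurent (K := ℂ) (L := 𝔤)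
  let D : LieDerivation Laurent (Laurent ⊗[ℂ] 𝔤) (Laurent ⊗[ℂ] 𝔤) :=
    { toFun x := g (dt (g.symm x)) - dt x
      map_add' x y := by simp only [map_add]; abel
      map_smul' c x := by
        simp only [map_smul, dt_smul, map_add, LinearEquiv.apply_symm_apply, RingHom.id_apply,
          smul_sub]
        abel
      leibniz' x y := by
        have e : g.symm ⁅x, y⁆ = ⁅g.symm x, g.symm y⁆ := lieAut.map_lie (inv_mem hg) x y
        simp only [LinearMap.coe_mk, AddHom.coe_mk]
        rw [e, dt_lie, dt_lie, map_add, lieAut.map_lie hg, lieAut.map_lie hg, g.apply_symm_apply,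
          g.apply_symm_apply, lie_sub, lie_sub, ← lie_skew y (g _), ← lie_skew y (dt x)]
        abel }
  obtain ⟨θ, hθ⟩ := LieDerivation.IsKilling.exists_eq_ad D
  refine ⟨θ, isGauge_zero_iff.2 fun x => ?_⟩
  have h1 : ⁅θ, g x⁆ = g (dt (g.symm (g x))) - dt (g x) := by
    rw [← LieDerivation.ad_apply_apply Laurent, hθ]
    rfl
  rw [h1, g.symm_apply_apply]
  abel

end Gauge

/-! ### The lattice `𝔤[[t]]` -/

section Lattice

variable {𝔤 : Type*} [LieRing 𝔤] [LieAlgebra ℂ 𝔤]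

variable (𝔤) in
/-- The lattice `𝔤[[t]]` in `𝔤((t))`. -/
def integralLattice : Submodule ℂ (Laurent ⊗[ℂ] 𝔤) := LinearMap.range ofIntegral

variable {X Y A : Laurent ⊗[ℂ] 𝔤} {a : Laurent}

theorem ofIntegral_tmul (f : PowerSeries ℂ) (x : 𝔤) :
    ofIntegral (f ⊗ₜ x) = Laurent.ofPowerSeries f ⊗ₜ[ℂ] x := rfl

theorem ofIntegral_smul (f : PowerSeries ℂ) (X : PowerSeries ℂ ⊗[ℂ] 𝔤) :
    ofIntegral (f • X) = Laurent.ofPowerSeries f • ofIntegral X :=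
  rTensor_hom_smul Laurent.ofPowerSeries_mul f X

theorem ofIntegral_lie (X Y : PowerSeries ℂ ⊗[ℂ] 𝔤) :
    ofIntegral ⁅X, Y⁆ = ⁅ofIntegral X, ofIntegral Y⁆ :=
  rTensor_hom_lie Laurent.ofPowerSeries_mul X Y

theorem ofIntegral_one_tmul (x : 𝔤) : ofIntegral (1 ⊗ₜ x) = 1 ⊗ₜ[ℂ] x := by
  rw [ofIntegral_tmul, Laurent.ofPowerSeries_one]

theorem ofIntegral_injective : Function.Injective (ofIntegral (𝔤 := 𝔤)) :=
  Module.Flat.rTensor_preserves_injective_linearMap _ Laurent.ofPowerSeries_injective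

theorem ofIntegral_mem (X : PowerSeries ℂ ⊗[ℂ] 𝔤) : ofIntegral X ∈ integralLattice 𝔤 := ⟨X, rfl⟩

theorem tmul_mem_integralLattice (ha : a ∈ Laurent.integers) (x : 𝔤) :
    a ⊗ₜ x ∈ integralLattice 𝔤 := by
  obtain ⟨f, rfl⟩ := ha
  exact ofIntegral_mem (f ⊗ₜ x)

theorem smul_mem_integralLattice (ha : a ∈ Laurent.integers) (hX : X ∈ integralLattice 𝔤) :
    a • X ∈ integralLattice 𝔤 := by
  obtain ⟨f, rfl⟩ := ha
  obtain ⟨X, rfl⟩ := hX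
  exact ⟨f • X, ofIntegral_smul f X⟩

theorem lie_mem_integralLattice (hX : X ∈ integralLattice 𝔤) (hY : Y ∈ integralLattice 𝔤) :
    ⁅X, Y⁆ ∈ integralLattice 𝔤 := by
  obtain ⟨X, rfl⟩ := hX
  obtain ⟨Y, rfl⟩ := hY
  exact ⟨⁅X, Y⁆, ofIntegral_lie X Y⟩

theorem hasSimplePole_iff : HasSimplePole A ↔ Laurent.t • A ∈ integralLattice 𝔤 := by
  constructor
  · rintro ⟨X, rfl⟩
    exact ⟨X, by rw [smul_inv_smul₀ Laurent.t_ne_zero]⟩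
  · rintro ⟨X, h⟩
    exact ⟨X, by rw [h, inv_smul_smul₀ Laurent.t_ne_zero]⟩

theorem inv_factorial_mem_integers (n : ℕ) : (n.factorial : Laurent)⁻¹ ∈ Laurent.integers :=
  ⟨algebraMap ℂ _ (n.factorial : ℂ)⁻¹, by
    have e : (n.factorial : Laurent)⁻¹ = algebraMap ℂ Laurent (n.factorial : ℂ)⁻¹ := by
      rw [map_inv₀, map_natCast]
    rw [e]
    exact Laurent.ofPowerSeriesHom.commutes _⟩

theorem adExp_mem_integralLattice (hX : IsNilpotent (LieAlgebra.ad Laurent _ X))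
    (h : X ∈ integralLattice 𝔤) (hY : Y ∈ integralLattice 𝔤) :
    adExp X hX Y ∈ integralLattice 𝔤 := by
  obtain ⟨m, hm⟩ := id hX
  rw [adExp_apply hX hm]
  refine sum_mem fun n hn => smul_mem_integralLattice (inv_factorial_mem_integers n) ?_
  clear hn
  induction n with
  | zero => simpa
  | succ n ih =>
    rw [pow_succ', Module.End.mul_apply]
    exact lie_mem_integralLattice h ih

variable [FiniteDimensional ℂ 𝔤] {ι : Type*} [Fintype ι] {𝔥 : LieSubalgebra ℂ 𝔤}
  (b : LieAlgebra.Basis ι 𝔥) {g : (Laurent ⊗[ℂ] 𝔤) ≃ₗ[Laurent] (Laurent ⊗[ℂ] 𝔤)}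

/-- Gauge transformations by `G[[t]]` preserve connections with at most a simple pole. -/
theorem exists_gauge_of_mem_integralGroup
    (hg : g ∈ integralGroup (extendBasis Laurent b) Laurent.integers) :
    g ∈ lieAut Laurent _ ∧ (∀ X ∈ integralLattice 𝔤, g X ∈ integralLattice 𝔤) ∧
      (∀ X ∈ integralLattice 𝔤, g⁻¹ X ∈ integralLattice 𝔤) ∧
      ∃ θ ∈ integralLattice 𝔤, IsGauge g 0 θ := by
  have key (a : Laurent) (ha : a ∈ Laurent.integers) (y : 𝔤)
      (h : IsNilpotent (LieAlgebra.ad Laurent (Laurent ⊗[ℂ] 𝔤) (a ⊗ₜ y))) :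
      adExp (a ⊗ₜ y) h ∈ lieAut Laurent _ ∧
      (∀ X ∈ integralLattice 𝔤, adExp (a ⊗ₜ y) h X ∈ integralLattice 𝔤) ∧
      (∀ X ∈ integralLattice 𝔤, (adExp (a ⊗ₜ y) h)⁻¹ X ∈ integralLattice 𝔤) ∧
      ∃ θ ∈ integralLattice 𝔤, IsGauge (adExp (a ⊗ₜ y) h) 0 θ := by
    have hy := tmul_mem_integralLattice ha y
    refine ⟨adExp_mem_lieAut h, fun X hX => adExp_mem_integralLattice h hy hX, fun X hX => ?_,
      _, neg_mem (tmul_mem_integralLattice ?_ y), isGauge_adExp_tmul h⟩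
    · have h' : IsNilpotent (LieAlgebra.ad Laurent (Laurent ⊗[ℂ] 𝔤) (-(a ⊗ₜ y))) := by
        rw [map_neg]; exact h.neg
      rw [← adExp_neg h h']
      exact adExp_mem_integralLattice h' (neg_mem hy) hX
    · obtain ⟨f, rfl⟩ := ha
      exact ⟨_, (Laurent.deriv_ofPowerSeries f).symm⟩
  induction hg using Subgroup.closure_induction with
  | mem g hg =>
    obtain ⟨i, a, ha, ⟨h, rfl⟩ | ⟨h, rfl⟩⟩ := hg
    · simp only [smul_extendBasis_e] at h ⊢
      exact key a ha _ h
    · simp only [smul_extendBasis_f] at h ⊢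
      exact key a ha _ h
  | one => exact ⟨one_mem _, fun _ h => h, fun X h => by simpa using h, 0, zero_mem _, isGauge_one _⟩
  | mul g g' _ _ hg hg' =>
    obtain ⟨h1, h2, h3, θ, hθ, h4⟩ := hg
    obtain ⟨h1', h2', h3', θ', hθ', h4'⟩ := hg'
    refine ⟨mul_mem h1 h1', fun X hX => h2 _ (h2' X hX), fun X hX => ?_, g θ' + θ,
      add_mem (h2 _ hθ') hθ, (h4.of_zero h1 θ').mul h4'⟩
    rw [mul_inv_rev]
    exact h3' _ (h3 X hX)
  | inv g _ hg =>
    obtain ⟨h1, h2, h3, θ, hθ, h4⟩ := hg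
    refine ⟨inv_mem h1, h3, by simpa using h2, g⁻¹ (-θ), h3 _ (neg_mem hθ), ?_⟩
    have := h4.of_zero h1 (g⁻¹ (-θ))
    rw [← LinearEquiv.mul_apply, mul_inv_cancel, LinearEquiv.coe_one, id, neg_add_cancel] at this
    exact this.inv

theorem HasSimplePole.exists_isGauge (hA : HasSimplePole A)
    (hg : g ∈ integralGroup (extendBasis Laurent b) Laurent.integers) :
    ∃ A', HasSimplePole A' ∧ IsGauge g A A' := by
  obtain ⟨h1, h2, -, θ, hθ, h4⟩ := exists_gauge_of_mem_integralGroup b hg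
  refine ⟨_, hasSimplePole_iff.2 ?_, h4.of_zero h1 A⟩
  rw [smul_add, ← map_smul]
  exact add_mem (h2 _ (hasSimplePole_iff.1 hA)) (smul_mem_integralLattice Laurent.t_mem_integers hθ)

end Lattice

/-! ### Gauge transformations and filtrations -/

section GaugeFiltration

/-- In a graded Lie algebra with trivial center, `x` has degree at least `r` if `ad x` raises the
filtration by `r`. -/
theorem mem_filt_of_forall_lie_mem {K L : Type*} [Field K] [CharZero K] [LieRing L]
    [LieAlgebra K L] [FiniteDimensional K L] {D x : L} {r : ℤ} (hD : IsGrading K D)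
    (hc : ∀ x : L, (∀ y : L, ⁅x, y⁆ = 0) → x = 0)
    (h : ∀ k, ∀ y ∈ wt (K := K) D k, ⁅x, y⁆ ∈ filt (K := K) D (k + r)) :
    x ∈ filt (K := K) D r := by
  obtain ⟨N, hN⟩ := hD.exists_filt_eq_top
  have key (n : ℕ) (hn : -N + n ≤ r) : x ∈ filt (K := K) D (-N + n) := by
    induction n with
    | zero => rw [Nat.cast_zero, add_zero, hN]; trivial
    | succ n ih =>
      push_cast at hn ⊢
      obtain ⟨y, hy, z, hz, rfl⟩ := exists_wt_add_filt (ih (by omega))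
      have hy0 : y = 0 := by
        refine hc y fun w => ?_
        have hw : w ∈ ⨆ k, wt (K := K) D k := by rw [show ⨆ k, wt (K := K) D k = ⊤ from hD]; trivial
        induction hw using Submodule.iSup_induction' with
        | zero => simp
        | add w w' _ _ hw hw' => rw [lie_add, hw, hw', add_zero]
        | mem k w hw =>
          refine eq_zero_of_mem_wt_of_mem_filt (by omega : k + (-N + n) < k + (-N + n) + 1) ?_ ?_
            (D := D) (K := K)
          · rw [add_comm]
            exact lie_mem_wt hy hw
          · have h1 := h k w hw
            rw [add_lie] at h1
            have h2 := sub_mem (filt_anti (k := k + (-N + n) + 1) (by omega) h1)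
              (lie_mem_filt' hz (wt_le_filt le_rfl hw) (by omega))
            rwa [add_sub_cancel_right] at h2
      rw [hy0, zero_add, ← add_assoc]
      exact hz
  obtain hr | hr := le_total r (-N)
  · exact filt_anti hr (by rw [hN]; trivial)
  · have := key (r + N).toNat (by omega)
    rwa [show -(N : ℤ) + (r + N).toNat = r by omega] at this

/-- How far a unipotent automorphism raises the filtration is determined by its effect on the
grading element `D`. -/
theorem sub_mem_filt_of_map_sub_mem {K L : Type*} [Field K] [CharZero K] [LieRing L]
    [LieAlgebra K L] {D : L} {r : ℤ} {g : L ≃ₗ[K] L} (hg : g ∈ lieAut K L)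
    (hg1 : ∀ k, ∀ y ∈ filt (K := K) D k, g y - y ∈ filt (K := K) D (k + 1))
    (h : g D - D ∈ filt (K := K) D r) {k : ℤ} {y : L} (hy : y ∈ filt (K := K) D k) :
    g y - y ∈ filt (K := K) D (k + r) := by
  induction hy using filt_induction with
  | zero => simp
  | add x y _ _ hx hy =>
    rw [map_add, add_sub_add_comm]
    exact add_mem hx hy
  | wt j hj y hy =>
    have hgy : g y ∈ filt (K := K) D j := by
      have := add_mem (filt_anti (by omega) (hg1 j y (wt_le_filt le_rfl hy)))
        (wt_le_filt (k := j) le_rfl hy)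
      rwa [sub_add_cancel] at this
    refine filt_anti (k := k + r) (l := j + r) (by omega)
      (mem_filt_of_lie_sub_mem (by omega : j < j + 1) (hg1 j y (wt_le_filt le_rfl hy)) ?_)
    have h1 : ⁅g D, g y⁆ = (j : K) • g y := by rw [← lieAut.map_lie hg, mem_wt.1 hy, map_smul]
    have e : ⁅D, g y - y⁆ - (j : K) • (g y - y) = -⁅g D - D, g y⁆ := by
      rw [lie_sub, mem_wt.1 hy, sub_lie, h1, smul_sub]
      abel
    rw [e]
    exact neg_mem (lie_mem_filt' h hgy (by omega))

variable {𝔤 : Type*} [LieRing 𝔤] [LieAlgebra ℂ 𝔤] [FiniteDimensional ℂ 𝔤]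
  {g : (Laurent ⊗[ℂ] 𝔤) ≃ₗ[Laurent] (Laurent ⊗[ℂ] 𝔤)} {θ : Laurent ⊗[ℂ] 𝔤} {D : 𝔤} {r : ℤ}

theorem dt_mem_filt (hD : IsGrading ℂ D) {k : ℤ} {X : Laurent ⊗[ℂ] 𝔤}
    (hX : X ∈ filt (K := Laurent) ((1 : Laurent) ⊗ₜ[ℂ] D) k) :
    dt X ∈ filt (K := Laurent) ((1 : Laurent) ⊗ₜ[ℂ] D) k := by
  rw [filt_extend _ hD] at *
  exact rTensor_mem_baseChange _ hX

theorem IsGrading.extend (K : Type*) [Field K] [Algebra ℂ K] (hD : IsGrading ℂ D) :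
    IsGrading K ((1 : K) ⊗ₜ[ℂ] D) := by
  obtain ⟨N, hN⟩ := hD.exists_filt_eq_top
  have h := filt_extend K hD (-N)
  rw [hN, Submodule.baseChange_top] at h
  rw [IsGrading, eq_top_iff, ← h]
  exact filt_le fun j _ => le_iSup (fun k => wt (K := K) ((1 : K) ⊗ₜ[ℂ] D) k) j

variable [LieAlgebra.IsKilling ℂ 𝔤]

/-- If `g` is the identity up to terms raising the degree by `r`, then so is `(∂_t g) g⁻¹`. -/
theorem IsGauge.mem_filt (hD : IsGrading ℂ D)
    (h : ∀ k, ∀ z ∈ filt (K := Laurent) ((1 : Laurent) ⊗ₜ[ℂ] D) k,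
      g z - z ∈ filt (K := Laurent) ((1 : Laurent) ⊗ₜ[ℂ] D) (k + r))
    (h' : ∀ k, ∀ z ∈ filt (K := Laurent) ((1 : Laurent) ⊗ₜ[ℂ] D) k,
      g⁻¹ z ∈ filt (K := Laurent) ((1 : Laurent) ⊗ₜ[ℂ] D) k) (hθ : IsGauge g 0 θ) :
    θ ∈ filt (K := Laurent) ((1 : Laurent) ⊗ₜ[ℂ] D) r := by
  refine mem_filt_of_forall_lie_mem (hD.extend Laurent)
    (fun x hx => eq_of_forall_lie_eq Laurent fun Z => by rw [hx, zero_lie]) fun k y hy => ?_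
  have hz := h' k y (wt_le_filt le_rfl hy)
  have h1 := isGauge_zero_iff.1 hθ (g⁻¹ y)
  have e : g (g⁻¹ y) = y := g.apply_symm_apply y
  rw [e] at h1
  have h2 : ⁅θ, y⁆ = (g (dt (g⁻¹ y)) - dt (g⁻¹ y)) - dt (g (g⁻¹ y) - g⁻¹ y) := by
    rw [h1, e, map_sub]
    abel
  rw [h2]
  exact sub_mem (h k _ (dt_mem_filt hD hz)) (dt_mem_filt hD (h k _ hz))

end GaugeFiltration

/-! ### Normal form of an oper with regular singularity -/

section OperNormalForm

variable {ι 𝔤 : Type*} [Fintype ι] [LieRing 𝔤] [LieAlgebra ℂ 𝔤] [FiniteDimensional ℂ 𝔤]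
  {𝔥 : LieSubalgebra ℂ 𝔤}

theorem borel_eq_filt {b : LieAlgebra.Basis ι 𝔥} {D : 𝔤} (hD : IsCoweight b 1 D) :
    borel b = filt (K := ℂ) D 0 :=
  hD.cartan_sup_posPart

theorem baseChange_borel_eq_filt (K : Type*) [Field K] [Algebra ℂ K] {b : LieAlgebra.Basis ι 𝔥}
    {D : 𝔤} (hD : IsCoweight b 1 D) :
    (borel b).baseChange K = filt (K := K) ((1 : K) ⊗ₜ[ℂ] D) 0 := by
  rw [filt_extend K hD.isGrading, borel_eq_filt hD]

/-- The sum of the root spaces of the roots containing `αⱼ` with a non-negative coefficient contains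
the Borel subalgebra. -/
theorem IsCoweight.borel_le_filt {b : LieAlgebra.Basis ι 𝔥} {m : ι → ℤ} {D : 𝔤}
    (hD : IsCoweight b m D) (hm : ∀ i, 0 ≤ m i) : borel b ≤ filt (K := ℂ) D 0 :=
  sup_le (fun _ hx => wt_le_filt le_rfl (hD.cartan_le hx)) (hD.posPart_le_filt le_rfl hm)

/-- The linear form extracting the coefficient of `fᵢ`. -/
theorem exists_dual_f (b : LieAlgebra.Basis ι 𝔥) (i : ι) : ∃ φ : Module.Dual ℂ 𝔤,
    φ (b.f i) = 1 ∧ (∀ j, j ≠ i → φ (b.f j) = 0) ∧ ∀ x ∈ borel b, φ x = 0 := by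
  classical
  obtain ⟨D, hD⟩ := exists_isCoweight b (Pi.single i 1)
  have hm (j : ι) : 0 ≤ (Pi.single i 1 : ι → ℤ) j := by
    obtain rfl | h := eq_or_ne j i
    · simp
    · simp [h]
  have hi : b.f i ∉ filt (K := ℂ) D 0 := fun h => by
    refine (b.sl2 i).f_ne_zero (eq_zero_of_mem_wt_of_mem_filt (j := -1) (by omega) ?_ h)
    simpa using hD.f_mem i
  obtain ⟨φ, hφ, hφ'⟩ := Submodule.exists_dual_map_eq_bot_of_notMem hi inferInstance
  have h0 (x : 𝔤) (hx : x ∈ filt (K := ℂ) D 0) : φ x = 0 := by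
    have : φ x ∈ (filt (K := ℂ) D 0).map φ := ⟨x, hx, rfl⟩
    rwa [hφ', Submodule.mem_bot] at this
  refine ⟨(φ (b.f i))⁻¹ • φ, inv_mul_cancel₀ hφ, fun j hj => ?_, fun x hx => ?_⟩
  · rw [LinearMap.smul_apply, h0 (b.f j), smul_zero]
    refine wt_le_filt le_rfl ?_
    simpa [hj] using hD.f_mem j
  · rw [LinearMap.smul_apply, h0 x (hD.borel_le_filt hm hx), smul_zero]

/-- An element of `𝔟((t))` that lies in `𝔤[[t]]` lies in `𝔟[[t]]`. -/
theorem exists_ofIntegral_eq {p : Submodule ℂ 𝔤} {X : Laurent ⊗[ℂ] 𝔤}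
    (hX : X ∈ p.baseChange Laurent) (hX' : X ∈ integralLattice 𝔤) :
    ∃ v ∈ p.baseChange (PowerSeries ℂ), ofIntegral v = X := by
  obtain ⟨q, hq⟩ := p.exists_isCompl
  let π : 𝔤 →ₗ[ℂ] 𝔤 := p.projection q hq
  have hπ (x : 𝔤) (hx : x ∈ p) : π x = x := Submodule.projection_apply_left hq ⟨x, hx⟩
  obtain ⟨Y, rfl⟩ := hX'
  have hY (Y : PowerSeries ℂ ⊗[ℂ] 𝔤) : π.lTensor _ Y ∈ p.baseChange (PowerSeries ℂ) := by
    induction Y using TensorProduct.induction_on with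
    | zero => rw [map_zero]; exact zero_mem _
    | tmul f x => exact Submodule.tmul_mem_baseChange_of_mem _ (Subtype.prop _)
    | add x y hx hy => rw [map_add]; exact add_mem hx hy
  have h1 : ofIntegral (π.lTensor _ Y) = π.lTensor _ (ofIntegral Y) := by
    rw [ofIntegral, ← LinearMap.comp_apply, ← LinearMap.comp_apply, LinearMap.rTensor_comp_lTensor,
      LinearMap.lTensor_comp_rTensor]
  have h2 {Z : Laurent ⊗[ℂ] 𝔤} (hZ : Z ∈ p.baseChange Laurent) : π.lTensor _ Z = Z := by
    induction hZ using baseChange_induction with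
    | zero => simp
    | add x y _ _ hx hy => rw [map_add, hx, hy]
    | tmul a x hx => rw [LinearMap.lTensor_tmul, hπ x hx]
  exact ⟨_, hY Y, h1.trans (h2 hX)⟩

/-- The `K`-linear form extracting the coefficient of `fᵢ`. -/
theorem exists_coeff_f (K : Type*) [Field K] [Algebra ℂ K] (b : LieAlgebra.Basis ι 𝔥) (i : ι) :
    ∃ (φ : Module.Dual ℂ 𝔤) (Φ : K ⊗[ℂ] 𝔤 →ₗ[ℂ] K), (∀ a x, Φ (a ⊗ₜ x) = φ x • a) ∧
      ∀ ψ : ι → K, ∀ v ∈ (borel b).baseChange K, Φ (∑ j, ψ j ⊗ₜ[ℂ] b.f j + v) = ψ i := by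
  classical
  obtain ⟨φ, hφ1, hφ2, hφ3⟩ := exists_dual_f b i
  let Φ : K ⊗[ℂ] 𝔤 →ₗ[ℂ] K := (TensorProduct.rid ℂ K).toLinearMap ∘ₗ φ.lTensor K
  have hΦ (a : K) (x : 𝔤) : Φ (a ⊗ₜ x) = φ x • a := by simp [Φ]
  refine ⟨φ, Φ, hΦ, fun ψ v hv => ?_⟩
  have hΦv : Φ v = 0 := by
    induction hv using baseChange_induction with
    | zero => simp
    | add x y _ _ hx hy => rw [map_add, hx, hy, add_zero]
    | tmul a x hx => rw [hΦ, hφ3 x hx, zero_smul]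
  rw [map_add, hΦv, add_zero, map_sum, Finset.sum_eq_single i
    (fun j _ hj => by rw [hΦ, hφ2 j hj, zero_smul]) (by simp), hΦ, hφ1, one_smul]

/-- In the oper form of an element of the lattice, all terms lie in the lattice. -/
theorem integral_of_operForm {b : LieAlgebra.Basis ι 𝔥} {ψ : ι → Laurent} {v : Laurent ⊗[ℂ] 𝔤}
    (hv : v ∈ (borel b).baseChange Laurent)
    (h : ∑ i, ψ i ⊗ₜ[ℂ] b.f i + v ∈ integralLattice 𝔤) :
    (∀ i, ψ i ∈ Laurent.integers) ∧ v ∈ integralLattice 𝔤 := by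
  have h1 (i : ι) : ψ i ∈ Laurent.integers := by
    obtain ⟨φ, Φ, hΦ, hΦf⟩ := exists_coeff_f Laurent b i
    have hΦi {X : Laurent ⊗[ℂ] 𝔤} (hX : X ∈ integralLattice 𝔤) : Φ X ∈ Laurent.integers := by
      obtain ⟨X, rfl⟩ := hX
      induction X using TensorProduct.induction_on with
      | zero => simp [zero_mem]
      | tmul f x =>
        rw [ofIntegral_tmul, hΦ, ← map_smul]
        exact Laurent.ofPowerSeries_mem_integers _
      | add x y hx hy => rw [map_add, map_add]; exact add_mem hx hy
    rw [← hΦf ψ v hv]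
    exact hΦi h
  refine ⟨h1, ?_⟩
  have h2 := sub_mem h (sum_mem fun i (_ : i ∈ Finset.univ) => tmul_mem_integralLattice (h1 i) (b.f i))
  rwa [add_sub_cancel_left] at h2

variable {b : LieAlgebra.Basis ι 𝔥} {g : (Laurent ⊗[ℂ] 𝔤) ≃ₗ[Laurent] (Laurent ⊗[ℂ] 𝔤)}
  {A A' : Laurent ⊗[ℂ] 𝔤}

theorem Laurent.deriv_zpow {c : Laurent} (hc : c ≠ 0) (k : ℤ) :
    (c ^ k).deriv = k * (c⁻¹ * c.deriv) * c ^ k := by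
  induction k using Int.induction_on with
  | zero => simp [Laurent.deriv_one]
  | succ k ih =>
    rw [zpow_add_one₀ hc, Laurent.deriv_mul, ih]
    push_cast
    field_simp
  | pred k ih =>
    rw [zpow_sub_one₀ hc, Laurent.deriv_mul, ih, Laurent.deriv_inv hc]
    push_cast
    field_simp
    ring

/-- Logarithmic derivatives have at most a simple pole. -/
theorem Laurent.t_mul_inv_mul_deriv_mem_integers {c : Laurent} (hc : c ≠ 0) :
    Laurent.t * (c⁻¹ * c.deriv) ∈ Laurent.integers := by
  obtain ⟨n, f, hf, rfl⟩ := Laurent.exists_eq_zpow_mul hc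
  have ht := Laurent.t_ne_zero
  have hf0 := right_ne_zero_of_mul hc
  have e : Laurent.t * ((Laurent.t ^ n * Laurent.ofPowerSeries f)⁻¹ *
      (Laurent.t ^ n * Laurent.ofPowerSeries f).deriv) =
      n + Laurent.t * ((Laurent.ofPowerSeries f)⁻¹ * (Laurent.ofPowerSeries f).deriv) := by
    rw [Laurent.deriv_mul, Laurent.deriv_zpow ht, Laurent.deriv_t]
    have := zpow_ne_zero n ht
    field_simp
  rw [e, Laurent.inv_ofPowerSeries hf, Laurent.deriv_ofPowerSeries]
  exact add_mem (intCast_mem _ n) (mul_mem Laurent.t_mem_integers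
    (mul_mem (Laurent.ofPowerSeries_mem_integers _) (Laurent.ofPowerSeries_mem_integers _)))

variable [LieAlgebra.IsKilling ℂ 𝔤]

theorem exists_gauge_borel (hg : g ∈ borelGroup (extendBasis Laurent b)) :
    ∃ θ ∈ (borel b).baseChange Laurent, IsGauge g 0 θ := by
  obtain ⟨D, hD⟩ := exists_isCoweight b 1
  obtain ⟨θ, hθ⟩ := exists_isGauge_zero (borelGroup_le_lieAut hg)
  have h1 := (hD.extend Laurent).map_of_mem_borelGroup hg
  have h2 := (hD.extend Laurent).map_of_mem_borelGroup (inv_mem hg)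
  refine ⟨θ, ?_, hθ⟩
  rw [baseChange_borel_eq_filt _ hD]
  exact hθ.mem_filt hD.isGrading (fun k z hz => by rw [add_zero]; exact sub_mem (h1.1 k z hz) hz) h2.1

/-- The shape of opers is preserved by the Borel subgroup. -/
theorem exists_map_eq_of_mem_borelGroup {u s : (Laurent ⊗[ℂ] 𝔤) ≃ₗ[Laurent] (Laurent ⊗[ℂ] 𝔤)}
    (hu : u ∈ unipotentGroup (extendBasis Laurent b)) (hs : s ∈ torusGroup (extendBasis Laurent b))
    {c : ι → Laurent} (hsc : ∀ i, s ((1 : Laurent) ⊗ₜ[ℂ] b.f i) = c i • 1 ⊗ₜ[ℂ] b.f i)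
    (ψ : ι → Laurent) {v : Laurent ⊗[ℂ] 𝔤} (hv : v ∈ (borel b).baseChange Laurent) :
    ∃ v' ∈ (borel b).baseChange Laurent,
      (u * s) (∑ i, ψ i ⊗ₜ[ℂ] b.f i + v) = ∑ i, (c i * ψ i) ⊗ₜ[ℂ] b.f i + v' := by
  obtain ⟨D, hD⟩ := exists_isCoweight b 1
  have hD' := hD.extend Laurent
  have h1 := hD'.map_of_mem_borelGroup
    (mul_mem (Subgroup.mem_sup_right hu) (Subgroup.mem_sup_left hs) :
      u * s ∈ borelGroup (extendBasis Laurent b))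
  rw [baseChange_borel_eq_filt _ hD] at hv ⊢
  refine ⟨(u * s) (∑ i, ψ i ⊗ₜ[ℂ] b.f i + v) - ∑ i, (c i * ψ i) ⊗ₜ[ℂ] b.f i, ?_,
    (add_sub_cancel _ _).symm⟩
  rw [map_add, add_sub_right_comm, map_sum, ← Finset.sum_sub_distrib]
  refine add_mem (sum_mem fun i _ => ?_) (h1.1 0 v hv)
  have e : s (ψ i ⊗ₜ[ℂ] b.f i) = (c i * ψ i) ⊗ₜ[ℂ] b.f i := by
    have e' (a : Laurent) : a ⊗ₜ[ℂ] b.f i = a • (1 : Laurent) ⊗ₜ[ℂ] b.f i := by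
      rw [TensorProduct.smul_tmul', smul_eq_mul, mul_one]
    rw [e', map_smul, hsc, smul_smul, mul_comm, ← e']
  rw [LinearEquiv.mul_apply, e]
  have h2 := hD'.sub_mem_filt_of_mem_unipotentGroup hu
    (wt_le_filt le_rfl (mem_wt_extend (hD.f_mem i) (c i * ψ i)))
  rwa [Pi.one_apply, neg_add_cancel] at h2

theorem exists_torus_smul_one_tmul_f {s : (Laurent ⊗[ℂ] 𝔤) ≃ₗ[Laurent] (Laurent ⊗[ℂ] 𝔤)}
    (hs : s ∈ torusGroup (extendBasis Laurent b)) (i : ι) :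
    ∃ c : Laurent, c ≠ 0 ∧ s ((1 : Laurent) ⊗ₜ[ℂ] b.f i) = c • 1 ⊗ₜ[ℂ] b.f i :=
  exists_torus_smul_f hs i

theorem IsOperForm.of_isGauge (hA : IsOperForm b A) (hg : g ∈ borelGroup (extendBasis Laurent b))
    (h : IsGauge g A A') : IsOperForm b A' := by
  obtain ⟨ψ, hψ, v, hv, rfl⟩ := hA
  obtain ⟨θ, hθ, hgθ⟩ := exists_gauge_borel hg
  obtain ⟨u, hu, s, hs, rfl⟩ := exists_eq_unipotent_mul_torus hg
  choose c hc hsc using fun i => exists_torus_smul_one_tmul_f hs i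
  obtain ⟨v', hv', e⟩ := exists_map_eq_of_mem_borelGroup hu hs hsc ψ hv
  refine ⟨_, fun i => mul_ne_zero (hc i) (hψ i), v' + θ, add_mem hv' hθ, ?_⟩
  rw [h.unique (hgθ.of_zero (borelGroup_le_lieAut hg) _), e, add_assoc]

/-- The one parameter subgroup `c ↦ c ^ D` of the torus. -/
theorem IsCoweight.exists_scaling_gauge {m : ι → ℤ} {D : 𝔤} (hD : IsCoweight b m D) {c : Laurent}
    (hc : c ≠ 0) : ∃ s ∈ torusGroup (extendBasis Laurent b),
      (∀ k, ∀ x ∈ wt (K := Laurent) ((1 : Laurent) ⊗ₜ[ℂ] D) k, s x = c ^ k • x) ∧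
      IsGauge s 0 (-((c⁻¹ * c.deriv) ⊗ₜ D)) := by
  obtain ⟨s, hs, hsc⟩ := (hD.extend Laurent).isGrading.exists_scaling hc
  refine ⟨s, ⟨hs, fun x hx => ?_⟩, hsc, isGauge_zero_iff.2 fun x => ?_⟩
  · rw [hsc 0 x ((hD.extend Laurent).cartan_le hx), zpow_zero, one_smul]
  · induction x using TensorProduct.induction_on with
    | zero => simp
    | add x y hx hy => simp only [map_add, hx, hy, lie_add]; abel
    | tmul a y =>
      have hy : y ∈ ⨆ k, wt (K := ℂ) D k := by
        rw [show ⨆ k, wt (K := ℂ) D k = ⊤ from hD.isGrading]; trivial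
      induction hy using Submodule.iSup_induction' with
      | zero => simp
      | add y z _ _ hy hz => simp only [TensorProduct.tmul_add, map_add, hy, hz, lie_add]; abel
      | mem k y hy =>
        rw [hsc k _ (mem_wt_extend hy a), dt_tmul, hsc k _ (mem_wt_extend hy _), dt_smul, dt_tmul,
          Laurent.deriv_zpow hc, lie_smul, neg_lie, LieAlgebra.ExtendScalars.bracket_tmul,
          mem_wt.1 hy, TensorProduct.tmul_smul, algebra_compatible_smul Laurent (k : ℂ)]
        simp only [TensorProduct.smul_tmul', smul_eq_mul, ← TensorProduct.add_tmul,
          ← TensorProduct.neg_tmul, map_intCast]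
        congr 1
        ring

/-- A connection in oper form with at most a simple pole can be brought to the form
`t⁻¹ (p₋₁ + v)` with `v ∈ 𝔟[[t]]`. -/
theorem exists_normalForm (hA : IsOperForm b A) (hA' : HasSimplePole A) :
    ∃ g ∈ borelGroup (extendBasis Laurent b), ∃ v ∈ (borel b).baseChange (PowerSeries ℂ),
      IsGauge g A (Laurent.t⁻¹ • ((1 : Laurent) ⊗ₜ[ℂ] pMinusOne b + ofIntegral v)) := by
  classical
  have ht := Laurent.t_ne_zero
  -- The `ψᵢ` are turned into `t⁻¹` one at a time by `(t ψᵢ) ^ D`, for the fundamental coweight `D`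
  -- of `αᵢ`. As `t ψᵢ` is integral and `ad D` has no negative eigenvalue on `𝔟`, the pole remains
  -- simple.
  have key (S : Finset ι) : ∃ g ∈ borelGroup (extendBasis Laurent b), ∃ ψ : ι → Laurent,
      (∀ i, ψ i ≠ 0) ∧ (∀ i ∈ S, ψ i = Laurent.t⁻¹) ∧ ∃ v ∈ (borel b).baseChange Laurent,
      HasSimplePole (∑ i, ψ i ⊗ₜ[ℂ] b.f i + v) ∧ IsGauge g A (∑ i, ψ i ⊗ₜ[ℂ] b.f i + v) := by
    induction S using Finset.induction_on with
    | empty =>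
      obtain ⟨ψ, hψ, v, hv, rfl⟩ := hA
      exact ⟨1, one_mem _, ψ, hψ, by simp, v, hv, hA', isGauge_one _⟩
    | insert i S hi ih =>
      obtain ⟨g, hg, ψ, hψ, hψS, v, hv, hpole, hgauge⟩ := ih
      have htv := Submodule.smul_mem _ Laurent.t hv
      have h1 := hasSimplePole_iff.1 hpole
      simp only [smul_add, Finset.smul_sum, TensorProduct.smul_tmul', smul_eq_mul] at h1
      obtain ⟨hψt, hvt⟩ := integral_of_operForm htv h1
      obtain ⟨D, hD⟩ := exists_isCoweight b (Pi.single i 1)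
      obtain ⟨ρ, hρ⟩ := exists_isCoweight b 1
      have hm (j : ι) : 0 ≤ (Pi.single i 1 : ι → ℤ) j := by
        obtain rfl | h := eq_or_ne j i
        · simp
        · simp [h]
      have hc := mul_ne_zero ht (hψ i)
      obtain ⟨s, hs, hsc, hsg⟩ := hD.exists_scaling_gauge hc
      let ψ' : ι → Laurent := Function.update ψ i Laurent.t⁻¹
      have hf (j : ι) : s (ψ j ⊗ₜ[ℂ] b.f j) = ψ' j ⊗ₜ b.f j := by
        rw [hsc _ _ (mem_wt_extend (hD.f_mem j) _), TensorProduct.smul_tmul', smul_eq_mul]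
        obtain rfl | hj := eq_or_ne j i
        · have := hψ j
          simp only [ψ', Pi.single_eq_same, Function.update_self, zpow_neg, zpow_one]
          field_simp
        · simp [ψ', hj]
      have hsv : s v ∈ (borel b).baseChange Laurent := by
        rw [baseChange_borel_eq_filt _ hρ] at hv ⊢
        exact (hρ.extend Laurent).map_mem_filt_of_mem_torusGroup hs hv
      have hsv' : s (Laurent.t • v) ∈ integralLattice 𝔤 := by
        obtain ⟨w, hw, e⟩ := exists_ofIntegral_eq htv hvt
        rw [← e]
        clear e
        induction hw using baseChange_induction with
        | zero => simp
        | add x y _ _ hx hy => rw [map_add, map_add]; exact add_mem hx hy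
        | tmul a y hy =>
          have hy' := hD.borel_le_filt hm hy
          clear hy
          rw [ofIntegral_tmul]
          induction hy' using filt_induction with
          | zero => simp
          | add x y _ _ hx hy => rw [TensorProduct.tmul_add, map_add]; exact add_mem hx hy
          | wt k hk y hy' =>
            lift k to ℕ using hk
            rw [hsc k _ (mem_wt_extend hy' _), zpow_natCast, ← ofIntegral_tmul]
            exact smul_mem_integralLattice (pow_mem (hψt i) k) (ofIntegral_mem _)
      have hθ : -(((Laurent.t * ψ i)⁻¹ * (Laurent.t * ψ i).deriv) ⊗ₜ[ℂ] D) ∈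
          (borel b).baseChange Laurent :=
        neg_mem (Submodule.tmul_mem_baseChange_of_mem _ (Submodule.mem_sup_left hD.mem))
      have e := hsg.of_zero hs.1 (∑ i, ψ i ⊗ₜ[ℂ] b.f i + v)
      rw [map_add, map_sum, add_assoc] at e
      simp only [hf] at e
      refine ⟨s * g, mul_mem (Subgroup.mem_sup_left hs) hg, ψ', fun j => ?_, fun j hj => ?_, _,
        add_mem hsv hθ, hasSimplePole_iff.2 ?_, e.mul hgauge⟩
      · obtain rfl | hj := eq_or_ne j i
        · simpa [ψ'] using ht
        · simpa [ψ', hj] using hψ j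
      · obtain rfl | hj' := eq_or_ne j i
        · simp [ψ']
        · simpa [ψ', hj'] using hψS j (Finset.mem_of_mem_insert_of_ne hj hj')
      · rw [smul_add, smul_add, ← map_smul, Finset.smul_sum]
        refine add_mem (sum_mem fun j _ => ?_) (add_mem hsv' ?_)
        · rw [TensorProduct.smul_tmul', smul_eq_mul]
          refine tmul_mem_integralLattice ?_ _
          obtain rfl | hj := eq_or_ne j i
          · simp [ψ', ht, one_mem]
          · simpa [ψ', hj] using hψt j
        · rw [smul_neg, TensorProduct.smul_tmul', smul_eq_mul]
          exact neg_mem (tmul_mem_integralLattice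
            (Laurent.t_mul_inv_mul_deriv_mem_integers hc) D)
  obtain ⟨g, hg, ψ, hψ, hψt, v, hv, hpole, hgauge⟩ := key Finset.univ
  have htv := Submodule.smul_mem _ Laurent.t hv
  have h1 := hasSimplePole_iff.1 hpole
  simp only [smul_add, Finset.smul_sum, TensorProduct.smul_tmul', smul_eq_mul] at h1
  obtain ⟨-, hvt⟩ := integral_of_operForm htv h1
  obtain ⟨w, hw, e⟩ := exists_ofIntegral_eq htv hvt
  refine ⟨g, hg, w, hw, ?_⟩
  convert hgauge using 1
  rw [e, smul_add, inv_smul_smul₀ ht, pMinusOne, TensorProduct.tmul_sum, Finset.smul_sum]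
  congr 1
  refine Finset.sum_congr rfl fun i hi => ?_
  rw [TensorProduct.smul_tmul', smul_eq_mul, mul_one, hψt i hi]

/-- If an oper is gauge equivalent to a connection with at most a simple pole, then it has a
representative of the form `t⁻¹ (p₋₁ + v)` with `v ∈ 𝔟[[t]]`. -/
theorem exists_normalForm_of_isGauge (hA : IsOperForm b A) (hA' : HasSimplePole A')
    (hg : g ∈ adjointGroup (extendBasis Laurent b)) (h : IsGauge g A A') :
    ∃ g ∈ borelGroup (extendBasis Laurent b), ∃ v ∈ (borel b).baseChange (PowerSeries ℂ),
      IsGauge g A (Laurent.t⁻¹ • ((1 : Laurent) ⊗ₜ[ℂ] pMinusOne b + ofIntegral v)) := by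
  obtain ⟨p, hp, k, hk, e⟩ := exists_iwasawa (extendBasis Laurent b)
    Laurent.mem_integers_or_inv_mem_integers (inv_mem hg)
  obtain ⟨A1, hA1, h1⟩ := hA'.exists_isGauge b hk
  have h2 := h1.mul h
  have e2 : k * g = p⁻¹ := by rw [eq_inv_iff_mul_eq_one, ← inv_inv g, e]; group
  rw [e2] at h2
  obtain ⟨g', hg', v, hv, h3⟩ := exists_normalForm (hA.of_isGauge (inv_mem hp) h2) hA1
  exact ⟨_, mul_mem hg' (inv_mem hp), v, hv, h3.mul h2⟩

end OperNormalForm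

/-! ### Evaluation at zero -/

section Evaluation

variable {R 𝔤 : Type*} [CommRing R] [Algebra ℂ R] [LieRing 𝔤] [LieAlgebra ℂ 𝔤]

theorem lid_rTensor_lie_eq_sum {κ : Type*} {s : Finset κ} {ε : R →ₗ[ℂ] ℂ} {φ ψ : κ → R →ₗ[ℂ] ℂ}
    (hε : ∀ a c, ε (a * c) = ∑ p ∈ s, φ p a * ψ p c) (X Y : R ⊗[ℂ] 𝔤) :
    TensorProduct.lid ℂ 𝔤 (ε.rTensor 𝔤 ⁅X, Y⁆) = ∑ p ∈ s,
      ⁅TensorProduct.lid ℂ 𝔤 ((φ p).rTensor 𝔤 X), TensorProduct.lid ℂ 𝔤 ((ψ p).rTensor 𝔤 Y)⁆ := by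
  induction X using TensorProduct.induction_on with
  | zero => simp
  | add X X' hX hX' => simp only [add_lie, map_add, hX, hX', Finset.sum_add_distrib]
  | tmul a x =>
    induction Y using TensorProduct.induction_on with
    | zero => simp
    | add X X' hX hX' => simp only [lie_add, map_add, hX, hX', Finset.sum_add_distrib]
    | tmul c y =>
      simp [LieAlgebra.ExtendScalars.bracket_tmul, hε, smul_smul, mul_comm, Finset.sum_smul]

theorem lid_rTensor_lie {ε : R →ₗ[ℂ] ℂ} (hε : ∀ a c, ε (a * c) = ε a * ε c) (X Y : R ⊗[ℂ] 𝔤) :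
    TensorProduct.lid ℂ 𝔤 (ε.rTensor 𝔤 ⁅X, Y⁆) =
      ⁅TensorProduct.lid ℂ 𝔤 (ε.rTensor 𝔤 X), TensorProduct.lid ℂ 𝔤 (ε.rTensor 𝔤 Y)⁆ := by
  rw [lid_rTensor_lie_eq_sum (s := {()}) (φ := fun _ => ε) (ψ := fun _ => ε) (by simpa using hε),
    Finset.sum_singleton]

theorem evalZero_tmul (f : PowerSeries ℂ) (x : 𝔤) :
    evalZero (f ⊗ₜ x) = PowerSeries.coeff 0 f • x := by
  simp [evalZero]

theorem evalZero_one_tmul (x : 𝔤) : evalZero ((1 : PowerSeries ℂ) ⊗ₜ x) = x := by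
  simp [evalZero_tmul]

theorem evalZero_lie (X Y : PowerSeries ℂ ⊗[ℂ] 𝔤) :
    evalZero ⁅X, Y⁆ = ⁅evalZero X, evalZero Y⁆ :=
  lid_rTensor_lie (ε := PowerSeries.coeff (R := ℂ) 0) (fun a c => by simp) X Y

end Evaluation

/-! ### Invariance of the projection to the adjoint quotient -/

section Invariance

variable {ι 𝔤 : Type*} [Fintype ι] [LieRing 𝔤] [LieAlgebra ℂ 𝔤] [FiniteDimensional ℂ 𝔤]
  {𝔥 : LieSubalgebra ℂ 𝔤} (b : LieAlgebra.Basis ι 𝔥)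

theorem ad_one_tmul_pow {K : Type*} [Field K] [Algebra ℂ K] (x y : 𝔤) (n : ℕ) :
    (LieAlgebra.ad K (K ⊗[ℂ] 𝔤) (1 ⊗ₜ x) ^ n) (1 ⊗ₜ y) = 1 ⊗ₜ (LieAlgebra.ad ℂ 𝔤 x ^ n) y := by
  induction n with
  | zero => simp
  | succ n ih =>
    rw [pow_succ', Module.End.mul_apply, ih, LieAlgebra.ad_apply, one_tmul_lie, pow_succ',
      Module.End.mul_apply, LieAlgebra.ad_apply]

theorem invFun_exp {q : 𝔤 → ℂ} (hq : q ∈ invFun b) {y : 𝔤} (hy : y ∈ nilradical b) {m : ℕ}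
    (hm : LieAlgebra.ad ℂ 𝔤 y ^ m = 0) (X : 𝔤) :
    q (∑ n ∈ Finset.range m, (n.factorial : ℂ)⁻¹ • (LieAlgebra.ad ℂ 𝔤 y ^ n) X) = q X := by
  have hm' : LieAlgebra.ad ℂ (ℂ ⊗[ℂ] 𝔤) (1 ⊗ₜ y) ^ m = 0 := by
    ext x
    simp [ad_one_tmul_pow, hm]
  have hn : IsNilpotent (LieAlgebra.ad ℂ (ℂ ⊗[ℂ] 𝔤) (1 ⊗ₜ y)) := ⟨m, hm'⟩
  refine hq.2 (adExp (1 ⊗ₜ y) hn) ?_ X _ ?_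
  · rw [adjointPoints_eq]
    refine Subgroup.mem_sup_left (Subgroup.mem_sup_right (adExp_mem_unipotentGroup ?_ _))
    rw [posPart_extendBasis]
    exact Submodule.tmul_mem_baseChange_of_mem _ hy
  · rw [adExp_apply _ hm', TensorProduct.tmul_sum]
    simp only [ad_one_tmul_pow, TensorProduct.tmul_smul]

end Invariance

/-! ### Residues of equivalent opers -/

section PrincipalSl2

variable {ι 𝔤 : Type*} [Fintype ι] [LieRing 𝔤] [LieAlgebra ℂ 𝔤] [FiniteDimensional ℂ 𝔤]
  {𝔥 : LieSubalgebra ℂ 𝔤} {b : LieAlgebra.Basis ι 𝔥} {D : 𝔤} {r : ℤ}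

theorem IsCoweight.pMinusOne_mem (hD : IsCoweight b 1 D) : pMinusOne b ∈ wt (K := ℂ) D (-1) :=
  sum_mem fun i _ => hD.f_mem i

/-- The element `p₋₁` is part of an `𝔰𝔩₂`-triple whose semisimple element defines the grading by
height, so that `ad p₋₁` is injective in positive degrees. -/
theorem IsCoweight.eq_zero_of_lie_pMinusOne (hD : IsCoweight b 1 D) (hr : 1 ≤ r) {y : 𝔤}
    (hy : y ∈ wt (K := ℂ) D r) (h : ⁅y, pMinusOne b⁆ = 0) : y = 0 := by
  classical
  by_contra hy0
  have hD0 : (2 : ℂ) • D ≠ 0 := by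
    intro h0
    have h1 := mem_wt.1 hy
    rw [(smul_eq_zero.1 h0).resolve_left two_ne_zero, zero_lie] at h1
    have h2 := (smul_eq_zero.1 h1.symm).resolve_right hy0
    have h3 : r = 0 := by exact_mod_cast h2
    omega
  have hmem : (2 : ℂ) • D ∈ Submodule.span ℂ (Set.range b.h) := by
    rw [← b.coe_cartan_eq_span]
    exact 𝔥.smul_mem _ hD.mem
  obtain ⟨c, hc⟩ := (Submodule.mem_span_range_iff_exists_fun ℂ).1 hmem
  have hDe (i : ι) : ⁅D, b.e i⁆ = b.e i := by simpa using mem_wt.1 (hD.e_mem i)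
  have hDf (i : ι) : ⁅D, b.f i⁆ = -b.f i := by simpa using mem_wt.1 (hD.f_mem i)
  have t : IsSl2Triple ((2 : ℂ) • D) (∑ i, c i • b.e i) (pMinusOne b) :=
    { h_ne_zero := hD0
      lie_e_f := by
        rw [← hc, pMinusOne, sum_lie]
        refine Finset.sum_congr rfl fun i _ => ?_
        rw [smul_lie, lie_sum, Finset.sum_eq_single i (fun j _ hj => b.lie_e_f_ne i j hj.symm)
          (by simp), (b.sl2 i).lie_e_f]
      lie_h_e_nsmul := by
        simp only [smul_lie, lie_sum, lie_smul, hDe, ← Nat.cast_smul_eq_nsmul ℂ, Finset.smul_sum,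
          smul_comm (2 : ℂ), Nat.cast_ofNat]
      lie_h_f_nsmul := by
        simp only [smul_lie, pMinusOne, lie_sum, hDf, ← Nat.cast_smul_eq_nsmul ℂ, Finset.smul_sum,
          Nat.cast_ofNat, smul_neg, Finset.sum_neg_distrib] }
  have P : t.symm.HasPrimitiveVectorWith y (-(2 * r : ℂ)) :=
    { ne_zero := hy0
      lie_h := by rw [neg_lie, smul_lie, mem_wt.1 hy, smul_smul, neg_smul]
      lie_e := by rw [← lie_skew, h, neg_zero] }
  obtain ⟨n, hn⟩ := P.exists_nat
  have : -(2 * r) = (n : ℤ) := by exact_mod_cast hn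
  omega

/-- A left inverse of `ad p₋₁` in degree `r`. -/
theorem IsCoweight.exists_leftInverse (hD : IsCoweight b 1 D) (hr : 1 ≤ r) :
    ∃ ψ : 𝔤 →ₗ[ℂ] 𝔤, (∀ y ∈ wt (K := ℂ) D r, ψ ⁅y, pMinusOne b⁆ = y) ∧
      ∀ y ∈ filt (K := ℂ) D r, ψ y = 0 := by
  let T : wt (K := ℂ) D r →ₗ[ℂ] 𝔤 ⧸ filt (K := ℂ) D r :=
    (filt (K := ℂ) D r).mkQ ∘ₗ (-LieAlgebra.ad ℂ 𝔤 (pMinusOne b)) ∘ₗ (wt (K := ℂ) D r).subtype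
  have hT (y : wt (K := ℂ) D r) : T y = (filt (K := ℂ) D r).mkQ ⁅(y : 𝔤), pMinusOne b⁆ := by
    rw [← lie_skew]
    rfl
  have hker : LinearMap.ker T = ⊥ := by
    rw [LinearMap.ker_eq_bot']
    intro y hy
    rw [hT, Submodule.mkQ_apply, Submodule.Quotient.mk_eq_zero] at hy
    exact Subtype.ext (hD.eq_zero_of_lie_pMinusOne hr y.2
      (eq_zero_of_mem_wt_of_mem_filt (by omega) (lie_mem_wt y.2 hD.pMinusOne_mem) hy))
  obtain ⟨S, hS⟩ := T.exists_leftInverse_of_injective hker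
  refine ⟨(wt (K := ℂ) D r).subtype ∘ₗ S ∘ₗ (filt (K := ℂ) D r).mkQ, fun y hy => ?_, fun y hy => ?_⟩
  · have h1 := hT ⟨y, hy⟩
    simp only [LinearMap.comp_apply]
    rw [← h1, ← LinearMap.comp_apply S T, hS]
    rfl
  · simp only [LinearMap.comp_apply, Submodule.mkQ_apply]
    rw [(Submodule.Quotient.mk_eq_zero _).2 hy, map_zero, map_zero]

end PrincipalSl2

theorem eq_one_of_mem_torusGroup {ι K L : Type*} [Fintype ι] [Field K] [CharZero K] [LieRing L]
    [LieAlgebra K L] [FiniteDimensional K L] {H : LieSubalgebra K L} {b : LieAlgebra.Basis ι H}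
    {s : L ≃ₗ[K] L} (hs : s ∈ torusGroup b) (hf : ∀ i, s (b.f i) = b.f i) : s = 1 := by
  have he (i : ι) : s (b.e i) = b.e i := by
    obtain ⟨d, -, hd⟩ := exists_torus_smul_f (b := b.symm) (g := s) hs i
    change s (b.e i) = d • b.e i at hd
    have h1 : s (b.h i) = d • b.h i := by
      rw [← (b.sl2 i).lie_e_f, lieAut.map_lie hs.1, hd, hf, smul_lie]
    rw [hs.2 _ (h_mem_cartan b i)] at h1
    have h2 : (d - 1) • b.h i = 0 := by rw [sub_smul, ← h1, one_smul, sub_self]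
    rw [hd, sub_eq_zero.1 ((smul_eq_zero.1 h2).resolve_right (b.sl2 i).h_ne_zero), one_smul]
  ext x
  exact mem_of_generators (b := b) (S := LinearMap.eqLocus s.toLinearMap LinearMap.id) he hf
    (fun x hx y hy => by
      have hx' : s x = x := hx
      have hy' : s y = y := hy
      change s ⁅x, y⁆ = ⁅x, y⁆
      rw [lieAut.map_lie hs.1, hx', hy']) x

section Disjointness

variable {ι 𝔤 : Type*} [Fintype ι] [LieRing 𝔤] [LieAlgebra ℂ 𝔤] [FiniteDimensional ℂ 𝔤]
  [LieAlgebra.IsKilling ℂ 𝔤] {𝔥 : LieSubalgebra ℂ 𝔤} {b : LieAlgebra.Basis ι 𝔥} {D : 𝔤} {r : ℤ}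
  {W W' : PowerSeries ℂ ⊗[ℂ] 𝔤} {g u : (Laurent ⊗[ℂ] 𝔤) ≃ₗ[Laurent] (Laurent ⊗[ℂ] 𝔤)}

variable (b) in
/-- `∂_t + t⁻¹ W` is an oper with regular singularity in normal form. -/
def IsRSForm (W : PowerSeries ℂ ⊗[ℂ] 𝔤) : Prop :=
  ∃ v ∈ (borel b).baseChange (PowerSeries ℂ), W = 1 ⊗ₜ pMinusOne b + v

theorem isRSForm_iff : IsRSForm b W ↔
    ofIntegral W - 1 ⊗ₜ[ℂ] pMinusOne b ∈ (borel b).baseChange Laurent := by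
  constructor
  · rintro ⟨v, hv, rfl⟩
    rw [map_add, ofIntegral_one_tmul, add_sub_cancel_left]
    exact rTensor_mem_baseChange _ hv
  · intro h
    obtain ⟨v, hv, e⟩ := exists_ofIntegral_eq h
      (sub_mem (ofIntegral_mem W) (tmul_mem_integralLattice (one_mem _) _))
    refine ⟨v, hv, ofIntegral_injective ?_⟩
    rw [map_add, e, ofIntegral_one_tmul, add_sub_cancel]

/-- The connection `∂_t + t⁻¹ W`. -/
def conn (W : PowerSeries ℂ ⊗[ℂ] 𝔤) : Laurent ⊗[ℂ] 𝔤 := Laurent.t⁻¹ • ofIntegral W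

theorem conn_injective : Function.Injective (conn (𝔤 := 𝔤)) := fun _ _ h =>
  ofIntegral_injective (smul_right_injective _ (inv_ne_zero Laurent.t_ne_zero) h)

/-- A gauge transformation by `exp (α y)` with `α ∈ ℂ[[t]]` and `y ∈ 𝔫` does not change the residue
of an oper in normal form. -/
theorem exists_gauge_exp (hD : IsCoweight b 1 D) (α : PowerSeries ℂ) {y : 𝔤}
    (hy : y ∈ nilradical b) (hX : IsNilpotent (LieAlgebra.ad Laurent (Laurent ⊗[ℂ] 𝔤)
      (Laurent.ofPowerSeries α ⊗ₜ y))) (hW : IsRSForm b W) :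
    ∃ W', IsRSForm b W' ∧ IsGauge (adExp (Laurent.ofPowerSeries α ⊗ₜ y) hX) (conn W) (conn W') ∧
      varpi b (evalZero W') = varpi b (evalZero W) := by
  obtain ⟨m1, hm1⟩ := id hX
  obtain ⟨m2, hm2⟩ := isNilpotent_ad_of_mem_posPart b
    (show PowerSeries.coeff 0 α • y ∈ posPart b from Submodule.smul_mem _ _ hy)
  let m := m1 + m2
  have hm : LieAlgebra.ad Laurent (Laurent ⊗[ℂ] 𝔤) (Laurent.ofPowerSeries α ⊗ₜ y) ^ m = 0 := by
    rw [pow_add, hm1, zero_mul]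
  have hm' : LieAlgebra.ad ℂ 𝔤 (PowerSeries.coeff 0 α • y) ^ m = 0 := by
    rw [pow_add, hm2, mul_zero]
  let P (n : ℕ) : PowerSeries ℂ ⊗[ℂ] 𝔤 := (fun Z => ⁅α ⊗ₜ[ℂ] y, Z⁆)^[n] W
  have hP (n : ℕ) : P (n + 1) = ⁅α ⊗ₜ[ℂ] y, P n⁆ := Function.iterate_succ_apply' _ _ _
  let W' : PowerSeries ℂ ⊗[ℂ] 𝔤 := ∑ n ∈ Finset.range m, (n.factorial : ℂ)⁻¹ • P n -
    (PowerSeries.X * PowerSeries.derivative ℂ α) ⊗ₜ y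
  have hPK (n : ℕ) : ofIntegral (P n) = (LieAlgebra.ad Laurent (Laurent ⊗[ℂ] 𝔤)
      (Laurent.ofPowerSeries α ⊗ₜ y) ^ n) (ofIntegral W) := by
    induction n with
    | zero => rfl
    | succ n ih =>
      rw [hP, ofIntegral_lie, ih, pow_succ', Module.End.mul_apply, LieAlgebra.ad_apply,
        ofIntegral_tmul]
  have hP0 (n : ℕ) : evalZero (P n) = (LieAlgebra.ad ℂ 𝔤
      (PowerSeries.coeff 0 α • y) ^ n) (evalZero W) := by
    induction n with
    | zero => rfl
    | succ n ih =>
      rw [hP, evalZero_lie, ih, pow_succ', Module.End.mul_apply, LieAlgebra.ad_apply, evalZero_tmul]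
  have hW'K : ofIntegral W' = adExp (Laurent.ofPowerSeries α ⊗ₜ y) hX (ofIntegral W) -
      (Laurent.t * (Laurent.ofPowerSeries α).deriv) ⊗ₜ y := by
    have e (n : ℕ) : (n.factorial : Laurent)⁻¹ = algebraMap ℂ Laurent (n.factorial : ℂ)⁻¹ := by
      rw [map_inv₀, map_natCast]
    rw [adExp_apply hX hm, map_sub, map_sum, ofIntegral_tmul, Laurent.ofPowerSeries_mul,
      Laurent.ofPowerSeries_X, ← Laurent.deriv_ofPowerSeries]
    simp only [map_smul, hPK, e, algebraMap_smul]
  have hW'0 : varpi b (evalZero W') = varpi b (evalZero W) := by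
    have e : evalZero W' = ∑ n ∈ Finset.range m, (n.factorial : ℂ)⁻¹ • (LieAlgebra.ad ℂ 𝔤
      (PowerSeries.coeff 0 α • y) ^ n) (evalZero W) := by
      rw [map_sub, evalZero_tmul, map_sum]
      simp [hP0]
    rw [e]
    exact AlgHom.ext fun q => invFun_exp b q.2 (Submodule.smul_mem _ _ hy) hm' _
  refine ⟨W', isRSForm_iff.2 ?_, ?_, hW'0⟩
  · rw [isRSForm_iff, baseChange_borel_eq_filt _ hD] at hW
    rw [baseChange_borel_eq_filt _ hD, hW'K]
    have hD' := hD.extend Laurent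
    have hyK : Laurent.ofPowerSeries α ⊗ₜ[ℂ] y ∈ posPart (extendBasis Laurent b) := by
      rw [posPart_extendBasis]
      exact Submodule.tmul_mem_baseChange_of_mem _ hy
    have hu := adExp_mem_unipotentGroup hyK hX
    have h1 := hD'.map_mem_filt_of_mem_unipotentGroup hu hW
    have h2 := hD'.sub_mem_filt_of_mem_unipotentGroup hu (wt_le_filt le_rfl
      (mem_wt_extend hD.pMinusOne_mem (1 : Laurent)))
    rw [neg_add_cancel] at h2
    have h3 : (Laurent.t * (Laurent.ofPowerSeries α).deriv) ⊗ₜ[ℂ] y ∈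
        filt (K := Laurent) ((1 : Laurent) ⊗ₜ[ℂ] D) 0 := by
      rw [← baseChange_borel_eq_filt _ hD]
      exact Submodule.tmul_mem_baseChange_of_mem _ (Submodule.mem_sup_right hy)
    have h4 := sub_mem (add_mem h1 h2) h3
    rw [map_sub, sub_add_sub_cancel] at h4
    rwa [sub_right_comm] at h4
  · have h := (isGauge_adExp_tmul hX).of_zero (adExp_mem_lieAut hX) (conn W)
    convert h using 1
    rw [conn, conn, hW'K, map_smul, smul_sub, sub_eq_add_neg, TensorProduct.smul_tmul', smul_eq_mul,
      inv_mul_cancel_left₀ Laurent.t_ne_zero]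

/-- Every element of `𝔤[[t]]` of positive degree is the leading term of a gauge transformation that
preserves the residues of opers in normal form. -/
theorem exists_gauge_of_leading_term (hD : IsCoweight b 1 D) (hr : 1 ≤ r) {ξ : PowerSeries ℂ ⊗[ℂ] 𝔤}
    (hξ : ξ ∈ (wt (K := ℂ) D r).baseChange (PowerSeries ℂ)) :
    ∃ e ∈ unipotentGroup (extendBasis Laurent b),
      e (1 ⊗ₜ D) - 1 ⊗ₜ D - ⁅ofIntegral ξ, (1 : Laurent) ⊗ₜ[ℂ] D⁆ ∈
        filt (K := Laurent) ((1 : Laurent) ⊗ₜ[ℂ] D) (r + 1) ∧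
      ∀ W, IsRSForm b W → ∃ W', IsRSForm b W' ∧ IsGauge e (conn W) (conn W') ∧
        varpi b (evalZero W') = varpi b (evalZero W) := by
  have hD' := hD.extend Laurent
  have hwt {ξ : PowerSeries ℂ ⊗[ℂ] 𝔤} (hξ : ξ ∈ (wt (K := ℂ) D r).baseChange (PowerSeries ℂ)) :
      ofIntegral ξ ∈ wt (K := Laurent) ((1 : Laurent) ⊗ₜ[ℂ] D) r := by
    rw [wt_extend _ hD.isGrading]
    exact rTensor_mem_baseChange _ hξ
  induction hξ using baseChange_induction with
  | zero =>
    refine ⟨1, one_mem _, ?_, fun W hW => ⟨W, hW, isGauge_one _, rfl⟩⟩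
    simp [zero_mem]
  | add ξ η hξ hη ihξ ihη =>
    obtain ⟨e, he, h1, h2⟩ := ihξ
    obtain ⟨e', he', h1', h2'⟩ := ihη
    refine ⟨e * e', mul_mem he he', ?_, fun W hW => ?_⟩
    · have h3 : e' (1 ⊗ₜ D) - 1 ⊗ₜ D ∈ filt (K := Laurent) ((1 : Laurent) ⊗ₜ[ℂ] D) r := by
        have := add_mem (filt_anti (by omega) h1') (lie_mem_filt' (k := r)
          (wt_le_filt le_rfl (hwt hη)) (self_mem_filt (K := Laurent)) (by omega))
        rwa [sub_add_cancel] at this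
      have h4 := hD'.sub_mem_filt_of_mem_unipotentGroup he h3
      have := add_mem (add_mem h4 h1) h1'
      convert this using 1
      rw [LinearEquiv.mul_apply, map_sub, map_add, add_lie]
      abel
    · obtain ⟨W1, hW1, hg1, hv1⟩ := h2' W hW
      obtain ⟨W2, hW2, hg2, hv2⟩ := h2 W1 hW1
      exact ⟨W2, hW2, hg2.mul hg1, hv2.trans hv1⟩
  | tmul α y hy =>
    have hy' : y ∈ nilradical b := by
      change y ∈ posPart b
      rw [hD.posPart_eq]
      exact wt_le_filt hr hy
    have hyK : Laurent.ofPowerSeries α ⊗ₜ[ℂ] y ∈ posPart (extendBasis Laurent b) := by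
      rw [posPart_extendBasis]
      exact Submodule.tmul_mem_baseChange_of_mem _ hy'
    have hX := isNilpotent_ad_of_mem_posPart (extendBasis Laurent b) hyK
    refine ⟨_, adExp_mem_unipotentGroup hyK hX, ?_, fun W hW => exists_gauge_exp hD α hy' hX hW⟩
    have hyr := wt_le_filt (k := r) le_rfl (mem_wt_extend (K := Laurent) hy (Laurent.ofPowerSeries α))
    exact adExp_sub_sub_mem hX (fun z hz => lie_mem_filt' hyr hz (by omega))
      (lie_mem_filt' hyr (lie_mem_filt hyr (self_mem_filt (K := Laurent))) (by omega))

/-- An element of the unipotent group that relates two opers in normal form has an integral leading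
term, as `ad p₋₁` is injective in positive degrees. -/
theorem exists_integral_leading_term (hD : IsCoweight b 1 D) (hr : 1 ≤ r)
    (hu : u ∈ unipotentGroup (extendBasis Laurent b))
    (hur : u (1 ⊗ₜ D) - 1 ⊗ₜ D ∈ filt (K := Laurent) ((1 : Laurent) ⊗ₜ[ℂ] D) r)
    (hW : IsRSForm b W) (h : IsGauge u (conn W) (conn W')) :
    ∃ ξ ∈ (wt (K := ℂ) D r).baseChange (PowerSeries ℂ),
      u (1 ⊗ₜ D) - 1 ⊗ₜ D - ⁅ofIntegral ξ, (1 : Laurent) ⊗ₜ[ℂ] D⁆ ∈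
        filt (K := Laurent) ((1 : Laurent) ⊗ₜ[ℂ] D) (r + 1) := by
  have hD' := hD.extend Laurent
  have hr0 : (r : Laurent) ≠ 0 := Int.cast_ne_zero.2 (by omega)
  have hulie := unipotentGroup_le_lieAut hu
  have hmap (k : ℤ) (z) (hz : z ∈ filt (K := Laurent) ((1 : Laurent) ⊗ₜ[ℂ] D) k) :
      u z - z ∈ filt (K := Laurent) ((1 : Laurent) ⊗ₜ[ℂ] D) (k + r) :=
    sub_mem_filt_of_map_sub_mem hulie
      (fun k y hy => hD'.sub_mem_filt_of_mem_unipotentGroup hu hy) hur hz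
  obtain ⟨z, hz, z', hz', e⟩ := exists_wt_add_filt hur
  let x : Laurent ⊗[ℂ] 𝔤 := -((r : Laurent)⁻¹ • z)
  have hx : x ∈ wt (K := Laurent) ((1 : Laurent) ⊗ₜ[ℂ] D) r :=
    neg_mem (Submodule.smul_mem _ _ hz)
  have hrx : (r : Laurent) • x = -z := by rw [smul_neg, smul_inv_smul₀ hr0]
  have hxD : ⁅x, (1 : Laurent) ⊗ₜ[ℂ] D⁆ = z := by
    rw [← lie_skew, mem_wt.1 hx, hrx, neg_neg]
  -- In degree `r`, the automorphism `u` is `ad x`.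
  have hux {k : ℤ} {y} (hy : y ∈ filt (K := Laurent) ((1 : Laurent) ⊗ₜ[ℂ] D) k) :
      u y - y - ⁅x, y⁆ ∈ filt (K := Laurent) ((1 : Laurent) ⊗ₜ[ℂ] D) (k + r + 1) := by
    induction hy using filt_induction with
    | zero => simp
    | add y y' _ _ hy hy' =>
      convert add_mem hy hy' using 1
      rw [map_add, lie_add]
      abel
    | wt j hj y hy =>
      have hyj := wt_le_filt (k := j) le_rfl hy
      refine filt_anti (k := k + r + 1) (l := j + r + 1) (by omega)
        (mem_filt_of_lie_sub_mem (j := j) (k := j + r) (by omega) (sub_mem (hmap j y hyj)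
          (lie_mem_filt' (wt_le_filt le_rfl hx) hyj (by omega))) ?_)
      have h1 : ⁅u (1 ⊗ₜ D), u y⁆ = (j : Laurent) • u y := by
        rw [← lieAut.map_lie hulie, mem_wt.1 hy, map_smul]
      have h2 : ⁅(1 : Laurent) ⊗ₜ[ℂ] D, ⁅x, y⁆⁆ = (r + j : Laurent) • ⁅x, y⁆ := by
        have := mem_wt.1 (lie_mem_wt hx hy)
        rwa [Int.cast_add] at this
      have h3 : (r : Laurent) • ⁅x, y⁆ = -⁅z, y⁆ := by rw [← smul_lie, hrx, neg_lie]
      have e1 : ⁅(1 : Laurent) ⊗ₜ[ℂ] D, u y - y - ⁅x, y⁆⁆ - (j : Laurent) • (u y - y - ⁅x, y⁆) =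
          -⁅z', u y⁆ - ⁅z, u y - y⁆ := by
        have e2 : (1 : Laurent) ⊗ₜ[ℂ] D = u (1 ⊗ₜ D) - (z + z') := by rw [← e, sub_sub_cancel]
        have e3 : ⁅(1 : Laurent) ⊗ₜ[ℂ] D, u y⁆ = (j : Laurent) • u y - ⁅z, u y⁆ - ⁅z', u y⁆ := by
          rw [e2, sub_lie, h1, add_lie]
          abel
        rw [lie_sub, lie_sub, h2, mem_wt.1 hy, e3, add_smul, h3, smul_sub, smul_sub, lie_sub]
        abel
      rw [e1]
      have huy : u y ∈ filt (K := Laurent) ((1 : Laurent) ⊗ₜ[ℂ] D) j :=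
        hD'.map_mem_filt_of_mem_unipotentGroup hu hyj
      exact sub_mem (neg_mem (lie_mem_filt' hz' huy (by omega)))
        (lie_mem_filt' (wt_le_filt le_rfl hz) (hmap j y hyj) (by omega))
  obtain ⟨θ, hθ⟩ := exists_isGauge_zero hulie
  have hθr : θ ∈ filt (K := Laurent) ((1 : Laurent) ⊗ₜ[ℂ] D) r :=
    hθ.mem_filt hD.isGrading hmap
      (fun k z hz => hD'.map_mem_filt_of_mem_unipotentGroup (inv_mem hu) hz)
  have e1 := h.unique (hθ.of_zero hulie _)
  have e2 : ofIntegral W' = u (ofIntegral W) + Laurent.t • θ := by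
    have := congrArg (Laurent.t • ·) e1
    simpa only [conn, smul_add, map_smul, smul_inv_smul₀ Laurent.t_ne_zero] using this
  rw [isRSForm_iff, baseChange_borel_eq_filt _ hD] at hW
  have hp := mem_wt_extend hD.pMinusOne_mem (1 : Laurent)
  have hWf : ofIntegral W ∈ filt (K := Laurent) ((1 : Laurent) ⊗ₜ[ℂ] D) (-1) := by
    have := add_mem (filt_anti (by omega) hW) (wt_le_filt (k := -1) le_rfl hp)
    rwa [sub_add_cancel] at this
  have h5 : ofIntegral (W' - W) - ⁅x, 1 ⊗ₜ pMinusOne b⁆ ∈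
      filt (K := Laurent) ((1 : Laurent) ⊗ₜ[ℂ] D) r := by
    have h6 := hux hWf
    rw [show -1 + r + 1 = r by ring] at h6
    have h7 := lie_mem_filt' (k := r) (wt_le_filt le_rfl hx) hW (by omega)
    have h8 := add_mem (add_mem h6 h7) (Submodule.smul_mem _ Laurent.t hθr)
    convert h8 using 1
    rw [map_sub, e2, lie_sub]
    abel
  obtain ⟨ψ, hψ, hψ'⟩ := hD.exists_leftInverse hr
  have hx1 : ψ.lTensor Laurent ⁅x, 1 ⊗ₜ pMinusOne b⁆ = x := by
    have hx' := hx
    rw [wt_extend _ hD.isGrading] at hx'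
    clear_value x
    clear hx hrx hxD hux h5
    induction hx' using baseChange_induction with
    | zero => simp
    | add x y _ _ hx hy => rw [add_lie, map_add, hx, hy]
    | tmul a y hy =>
      rw [LieAlgebra.ExtendScalars.bracket_tmul, mul_one, LinearMap.lTensor_tmul, hψ y hy]
  have hx2 : ψ.lTensor Laurent (ofIntegral (W' - W) - ⁅x, 1 ⊗ₜ pMinusOne b⁆) = 0 := by
    rw [filt_extend _ hD.isGrading] at h5
    generalize ofIntegral (W' - W) - ⁅x, 1 ⊗ₜ pMinusOne b⁆ = w at h5
    induction h5 using baseChange_induction with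
    | zero => simp
    | add x y _ _ hx hy => rw [map_add, hx, hy, add_zero]
    | tmul a y hy => rw [LinearMap.lTensor_tmul, hψ' y hy, TensorProduct.tmul_zero]
  have hx3 : x ∈ integralLattice 𝔤 := by
    rw [map_sub, hx1, sub_eq_zero] at hx2
    rw [← hx2]
    refine ⟨ψ.lTensor _ (W' - W), ?_⟩
    rw [ofIntegral, ← LinearMap.comp_apply, ← LinearMap.comp_apply, LinearMap.rTensor_comp_lTensor,
      LinearMap.lTensor_comp_rTensor]
  have hx' := hx
  rw [wt_extend _ hD.isGrading] at hx'
  obtain ⟨ξ, hξ, e3⟩ := exists_ofIntegral_eq hx' hx3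
  refine ⟨ξ, hξ, ?_⟩
  rw [e3, hxD, e, add_sub_cancel_left]
  exact hz'

/-- The residue is invariant under `N((t))`: the leading term of the gauge transformation is
integral, and splitting off its exponential, which preserves the residue, raises the degree. -/
theorem varpi_eq_of_unipotent (hD : IsCoweight b 1 D) (hr : 1 ≤ r)
    (hu : u ∈ unipotentGroup (extendBasis Laurent b))
    (hur : u (1 ⊗ₜ D) - 1 ⊗ₜ D ∈ filt (K := Laurent) ((1 : Laurent) ⊗ₜ[ℂ] D) r)
    (hW : IsRSForm b W) (h : IsGauge u (conn W) (conn W')) :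
    varpi b (evalZero W) = varpi b (evalZero W') := by
  have hD' := hD.extend Laurent
  obtain ⟨N, hN⟩ := hD'.isGrading.exists_filt_eq_top
  obtain ⟨M, hM⟩ := exists_filt_eq_bot (K := Laurent) ((1 : Laurent) ⊗ₜ[ℂ] D)
  obtain ⟨k, hk⟩ : ∃ k : ℕ, (N + M : ℤ) ≤ r + k := ⟨(N + M - r).toNat, by omega⟩
  induction k generalizing r u W with
  | zero =>
    have hu1 : u = 1 := by
      ext y
      have hy : y ∈ filt (K := Laurent) ((1 : Laurent) ⊗ₜ[ℂ] D) (-N) := by rw [hN]; trivial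
      have := sub_mem_filt_of_map_sub_mem (unipotentGroup_le_lieAut hu)
        (fun k y hy => hD'.sub_mem_filt_of_mem_unipotentGroup hu hy) hur hy
      have h0 := filt_anti (k := M) (by push_cast at hk; omega) this
      rw [hM, Submodule.mem_bot, sub_eq_zero] at h0
      exact h0
    subst hu1
    rw [conn_injective (h.unique (isGauge_one _))]
  | succ k ih =>
    obtain ⟨ξ, hξ, h1⟩ := exists_integral_leading_term hD hr hu hur hW h
    obtain ⟨e, he, h2, h3⟩ := exists_gauge_of_leading_term hD hr hξ
    obtain ⟨W1, hW1, hg1, hv1⟩ := h3 W hW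
    rw [← hv1]
    have hue := mul_mem hu (inv_mem he)
    refine ih (r := r + 1) (by omega) hue ?_ hW1 (h.mul hg1.inv) (by push_cast at hk; omega)
    have h4 : e (1 ⊗ₜ D) - 1 ⊗ₜ D ∈ filt (K := Laurent) ((1 : Laurent) ⊗ₜ[ℂ] D) r := by
      have h5 : ofIntegral ξ ∈ wt (K := Laurent) ((1 : Laurent) ⊗ₜ[ℂ] D) r := by
        rw [wt_extend _ hD.isGrading]
        exact rTensor_mem_baseChange _ hξ
      have := add_mem (filt_anti (by omega) h2) (lie_mem_filt' (k := r)
        (wt_le_filt le_rfl h5) (self_mem_filt (K := Laurent)) (by omega))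
      rwa [sub_add_cancel] at this
    have h5 := hD'.sub_mem_filt_of_mem_unipotentGroup hue h4
    have e1 : (u * e⁻¹) (e (1 ⊗ₜ D)) = u (1 ⊗ₜ D) := by
      rw [← LinearEquiv.mul_apply, inv_mul_cancel_right]
    convert sub_mem (sub_mem h1 h2) h5 using 1
    rw [map_sub, e1]
    abel

/-- Opers in normal form that are equivalent under the Borel subgroup have the same residue. -/
theorem varpi_eq_of_isGauge (hg : g ∈ borelGroup (extendBasis Laurent b))
    (hW : IsRSForm b W) (hW' : IsRSForm b W') (h : IsGauge g (conn W) (conn W')) :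
    varpi b (evalZero W) = varpi b (evalZero W') := by
  obtain ⟨D, hD⟩ := exists_isCoweight b 1
  have hD' := hD.extend Laurent
  have ht := Laurent.t_ne_zero
  obtain ⟨θ, hθ, hgθ⟩ := exists_gauge_borel hg
  have hconn {W : PowerSeries ℂ ⊗[ℂ] 𝔤} (hW : IsRSForm b W) :
      ∃ v ∈ (borel b).baseChange Laurent,
        conn W = ∑ i, (fun _ => Laurent.t⁻¹ : ι → Laurent) i ⊗ₜ[ℂ] b.f i + v := by
    refine ⟨_, Submodule.smul_mem _ Laurent.t⁻¹ (isRSForm_iff.1 hW), ?_⟩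
    rw [conn, smul_sub, TensorProduct.smul_tmul', smul_eq_mul, mul_one, pMinusOne,
      TensorProduct.tmul_sum, add_sub_cancel]
  have e := h.unique (hgθ.of_zero (borelGroup_le_lieAut hg) _)
  obtain ⟨u, hu, s, hs, rfl⟩ := exists_eq_unipotent_mul_torus hg
  choose c hc hsc using fun i => exists_torus_smul_one_tmul_f hs i
  -- Comparing the coefficients of the `fᵢ`, the torus part is trivial.
  have hc1 (i : ι) : c i = 1 := by
    obtain ⟨v, hv, e1⟩ := hconn hW
    obtain ⟨v', hv', e1'⟩ := hconn hW'
    obtain ⟨w, hw, e2⟩ := exists_map_eq_of_mem_borelGroup hu hs hsc (fun _ => Laurent.t⁻¹) hv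
    obtain ⟨φ, Φ, -, hΦ⟩ := exists_coeff_f Laurent b i
    rw [e1, e1', e2, add_assoc] at e
    have := congrArg Φ e
    rw [hΦ _ _ hv', hΦ _ _ (add_mem hw hθ)] at this
    exact mul_right_cancel₀ (inv_ne_zero ht) (by rw [one_mul, ← this])
  have hs1 : s = 1 := by
    refine eq_one_of_mem_torusGroup hs fun i => ?_
    have := hsc i
    rwa [hc1, one_smul] at this
  subst hs1
  rw [mul_one] at h
  exact varpi_eq_of_unipotent hD le_rfl hu
    (by
      have h2 := hD'.sub_mem_filt_of_mem_unipotentGroup hu (self_mem_filt (K := Laurent))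
      rwa [zero_add] at h2) hW h

end Disjointness

/-! ### The characteristic polynomial of the adjoint representation -/

section Charpoly

variable {ι 𝔤 : Type*} [Fintype ι] [LieRing 𝔤] [LieAlgebra ℂ 𝔤] [FiniteDimensional ℂ 𝔤]
  {𝔥 : LieSubalgebra ℂ 𝔤} (b : LieAlgebra.Basis ι 𝔥)

theorem mem_polyFun (φ : Module.Dual ℂ 𝔤) : (φ : 𝔤 → ℂ) ∈ polyFun 𝔤 :=
  Algebra.subset_adjoin ⟨φ, rfl⟩

theorem adjointGroup_le_lieAut {K L : Type*} [Field K] [CharZero K] [LieRing L] [LieAlgebra K L]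
    {H : LieSubalgebra K L} (b : LieAlgebra.Basis ι H) : adjointGroup b ≤ lieAut K L :=
  sup_le borelGroup_le_lieAut ((Subgroup.closure_le _).2 fun _ ⟨_, _, h, hg⟩ =>
    hg ▸ adExp_mem_lieAut h)

/-- The coefficients of the characteristic polynomial of `ad x` are invariant polynomial functions
of `x`. -/
theorem charpoly_coeff_mem_invFun (i : ℕ) :
    (fun x : 𝔤 => (LieAlgebra.ad ℂ 𝔤 x).charpoly.coeff i) ∈ invFun b := by
  constructor
  · let v := Module.finBasis ℂ 𝔤
    let P : MvPolynomial _ ℂ :=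
      (LinearMap.polyCharpoly (LieAlgebra.ad ℂ 𝔤 : 𝔤 →ₗ[ℂ] Module.End ℂ 𝔤) v).coeff i
    have h : (fun x : 𝔤 => (LieAlgebra.ad ℂ 𝔤 x).charpoly.coeff i) =
        fun x => MvPolynomial.eval (v.repr x) P := by
      funext x
      exact (LinearMap.polyCharpoly_coeff_eval
        (LieAlgebra.ad ℂ 𝔤 : 𝔤 →ₗ[ℂ] Module.End ℂ 𝔤) v x i).symm
    rw [h]
    clear h
    clear_value P
    induction P using MvPolynomial.induction_on with
    | C a =>
      simp only [MvPolynomial.eval_C]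
      exact Subalgebra.algebraMap_mem (polyFun 𝔤) a
    | add p q hp hq => simp only [map_add]; exact add_mem hp hq
    | mul_X p j hp =>
      simp only [map_mul, MvPolynomial.eval_X]
      exact mul_mem hp (mem_polyFun (v.coord j))
  · intro g hg x y hxy
    rw [adjointPoints_eq] at hg
    have hg' := adjointGroup_le_lieAut _ hg
    let E : 𝔤 ≃ₗ[ℂ] ℂ ⊗[ℂ] 𝔤 := (TensorProduct.lid ℂ 𝔤).symm
    have hE (x : 𝔤) : E.conj (LieAlgebra.ad ℂ 𝔤 x) = LieAlgebra.ad ℂ (ℂ ⊗[ℂ] 𝔤) (1 ⊗ₜ x) := by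
      ext y
      simp [E, LinearEquiv.conj_apply]
    have h1 : g.conj (LieAlgebra.ad ℂ (ℂ ⊗[ℂ] 𝔤) (1 ⊗ₜ x)) = LieAlgebra.ad ℂ (ℂ ⊗[ℂ] 𝔤) (1 ⊗ₜ y) := by
      refine LinearMap.ext fun z => ?_
      rw [LinearEquiv.conj_apply_apply, LieAlgebra.ad_apply, lieAut.map_lie hg', hxy,
        g.apply_symm_apply, LieAlgebra.ad_apply]
    change (LieAlgebra.ad ℂ 𝔤 y).charpoly.coeff i = (LieAlgebra.ad ℂ 𝔤 x).charpoly.coeff i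
    rw [← E.charpoly_conj (LieAlgebra.ad ℂ 𝔤 y), ← E.charpoly_conj (LieAlgebra.ad ℂ 𝔤 x), hE, hE,
      ← h1, g.charpoly_conj]

theorem charpoly_eq_of_varpi_eq {x y : 𝔤} (h : varpi b x = varpi b y) :
    (LieAlgebra.ad ℂ 𝔤 x).charpoly = (LieAlgebra.ad ℂ 𝔤 y).charpoly :=
  Polynomial.ext fun i => congrArg (fun φ => φ ⟨_, charpoly_coeff_mem_invFun b i⟩) h

/-- The eigenvalues of `ad x` are integers. -/
def HasIntegralSpectrum (x : 𝔤) : Prop :=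
  ∀ μ, (LieAlgebra.ad ℂ 𝔤 x).HasEigenvalue μ → ∃ n : ℤ, μ = n

theorem hasIntegralSpectrum_of_varpi_eq {x y : 𝔤} (h : varpi b x = varpi b y)
    (hx : HasIntegralSpectrum x) : HasIntegralSpectrum y := fun μ hμ => by
  rw [Module.End.hasEigenvalue_iff_isRoot_charpoly, ← charpoly_eq_of_varpi_eq b h,
    ← Module.End.hasEigenvalue_iff_isRoot_charpoly] at hμ
  exact hx μ hμ

theorem hasIntegralSpectrum_of_isGrading {x : 𝔤} (hx : IsGrading ℂ x) : HasIntegralSpectrum x := by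
  intro μ hμ
  by_contra! h
  refine hμ (eq_bot_iff.2 ?_)
  have h1 := Module.End.eigenspaces_iSupIndep (LieAlgebra.ad ℂ 𝔤 x) μ
  have h2 : (⊤ : Submodule ℂ 𝔤) ≤ ⨆ j, ⨆ (_ : j ≠ μ), (LieAlgebra.ad ℂ 𝔤 x).eigenspace j := by
    rw [← show ⨆ k, wt (K := ℂ) x k = ⊤ from hx]
    exact iSup_le fun k => le_iSup₂_of_le (k : ℂ) (h k).symm le_rfl
  have h3 := h1.mono_right h2
  rw [disjoint_top] at h3
  exact h3.le

theorem hasIntegralSpectrum_of_mem_coweightLattice {x : 𝔤} (hx : x ∈ coweightLattice b) :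
    HasIntegralSpectrum x := by
  choose n hn using hx.2
  have hx' (i : ι) : b.baseSupp i ⟨x, hx.1⟩ = n i := by
    have h1 := lie_e_of_mem_cartan b hx.1 i
    rw [hn, ← Int.cast_smul_eq_zsmul ℂ] at h1
    exact (smul_left_injective ℂ (b.sl2 i).e_ne_zero h1).symm
  have hD : IsCoweight b n x :=
    { mem := hx.1
      e_mem i := by rw [mem_wt, hn, Int.cast_smul_eq_zsmul]
      f_mem i := by rw [mem_wt, lie_f_of_mem_cartan b hx.1, hx', Int.cast_neg, neg_smul] }
  exact hasIntegralSpectrum_of_isGrading hD.isGrading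

theorem mem_coweightLattice_of_hasIntegralSpectrum {x : 𝔤} (hx : x ∈ 𝔥)
    (h : HasIntegralSpectrum x) : x ∈ coweightLattice b := by
  refine ⟨hx, fun i => ?_⟩
  have h1 := lie_e_of_mem_cartan b hx i
  obtain ⟨n, hn⟩ := h (b.baseSupp i ⟨x, hx⟩)
    (Module.End.hasEigenvalue_of_hasEigenvector (x := b.e i)
      ⟨Module.End.mem_eigenspace_iff.2 h1, (b.sl2 i).e_ne_zero⟩)
  exact ⟨n, by rw [h1, hn, Int.cast_smul_eq_zsmul]⟩

end Charpoly

/-! ### Invariant functions vanishing on the Cartan subalgebra -/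

section InvariantFunctions

variable {ι 𝔤 : Type*} [Fintype ι] [LieRing 𝔤] [LieAlgebra ℂ 𝔤] {𝔥 : LieSubalgebra ℂ 𝔤}

/-- Evaluation at `s` of a polynomial curve in `𝔤`. -/
def evalCurve (s : ℂ) : Polynomial ℂ ⊗[ℂ] 𝔤 →ₗ[ℂ] 𝔤 :=
  (TensorProduct.lid ℂ 𝔤).toLinearMap ∘ₗ (Polynomial.aeval (R := ℂ) s).toLinearMap.rTensor 𝔤

theorem evalCurve_tmul (s : ℂ) (P : Polynomial ℂ) (x : 𝔤) : evalCurve s (P ⊗ₜ x) = P.eval s • x := by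
  simp [evalCurve, Polynomial.aeval_def, Polynomial.eval₂_eq_eval_map]

theorem evalCurve_lie (s : ℂ) (X Y : Polynomial ℂ ⊗[ℂ] 𝔤) :
    evalCurve s ⁅X, Y⁆ = ⁅evalCurve s X, evalCurve s Y⁆ :=
  lid_rTensor_lie (ε := (Polynomial.aeval (R := ℂ) s).toLinearMap) (fun a c => by simp) X Y

theorem evalCurve_smul (s : ℂ) (P : Polynomial ℂ) (X : Polynomial ℂ ⊗[ℂ] 𝔤) :
    evalCurve s (P • X) = P.eval s • evalCurve s X := by
  induction X using TensorProduct.induction_on with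
  | zero => simp
  | tmul Q x => simp [TensorProduct.smul_tmul', evalCurve_tmul, smul_smul]
  | add X Y hX hY => simp only [smul_add, map_add, hX, hY]

theorem evalCurve_mem (s : ℂ) {p : Submodule ℂ 𝔤} {X : Polynomial ℂ ⊗[ℂ] 𝔤}
    (hX : X ∈ p.baseChange (Polynomial ℂ)) : evalCurve s X ∈ p := by
  induction hX using baseChange_induction with
  | zero => rw [map_zero]; exact zero_mem _
  | add x y _ _ hx hy => rw [map_add]; exact add_mem hx hy
  | tmul a x hx => rw [evalCurve_tmul]; exact p.smul_mem _ hx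

/-- A polynomial function is polynomial along a polynomial curve, and its values along two curves
that agree to order `M` agree to order `M`. -/
theorem exists_polynomial_of_mem_polyFun {q : 𝔤 → ℂ} (hq : q ∈ polyFun 𝔤)
    (M : ℕ) (γ δ : Polynomial ℂ ⊗[ℂ] 𝔤) : (∃ P : Polynomial ℂ, ∀ s, q (evalCurve s γ) = P.eval s) ∧
      ∃ Q : Polynomial ℂ, ∀ s,
        q (evalCurve s (γ + (Polynomial.X ^ M : Polynomial ℂ) • δ)) = q (evalCurve s γ) + s ^ M * Q.eval s := by
  induction hq using Algebra.adjoin_induction with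
  | mem q hq =>
    obtain ⟨φ, rfl⟩ := hq
    have h (γ : Polynomial ℂ ⊗[ℂ] 𝔤) : ∃ P : Polynomial ℂ, ∀ s, φ (evalCurve s γ) = P.eval s := by
      induction γ using TensorProduct.induction_on with
      | zero => exact ⟨(0 : Polynomial ℂ), fun s => by simp⟩
      | tmul P x => exact ⟨Polynomial.C (φ x) * P, fun s => by simp [evalCurve_tmul, mul_comm]⟩
      | add x y hx hy =>
        obtain ⟨P, hP⟩ := hx
        obtain ⟨Q, hQ⟩ := hy
        exact ⟨P + Q, fun s => by simp [hP, hQ]⟩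
    obtain ⟨Q, hQ⟩ := h δ
    exact ⟨h γ, Q, fun s => by simp [evalCurve_smul, hQ]⟩
  | algebraMap c => exact ⟨⟨Polynomial.C c, fun s => by simp⟩, (0 : Polynomial ℂ), fun s => by simp⟩
  | add q q' _ _ hq hq' =>
    obtain ⟨⟨P, hP⟩, Q, hQ⟩ := hq
    obtain ⟨⟨P', hP'⟩, Q', hQ'⟩ := hq'
    refine ⟨⟨P + P', fun s => by simp [hP, hP']⟩, Q + Q', fun s => ?_⟩
    rw [Pi.add_apply, Pi.add_apply, hQ, hQ', Polynomial.eval_add]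
    ring
  | mul q q' _ _ hq hq' =>
    obtain ⟨⟨P, hP⟩, Q, hQ⟩ := hq
    obtain ⟨⟨P', hP'⟩, Q', hQ'⟩ := hq'
    refine ⟨⟨P * P', fun s => by simp [hP, hP']⟩, Q * P' + P * Q' + Polynomial.X ^ M * Q * Q',
      fun s => ?_⟩
    rw [Pi.mul_apply, Pi.mul_apply, hQ, hQ', hP, hP']
    simp only [Polynomial.eval_add, Polynomial.eval_mul, Polynomial.eval_pow, Polynomial.eval_X]
    ring

variable [FiniteDimensional ℂ 𝔤] {b : LieAlgebra.Basis ι 𝔥} {D : 𝔤}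

/-- Invariant functions that vanish on `𝔥` vanish on the elements `a p₋₁ + h`, which the torus
contracts to `h`. -/
theorem invFun_smul_pMinusOne_add {q : 𝔤 → ℂ} (hq : q ∈ invFun b) (h0 : ∀ h ∈ 𝔥, q h = 0)
    (a : ℂ) {h : 𝔤} (hh : h ∈ 𝔥) : q (a • pMinusOne b + h) = 0 := by
  obtain ⟨D, hD⟩ := exists_isCoweight b 1
  let γ : Polynomial ℂ ⊗[ℂ] 𝔤 := Polynomial.X ⊗ₜ (a • pMinusOne b) + 1 ⊗ₜ h
  obtain ⟨⟨P, hP⟩, -⟩ := exists_polynomial_of_mem_polyFun hq.1 0 γ 0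
  have hγ (s : ℂ) : evalCurve s γ = s • a • pMinusOne b + h := by
    simp [γ, evalCurve_tmul, smul_comm s a]
  have hinv (c : ℂ) (hc : c ≠ 0) : q (c⁻¹ • a • pMinusOne b + h) = q (a • pMinusOne b + h) := by
    have hD' := hD.extend ℂ
    obtain ⟨g, hg, hgc⟩ := hD'.isGrading.exists_scaling hc
    refine hq.2 g ?_ _ _ ?_
    · rw [adjointPoints_eq]
      refine Subgroup.mem_sup_left (Subgroup.mem_sup_left ⟨hg, fun x hx => ?_⟩)
      rw [hgc 0 x (hD'.cartan_le hx), zpow_zero, one_smul]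
    · rw [TensorProduct.tmul_add, map_add, hgc 0 _ (hD'.cartan_le (one_tmul_mem_cartan ℂ b hh)),
        TensorProduct.tmul_smul, map_smul, hgc (-1) _ (mem_wt_extend hD.pMinusOne_mem 1), zpow_zero,
        one_smul, zpow_neg_one, TensorProduct.tmul_add, TensorProduct.tmul_smul,
        TensorProduct.tmul_smul, smul_comm]
  -- The polynomial `q (s a p₋₁ + h)` in `s` is constant away from `0`, hence constant.
  have hPc : P = Polynomial.C (P.eval 1) := by
    refine Polynomial.eq_of_infinite_eval_eq _ _ ((Set.finite_singleton (0 : ℂ)).infinite_compl.mono ?_)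
    intro s hs
    have hs' : s⁻¹ ≠ 0 := inv_ne_zero hs
    have := hinv _ hs'
    rw [inv_inv] at this
    change P.eval s = _
    rw [Polynomial.eval_C, ← hP, ← hP, hγ, hγ, one_smul, this]
  have h1 := hP 1
  have h2 := hP 0
  rw [hγ, one_smul] at h1
  rw [hγ, zero_smul, zero_add, h0 h hh] at h2
  rw [h1, h2, hPc]
  simp

end InvariantFunctions

/-! ### Invariant functions on the slice `p₋₁ + 𝔟` -/

section Straightening

variable {ι 𝔤 : Type*} [Fintype ι] [LieRing 𝔤] [LieAlgebra ℂ 𝔤] [FiniteDimensional ℂ 𝔤]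
  {𝔥 : LieSubalgebra ℂ 𝔤} {b : LieAlgebra.Basis ι 𝔥} {D : 𝔤}

theorem pow_finrank_eq_zero_of_isNilpotent {V : Type*} [AddCommGroup V] [Module ℂ V]
    [FiniteDimensional ℂ V] {f : Module.End ℂ V} (hf : IsNilpotent f) :
    f ^ Module.finrank ℂ V = 0 := by
  have h := f.aeval_self_charpoly
  rwa [hf.charpoly_eq_X_pow_finrank, map_pow, Polynomial.aeval_X] at h

/-- In positive degrees `ad D` is invertible. -/
theorem exists_lie_eq_of_mem_filt_one {R : Type*} [CommRing R] [Algebra ℂ R] {ν : R ⊗[ℂ] 𝔤}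
    (hν : ν ∈ (filt (K := ℂ) D 1).baseChange R) :
    ∃ w ∈ (filt (K := ℂ) D 1).baseChange R, ⁅w, (1 : R) ⊗ₜ[ℂ] D⁆ = -ν := by
  induction hν using baseChange_induction with
  | zero => exact ⟨0, zero_mem _, by rw [zero_lie, neg_zero]⟩
  | add x y _ _ hx hy =>
    obtain ⟨v, hv, hv'⟩ := hx
    obtain ⟨w, hw, hw'⟩ := hy
    exact ⟨v + w, add_mem hv hw, by rw [add_lie, hv', hw', neg_add]⟩
  | tmul a x hx =>
    have h : ∃ y ∈ filt (K := ℂ) D 1, ⁅y, D⁆ = -x := by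
      induction hx using filt_induction with
      | zero => exact ⟨0, zero_mem _, by rw [zero_lie, neg_zero]⟩
      | add x y _ _ hx hy =>
        obtain ⟨v, hv, hv'⟩ := hx
        obtain ⟨w, hw, hw'⟩ := hy
        exact ⟨v + w, add_mem hv hw, by rw [add_lie, hv', hw', neg_add]⟩
      | wt j hj x hx =>
        refine ⟨(j : ℂ)⁻¹ • x, Submodule.smul_mem _ _ (wt_le_filt hj hx), ?_⟩
        rw [smul_lie, ← lie_skew, mem_wt.1 hx, smul_neg,
          inv_smul_smul₀ (Int.cast_ne_zero.2 (by omega))]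
    obtain ⟨y, hy, hy'⟩ := h
    refine ⟨a ⊗ₜ y, Submodule.tmul_mem_baseChange_of_mem a hy, ?_⟩
    rw [LieAlgebra.ExtendScalars.bracket_tmul, hy', mul_one, TensorProduct.tmul_neg]

/-- A step of the reduction of a deformation `ρ + a (p₋₁ + β)`, where `β ∈ 𝔟`, to an element of
`ρ + a (p₋₁ + 𝔥)` by exponentials of elements of `𝔫`. -/
theorem exists_straightening_step {R : Type*} [CommRing R] [Algebra ℂ R] (hD : IsCoweight b 1 D)
    (a : R) (m : ℕ) {M : ℕ} (hM : 1 ≤ M) {η ν : R ⊗[ℂ] 𝔤}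
    (hη : η ∈ 𝔥.toSubmodule.baseChange R) (hν : ν ∈ (nilradical b).baseChange R) :
    ∃ W ∈ (nilradical b).baseChange R, ∃ η' ∈ 𝔥.toSubmodule.baseChange R,
      ∃ ν' ∈ (nilradical b).baseChange R,
      ∑ n ∈ Finset.range (m + 2), (n.factorial : ℂ)⁻¹ • (fun Z => ⁅W, Z⁆)^[n]
        (1 ⊗ₜ D + a • (1 ⊗ₜ pMinusOne b + η) + a ^ M • ν) =
      1 ⊗ₜ D + a • (1 ⊗ₜ pMinusOne b + η') + a ^ (M + 1) • ν' := by
  have hn : nilradical b = filt (K := ℂ) D 1 := hD.posPart_eq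
  have hB : borel b = filt (K := ℂ) D 0 := borel_eq_filt hD
  rw [hn] at hν
  obtain ⟨w, hw, hwD⟩ := exists_lie_eq_of_mem_filt_one hν
  obtain ⟨W, hW⟩ : ∃ W, W = a ^ M • w := ⟨_, rfl⟩
  obtain ⟨γ, hγ⟩ : ∃ γ, γ = 1 ⊗ₜ D + a • (1 ⊗ₜ pMinusOne b + η) + a ^ M • ν := ⟨_, rfl⟩
  let F := (filt (K := ℂ) D 0).baseChange R
  let P (n : ℕ) : R ⊗[ℂ] 𝔤 := (fun Z => ⁅W, Z⁆)^[n] γ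
  have hP (n : ℕ) : P (n + 1) = ⁅W, P n⁆ := Function.iterate_succ_apply' _ _ _
  have hνF : ν ∈ F := Submodule.baseChange_mono _ (filt_anti (by omega)) hν
  have hwp : ⁅w, 1 ⊗ₜ pMinusOne b + η⁆ ∈ F := by
    refine lie_mem_baseChange (q := filt (K := ℂ) D (-1))
      (fun x hx y hy => lie_mem_filt' hx hy (by omega)) hw (add_mem ?_ ?_)
    · exact Submodule.tmul_mem_baseChange_of_mem _ (wt_le_filt le_rfl hD.pMinusOne_mem)
    · refine Submodule.baseChange_mono _ (fun x hx => ?_) hη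
      exact wt_le_filt (by omega) (hD.cartan_le hx)
  have hlie {z} (hz : z ∈ F) : ∃ z' ∈ F, ⁅W, a ^ M • z⁆ = a ^ (M + 1) • z' := by
    refine ⟨a ^ (M - 1) • ⁅w, z⁆, Submodule.smul_mem _ _ (lie_mem_baseChange
      (fun x hx y hy => lie_mem_filt' hx hy (by omega)) hw hz), ?_⟩
    rw [hW, smul_lie, lie_smul, smul_smul, smul_smul, ← pow_add, ← pow_add]
    congr 2
    omega
  have h1 : ∃ z ∈ F, P 1 = -(a ^ M • ν) + a ^ (M + 1) • z := by
    obtain ⟨z, hz, hz'⟩ := hlie hνF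
    refine ⟨⁅w, 1 ⊗ₜ pMinusOne b + η⁆ + z, add_mem hwp hz, ?_⟩
    have e : P 1 = ⁅W, γ⁆ := rfl
    rw [e, hγ, lie_add, lie_add, hz', hW, smul_lie, hwD, smul_neg, lie_smul, smul_lie, smul_smul,
      smul_add, add_assoc, ← pow_succ']
  have h2 (n : ℕ) : ∃ z ∈ F, P (n + 2) = a ^ (M + 1) • z := by
    induction n with
    | zero =>
      obtain ⟨z, hz, hz'⟩ := h1
      obtain ⟨z1, hz1, hz1'⟩ := hlie (add_mem (neg_mem hνF) (Submodule.smul_mem F a hz))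
      refine ⟨z1, hz1, ?_⟩
      rw [hP, hz', ← hz1', smul_add, smul_neg, smul_smul, ← pow_succ]
    | succ n ih =>
      obtain ⟨z, hz, hz'⟩ := ih
      obtain ⟨z1, hz1, hz1'⟩ := hlie (Submodule.smul_mem F a hz)
      refine ⟨z1, hz1, ?_⟩
      rw [hP, hz', ← hz1', smul_smul, ← pow_succ]
  have hsum : ∃ z ∈ F, ∑ n ∈ Finset.range (m + 2), (n.factorial : ℂ)⁻¹ • P n =
      1 ⊗ₜ D + a • (1 ⊗ₜ pMinusOne b + η) + a ^ (M + 1) • z := by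
    choose z hz hz' using h2
    obtain ⟨z1, hz1, hz1'⟩ := h1
    refine ⟨∑ n ∈ Finset.range m, ((n + 2).factorial : ℂ)⁻¹ • z n + z1,
      add_mem (sum_mem fun n _ => ?_) hz1, ?_⟩
    · exact (F.restrictScalars ℂ).smul_mem _ (hz n)
    · rw [Finset.sum_range_succ', Finset.sum_range_succ', hz1']
      simp only [add_assoc, hz', Nat.reduceAdd]
      have e : P 0 = γ := rfl
      rw [e, hγ, smul_add (a ^ (M + 1)), Finset.smul_sum]
      simp only [smul_comm (a ^ (M + 1)), Nat.factorial_one, Nat.factorial_zero,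
        Nat.cast_one, inv_one, one_smul]
      abel
  obtain ⟨z, hz, hsum⟩ := hsum
  have hz' : z ∈ (borel b).baseChange R := by rw [hB]; exact hz
  rw [borel, baseChange_sup] at hz'
  obtain ⟨η1, hη1, ν1, hν1, rfl⟩ := Submodule.mem_sup.1 hz'
  refine ⟨W, ?_, η + a ^ M • η1, add_mem hη (Submodule.smul_mem _ _ hη1), ν1, hν1, ?_⟩
  · rw [hW, hn]
    exact Submodule.smul_mem _ _ hw
  · rw [← hγ, hsum]
    simp only [smul_add, smul_smul, ← pow_succ']
    abel

/-- An invariant function takes the same values along two curves of the form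
`ρ + s (p₋₁ + η(s)) + sᴹ ν(s)` and `ρ + s (p₋₁ + η'(s)) + sᴹ⁺¹ ν'(s)`, where `η, η'` are curves
in `𝔥` and `ν, ν'` in `𝔫`. -/
theorem exists_straightening (hD : IsCoweight b 1 D) {q : 𝔤 → ℂ} (hq : q ∈ invFun b) {M : ℕ}
    (hM : 1 ≤ M) {η ν : Polynomial ℂ ⊗[ℂ] 𝔤}
    (hη : η ∈ 𝔥.toSubmodule.baseChange (Polynomial ℂ))
    (hν : ν ∈ (nilradical b).baseChange (Polynomial ℂ)) :
    ∃ η' ∈ 𝔥.toSubmodule.baseChange (Polynomial ℂ),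
      ∃ ν' ∈ (nilradical b).baseChange (Polynomial ℂ), ∀ s,
      q (evalCurve s (1 ⊗ₜ D + (Polynomial.X : Polynomial ℂ) • (1 ⊗ₜ pMinusOne b + η) +
        (Polynomial.X ^ M : Polynomial ℂ) • ν)) =
      q (evalCurve s (1 ⊗ₜ D + (Polynomial.X : Polynomial ℂ) • (1 ⊗ₜ pMinusOne b + η') +
        (Polynomial.X ^ (M + 1) : Polynomial ℂ) • ν')) := by
  obtain ⟨W, hW, η', hη', ν', hν', e⟩ := exists_straightening_step hD
    (Polynomial.X : Polynomial ℂ) (Module.finrank ℂ 𝔤) hM hη hν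
  refine ⟨η', hη', ν', hν', fun s => ?_⟩
  rw [← e, map_sum]
  generalize 1 ⊗ₜ D + (Polynomial.X : Polynomial ℂ) • (1 ⊗ₜ pMinusOne b + η) +
        (Polynomial.X ^ M : Polynomial ℂ) • ν = γ
  have hws : evalCurve s W ∈ nilradical b := evalCurve_mem s hW
  have hnil : LieAlgebra.ad ℂ 𝔤 (evalCurve s W) ^ (Module.finrank ℂ 𝔤 + 2) = 0 := by
    rw [pow_add, pow_finrank_eq_zero_of_isNilpotent (isNilpotent_ad_of_mem_posPart b hws), zero_mul]
  have hPs (n : ℕ) : evalCurve s ((fun Z => ⁅W, Z⁆)^[n] γ) =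
      (LieAlgebra.ad ℂ 𝔤 (evalCurve s W) ^ n) (evalCurve s γ) := by
    induction n with
    | zero => rfl
    | succ n ih =>
      rw [Function.iterate_succ_apply', evalCurve_lie, ih, pow_succ', Module.End.mul_apply,
        LieAlgebra.ad_apply]
  simp only [map_smul, hPs]
  exact (invFun_exp b hq hws hnil _).symm

/-- Invariant functions that vanish on `𝔥` vanish on `p₋₁ + 𝔟`: the function vanishes to infinite
order at `s = 0` along the curve `ρ + s (p₋₁ + β - ρ)`. -/
theorem invFun_pMinusOne_add {q : 𝔤 → ℂ} (hq : q ∈ invFun b) (h0 : ∀ h ∈ 𝔥, q h = 0)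
    {β : 𝔤} (hβ : β ∈ borel b) : q (pMinusOne b + β) = 0 := by
  obtain ⟨D, hD⟩ := exists_isCoweight b 1
  obtain ⟨h, hh, y, hy, e⟩ := Submodule.mem_sup.1
    (sub_mem hβ (Submodule.mem_sup_left (T := nilradical b) (show D ∈ 𝔥.toSubmodule from hD.mem)))
  let γ : Polynomial ℂ ⊗[ℂ] 𝔤 := 1 ⊗ₜ D + (Polynomial.X : Polynomial ℂ) • (1 ⊗ₜ pMinusOne b + 1 ⊗ₜ h) +
    (Polynomial.X ^ 1 : Polynomial ℂ) • (1 ⊗ₜ y)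
  have hγ (M : ℕ) : ∃ η ∈ 𝔥.toSubmodule.baseChange (Polynomial ℂ),
      ∃ ν ∈ (nilradical b).baseChange (Polynomial ℂ), ∀ s,
      q (evalCurve s γ) =
      q (evalCurve s (1 ⊗ₜ D + (Polynomial.X : Polynomial ℂ) • (1 ⊗ₜ pMinusOne b + η) +
        (Polynomial.X ^ (M + 1) : Polynomial ℂ) • ν)) := by
    induction M with
    | zero => exact ⟨1 ⊗ₜ h, Submodule.tmul_mem_baseChange_of_mem _ hh, 1 ⊗ₜ y,
        Submodule.tmul_mem_baseChange_of_mem _ hy, fun _ => rfl⟩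
    | succ M ih =>
      obtain ⟨η, hη, ν, hν, e⟩ := ih
      obtain ⟨η', hη', ν', hν', e'⟩ := exists_straightening hD hq (M := M + 1) (by omega) hη hν
      exact ⟨η', hη', ν', hν', fun s => (e s).trans (e' s)⟩
  obtain ⟨⟨P, hP⟩, -⟩ := exists_polynomial_of_mem_polyFun hq.1 0 γ 0
  have hdvd (M : ℕ) : Polynomial.X ^ (M + 1) ∣ P := by
    obtain ⟨η, hη, ν, -, e⟩ := hγ M
    obtain ⟨-, Q, hQ⟩ := exists_polynomial_of_mem_polyFun hq.1 (M + 1)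
      (1 ⊗ₜ D + (Polynomial.X : Polynomial ℂ) • (1 ⊗ₜ pMinusOne b + η)) ν
    refine ⟨Q, Polynomial.funext fun s => ?_⟩
    have h1 : evalCurve s (1 ⊗ₜ D + (Polynomial.X : Polynomial ℂ) • (1 ⊗ₜ pMinusOne b + η)) =
        s • pMinusOne b + (D + s • evalCurve s η) := by
      rw [map_add, evalCurve_smul, map_add, evalCurve_tmul, evalCurve_tmul, Polynomial.eval_one,
        one_smul, one_smul, Polynomial.eval_X, smul_add]
      abel
    rw [← hP, e, hQ, h1, invFun_smul_pMinusOne_add hq h0 s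
      (add_mem hD.mem (𝔥.smul_mem _ (evalCurve_mem s hη))), zero_add, Polynomial.eval_mul,
      Polynomial.eval_pow, Polynomial.eval_X]
  have hP0 : P = 0 := by
    by_contra hne
    have := Polynomial.natDegree_le_of_dvd (hdvd P.natDegree) hne
    rw [Polynomial.natDegree_X_pow] at this
    omega
  have h1 := hP 1
  have h2 : evalCurve 1 γ = pMinusOne b + β := by
    have e' : β = D + h + y := by rw [add_assoc, e, add_sub_cancel]
    simp only [γ, map_add, evalCurve_smul, evalCurve_tmul, Polynomial.eval_one, one_smul,
      Polynomial.eval_X, pow_one, e']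
    abel
  rw [← h2, h1, hP0, Polynomial.eval_zero]

end Straightening

/-! ### Surjectivity of the Cartan subalgebra onto the adjoint quotient -/

section Restriction

variable {ι 𝔤 : Type*} [Fintype ι] [LieRing 𝔤] [LieAlgebra ℂ 𝔤] [FiniteDimensional ℂ 𝔤]
  {𝔥 : LieSubalgebra ℂ 𝔤} (b : LieAlgebra.Basis ι 𝔥)

/-- The simple roots span the dual of `𝔥`, the center of `𝔤` being trivial. -/
theorem span_baseSupp [LieAlgebra.IsKilling ℂ 𝔤] :
    Submodule.span ℂ (Set.range b.baseSupp) = ⊤ := by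
  have h : (Submodule.span ℂ (Set.range b.baseSupp)).dualCoannihilator = ⊥ := by
    rw [eq_bot_iff]
    intro x hx
    rw [Submodule.mem_dualCoannihilator] at hx
    have hx' (i : ι) : b.baseSupp i x = 0 := hx _ (Submodule.subset_span ⟨i, rfl⟩)
    have h1 (y : 𝔤) : ⁅(x : 𝔤), y⁆ = 0 := by
      refine mem_of_generators (b := b) (S := LinearMap.ker (LieAlgebra.ad ℂ 𝔤 (x : 𝔤)))
        (fun i => ?_) (fun i => ?_) (fun y hy z hz => ?_) y
      · change ⁅(x : 𝔤), b.e i⁆ = 0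
        rw [lie_e_of_mem_cartan b x.2, hx', zero_smul]
      · change ⁅(x : 𝔤), b.f i⁆ = 0
        rw [lie_f_of_mem_cartan b x.2, hx', zero_smul, neg_zero]
      · change ⁅(x : 𝔤), ⁅y, z⁆⁆ = 0
        have hy' : ⁅(x : 𝔤), y⁆ = 0 := hy
        have hz' : ⁅(x : 𝔤), z⁆ = 0 := hz
        rw [leibniz_lie, hy', hz', zero_lie, lie_zero, add_zero]
    have h2 : (x : 𝔤) ∈ LieAlgebra.center ℂ 𝔤 := fun y => by rw [← lie_skew, h1, neg_zero]
    rw [LieAlgebra.center_eq_bot, LieSubmodule.mem_bot] at h2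
    exact Subtype.ext h2
  have h2 := Subspace.dualCoannihilator_dualAnnihilator_eq
    (W := Submodule.span ℂ (Set.range b.baseSupp))
  rw [← h2, h, Submodule.dualAnnihilator_bot]

/-- The algebra of polynomial functions on `𝔥`. -/
def cartanFun (𝔥 : LieSubalgebra ℂ 𝔤) : Subalgebra ℂ (𝔥 → ℂ) :=
  Algebra.adjoin ℂ (Set.range fun φ : Module.Dual ℂ 𝔥 => (φ : 𝔥 → ℂ))

theorem restrict_mem_cartanFun {q : 𝔤 → ℂ} (hq : q ∈ polyFun 𝔤) :
    (fun x : 𝔥 => q x) ∈ cartanFun 𝔥 := by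
  induction hq using Algebra.adjoin_induction with
  | mem q hq =>
    obtain ⟨φ, rfl⟩ := hq
    exact Algebra.subset_adjoin ⟨φ ∘ₗ 𝔥.toSubmodule.subtype, rfl⟩
  | algebraMap c => exact Subalgebra.algebraMap_mem (cartanFun 𝔥) c
  | add q q' _ _ h h' => exact add_mem h h'
  | mul q q' _ _ h h' => exact mul_mem h h'

/-- The restriction of invariant functions to `𝔥`. -/
def restrict : invFun b →ₐ[ℂ] cartanFun 𝔥 where
  toFun q := ⟨fun x => q.1 x, restrict_mem_cartanFun q.2.1⟩
  map_one' := rfl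
  map_mul' _ _ := rfl
  map_zero' := rfl
  map_add' _ _ := rfl
  commutes' _ := rfl

/-- The simple roots are integral over the algebra of invariant functions, being roots of the
characteristic polynomial of the adjoint representation. -/
theorem isIntegralElem_baseSupp (i : ι) : (restrict b).toRingHom.IsIntegralElem
    ⟨b.baseSupp i, Algebra.subset_adjoin ⟨b.baseSupp i, rfl⟩⟩ := by
  let n := Module.finrank ℂ 𝔤
  let c (k : ℕ) : invFun b := ⟨_, charpoly_coeff_mem_invFun b k⟩
  refine ⟨Polynomial.X ^ n + ∑ k : Fin n, Polynomial.C (c k) * Polynomial.X ^ (k : ℕ),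
    Polynomial.monic_X_pow_add (Polynomial.degree_sum_fin_lt _), Subtype.ext (funext fun x => ?_)⟩
  rw [Polynomial.eval₂_add, Polynomial.eval₂_X_pow, Polynomial.eval₂_finsetSum]
  simp only [Polynomial.eval₂_mul, Polynomial.eval₂_C, Polynomial.eval₂_X_pow]
  have h1 : (LieAlgebra.ad ℂ 𝔤 (x : 𝔤)).charpoly.eval (b.baseSupp i x) = 0 := by
    change (LieAlgebra.ad ℂ 𝔤 (x : 𝔤)).charpoly.IsRoot (b.baseSupp i x)
    rw [← Module.End.hasEigenvalue_iff_isRoot_charpoly]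
    exact Module.End.hasEigenvalue_of_hasEigenvector (x := b.e i)
      ⟨Module.End.mem_eigenspace_iff.2 (lie_e_of_mem_cartan b x.2 i), (b.sl2 i).e_ne_zero⟩
  have h2 := (LieAlgebra.ad ℂ 𝔤 (x : 𝔤)).charpoly_monic.coeff_natDegree
  rw [LinearMap.charpoly_natDegree] at h2
  rw [Polynomial.eval_eq_sum_range, LinearMap.charpoly_natDegree, Finset.sum_range_succ, h2,
    one_mul, Finset.sum_range, add_comm] at h1
  have h3 (k : ℕ) : ((restrict b) (c k)).1 x =
      (LieAlgebra.ad ℂ 𝔤 (x : 𝔤)).charpoly.coeff k := rfl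
  simpa [h3] using h1

/-- Polynomial functions on `𝔥` are integral over the invariant functions on `𝔤`. -/
theorem isIntegral_restrict [LieAlgebra.IsKilling ℂ 𝔤] : (restrict b).toRingHom.IsIntegral := by
  let _ := (restrict b).toRingHom.toAlgebra
  have h (φ : Module.Dual ℂ 𝔥) : (restrict b).toRingHom.IsIntegralElem
      ⟨φ, Algebra.subset_adjoin ⟨φ, rfl⟩⟩ := by
    have hφ : φ ∈ Submodule.span ℂ (Set.range b.baseSupp) := by rw [span_baseSupp]; trivial
    induction hφ using Submodule.span_induction with
    | mem φ h => obtain ⟨i, rfl⟩ := h; exact isIntegralElem_baseSupp b i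
    | zero => exact RingHom.isIntegralElem_zero _
    | add φ ψ _ _ h h' => exact RingHom.IsIntegralElem.add _ h h'
    | smul c φ _ h =>
      exact RingHom.IsIntegralElem.mul _
        ((restrict b).toRingHom.isIntegralElem_map (x := algebraMap ℂ _ c)) h
  rintro ⟨f, hf⟩
  have key : ∃ hf : f ∈ cartanFun 𝔥, (restrict b).toRingHom.IsIntegralElem ⟨f, hf⟩ := by
    induction hf using Algebra.adjoin_induction with
    | mem f hf =>
      obtain ⟨φ, rfl⟩ := hf
      exact ⟨_, h φ⟩
    | algebraMap c => exact ⟨_, (restrict b).toRingHom.isIntegralElem_map (x := algebraMap ℂ _ c)⟩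
    | add f g _ _ hf hg =>
      obtain ⟨hf, hf'⟩ := hf
      obtain ⟨hg, hg'⟩ := hg
      exact ⟨add_mem hf hg, RingHom.IsIntegralElem.add _ hf' hg'⟩
    | mul f g _ _ hf hg =>
      obtain ⟨hf, hf'⟩ := hf
      obtain ⟨hg, hg'⟩ := hg
      exact ⟨mul_mem hf hg, RingHom.IsIntegralElem.mul _ hf' hg'⟩
  exact key.2

/-- A point of the adjoint quotient at which all invariant functions vanishing on `𝔥` vanish is the
image of a point of `𝔥`. -/
theorem exists_varpi_eq [LieAlgebra.IsKilling ℂ 𝔤] (χ : AdjQuot b)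
    (hχ : ∀ q : invFun b, (∀ h ∈ 𝔥, q.1 h = 0) → χ q = 0) : ∃ ν ∈ 𝔥, varpi b ν = χ := by
  -- A prime of the functions on `𝔥` lying over the kernel of `χ` is the ideal of a point.
  let _ := (restrict b).toRingHom.toAlgebra
  have _ : Algebra.IsIntegral (invFun b) (cartanFun 𝔥) := ⟨isIntegral_restrict b⟩
  have _ : IsScalarTower ℂ (invFun b) (cartanFun 𝔥) :=
    IsScalarTower.of_algebraMap_eq fun c => ((restrict b).commutes c).symm
  have hP : (RingHom.ker χ).IsPrime := RingHom.ker_isPrime χ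
  obtain ⟨Q, -, hQ, hQP⟩ := Ideal.exists_ideal_over_prime_of_isIntegral (S := cartanFun 𝔥)
    (RingHom.ker χ) ⊥ (fun q hq => by
      have hq' : restrict b q = 0 := hq
      exact hχ q fun h hh => congrFun (congrArg Subtype.val hq') ⟨h, hh⟩)
  have hint (f : cartanFun 𝔥 ⧸ Q) : IsIntegral ℂ f := by
    have h1 : ((Ideal.Quotient.mk Q).comp (restrict b).toRingHom).IsIntegralElem f := by
      obtain ⟨f, rfl⟩ := Ideal.Quotient.mk_surjective f
      obtain ⟨p, hp, hpf⟩ := isIntegral_restrict b f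
      exact ⟨p, hp, by rw [← Polynomial.hom_eval₂, hpf, map_zero]⟩
    obtain ⟨p, hp, hpf⟩ := h1
    refine ⟨p.map χ.toRingHom, hp.map _, ?_⟩
    rw [Polynomial.eval₂_map]
    rw [show (algebraMap ℂ (cartanFun 𝔥 ⧸ Q)).comp χ.toRingHom =
      (Ideal.Quotient.mk Q).comp (restrict b).toRingHom from ?_]
    · exact hpf
    refine RingHom.ext fun q => ?_
    change Ideal.Quotient.mk Q (algebraMap ℂ _ (χ q)) = Ideal.Quotient.mk Q (restrict b q)
    rw [← (restrict b).commutes, Ideal.Quotient.eq, ← map_sub]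
    change _ ∈ Q.comap (algebraMap (invFun b) (cartanFun 𝔥))
    rw [hQP, RingHom.mem_ker, map_sub, AlgHom.commutes]
    simp
  have _ : Algebra.IsIntegral ℂ (cartanFun 𝔥 ⧸ Q) := ⟨hint⟩
  let E : ℂ ≃ₐ[ℂ] (cartanFun 𝔥 ⧸ Q) := AlgEquiv.ofBijective (Algebra.ofId _ _)
    IsAlgClosed.algebraMap_bijective_of_isIntegral
  let ψ : cartanFun 𝔥 →ₐ[ℂ] ℂ := E.symm.toAlgHom.comp (Ideal.Quotient.mkₐ ℂ Q)
  have hψ (q : invFun b) : ψ (restrict b q) = χ q := by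
    have h1 : algebraMap ℂ (invFun b) (χ q) - q ∈ RingHom.ker χ := by
      rw [RingHom.mem_ker, map_sub, AlgHom.commutes]
      simp
    rw [← hQP] at h1
    have h2 : Ideal.Quotient.mkₐ ℂ Q (restrict b (algebraMap ℂ (invFun b) (χ q) - q)) = 0 :=
      Ideal.Quotient.eq_zero_iff_mem.2 h1
    have h3 : ψ (restrict b (algebraMap ℂ (invFun b) (χ q) - q)) = 0 := by
      change E.symm (Ideal.Quotient.mkₐ ℂ Q _) = 0
      rw [h2, map_zero]
    rw [map_sub, map_sub, AlgHom.commutes, AlgHom.commutes, sub_eq_zero] at h3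
    exact h3.symm
  let L : Module.Dual ℂ (Module.Dual ℂ 𝔥) :=
    { toFun φ := ψ ⟨φ, Algebra.subset_adjoin ⟨φ, rfl⟩⟩
      map_add' φ φ' := map_add ψ ⟨φ, Algebra.subset_adjoin ⟨φ, rfl⟩⟩
        ⟨φ', Algebra.subset_adjoin ⟨φ', rfl⟩⟩
      map_smul' c φ := map_smul ψ c ⟨φ, Algebra.subset_adjoin ⟨φ, rfl⟩⟩ }
  let ν : 𝔥 := (Module.evalEquiv ℂ 𝔥).symm L
  have hν (φ : Module.Dual ℂ 𝔥) : ψ ⟨φ, Algebra.subset_adjoin ⟨φ, rfl⟩⟩ = φ ν := by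
    have h1 : Module.evalEquiv ℂ 𝔥 ν = L := LinearEquiv.apply_symm_apply _ _
    exact (LinearMap.congr_fun h1 φ).symm
  have hψν : ψ = (Pi.evalAlgHom ℂ (fun _ : 𝔥 => ℂ) ν).comp (cartanFun 𝔥).val := by
    refine AlgHom.adjoin_ext (fun f hf => ?_)
    obtain ⟨φ, rfl⟩ := hf
    exact hν φ
  refine ⟨ν, ν.2, AlgHom.ext fun q => ?_⟩
  rw [← hψ, hψν]
  rfl

/-- The residue of an oper with integral spectrum is an integral point of the adjoint quotient. -/
theorem varpi_mem_integralPoints [LieAlgebra.IsKilling ℂ 𝔤] {β : 𝔤} (hβ : β ∈ borel b)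
    (h : HasIntegralSpectrum (pMinusOne b + β)) : varpi b (pMinusOne b + β) ∈ integralPoints b := by
  obtain ⟨ν, hν, e⟩ := exists_varpi_eq b (varpi b (pMinusOne b + β))
    fun q hq => invFun_pMinusOne_add q.2 hq hβ
  exact ⟨ν, mem_coweightLattice_of_hasIntegralSpectrum b hν (hasIntegralSpectrum_of_varpi_eq b e.symm h),
    e⟩

end Restriction

/-! ### Formal solutions at a regular singular point -/

section Frobenius

variable {𝔤 : Type*} [LieRing 𝔤] [LieAlgebra ℂ 𝔤]

/-- The coefficient of `tⁿ` of an element of `𝔤[[t]]`. -/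
def coeffMap (n : ℕ) : PowerSeries ℂ ⊗[ℂ] 𝔤 →ₗ[ℂ] 𝔤 :=
  (TensorProduct.lid ℂ 𝔤).toLinearMap ∘ₗ (PowerSeries.coeff (R := ℂ) n).rTensor 𝔤

theorem coeffMap_zero : coeffMap 0 = evalZero (𝔤 := 𝔤) := rfl

theorem coeffMap_tmul (n : ℕ) (f : PowerSeries ℂ) (x : 𝔤) :
    coeffMap n (f ⊗ₜ x) = PowerSeries.coeff n f • x := by
  simp [coeffMap]

theorem coeffMap_lie (n : ℕ) (X Y : PowerSeries ℂ ⊗[ℂ] 𝔤) : coeffMap n ⁅X, Y⁆ =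
    ∑ p ∈ Finset.HasAntidiagonal.antidiagonal n, ⁅coeffMap p.1 X, coeffMap p.2 Y⁆ :=
  lid_rTensor_lie_eq_sum (s := Finset.HasAntidiagonal.antidiagonal n)
    (ε := PowerSeries.coeff (R := ℂ) n) (φ := fun p : ℕ × ℕ => PowerSeries.coeff (R := ℂ) p.1)
    (ψ := fun p => PowerSeries.coeff (R := ℂ) p.2) (fun a c => PowerSeries.coeff_mul n a c) X Y

/-- The operator `t d/dt` on `𝔤[[t]]`. -/
def euler : PowerSeries ℂ ⊗[ℂ] 𝔤 →ₗ[ℂ] PowerSeries ℂ ⊗[ℂ] 𝔤 :=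
  (LinearMap.mulLeft ℂ (PowerSeries.X : PowerSeries ℂ) ∘ₗ
    (PowerSeries.derivative ℂ : Derivation ℂ (PowerSeries ℂ) (PowerSeries ℂ)).toLinearMap).rTensor 𝔤

theorem euler_tmul (f : PowerSeries ℂ) (x : 𝔤) :
    euler (f ⊗ₜ x) = (PowerSeries.X * PowerSeries.derivative ℂ f) ⊗ₜ x := rfl

theorem coeffMap_euler (n : ℕ) (Y : PowerSeries ℂ ⊗[ℂ] 𝔤) :
    coeffMap n (euler Y) = (n : ℂ) • coeffMap n Y := by
  induction Y using TensorProduct.induction_on with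
  | zero => simp
  | add X X' hX hX' => simp only [map_add, hX, hX', smul_add]
  | tmul f x =>
    rw [euler_tmul, coeffMap_tmul, coeffMap_tmul, smul_smul]
    congr 1
    cases n with
    | zero => simp
    | succ n =>
      rw [PowerSeries.coeff_succ_X_mul, PowerSeries.coeff_derivative]
      push_cast
      ring

variable (W : PowerSeries ℂ ⊗[ℂ] 𝔤) (μ : ℂ)

/-- The operator `t d/dt + ad W - μ` on `𝔤[[t]]`. -/
def shiftedConn : Module.End ℂ (PowerSeries ℂ ⊗[ℂ] 𝔤) :=
  euler + LieAlgebra.ad ℂ (PowerSeries ℂ ⊗[ℂ] 𝔤) W - μ • 1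

theorem shiftedConn_apply (Y : PowerSeries ℂ ⊗[ℂ] 𝔤) :
    shiftedConn W μ Y = euler Y + ⁅W, Y⁆ - μ • Y := rfl

/-- The action of `t d/dt + ad W - μ` on leading coefficients of order `n`. -/
def indicial (n : ℕ) : Module.End ℂ 𝔤 :=
  LieAlgebra.ad ℂ 𝔤 (evalZero W) - (μ - n) • 1

variable {W μ}

theorem coeffMap_shiftedConn (n : ℕ) (Y : PowerSeries ℂ ⊗[ℂ] 𝔤) :
    coeffMap n (shiftedConn W μ Y) = indicial W μ n (coeffMap n Y) +
      ∑ k ∈ Finset.range n, ⁅coeffMap (k + 1) W, coeffMap (n - (k + 1)) Y⁆ := by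
  rw [shiftedConn_apply, map_sub, map_add, coeffMap_euler, coeffMap_lie,
    Finset.Nat.sum_antidiagonal_eq_sum_range_succ_mk, Finset.sum_range_succ', map_smul]
  simp only [indicial, LinearMap.sub_apply, LieAlgebra.ad_apply, LinearMap.smul_apply,
    Module.End.one_apply, sub_smul, coeffMap_zero, Nat.sub_zero]
  abel

theorem coeffMap_shiftedConn_of_order {n : ℕ} {Y : PowerSeries ℂ ⊗[ℂ] 𝔤}
    (hY : ∀ k < n, coeffMap k Y = 0) :
    (∀ k < n, coeffMap k (shiftedConn W μ Y) = 0) ∧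
      coeffMap n (shiftedConn W μ Y) = indicial W μ n (coeffMap n Y) := by
  have h (k : ℕ) (hk : k ≤ n) :
      coeffMap k (shiftedConn W μ Y) = indicial W μ k (coeffMap k Y) := by
    rw [coeffMap_shiftedConn, Finset.sum_eq_zero, add_zero]
    intro j hj
    rw [Finset.mem_range] at hj
    rw [hY _ (by omega), lie_zero]
  exact ⟨fun k hk => by rw [h k hk.le, hY k hk, map_zero], h n le_rfl⟩

theorem coeffMap_shiftedConn_pow_of_order {n : ℕ} {Y : PowerSeries ℂ ⊗[ℂ] 𝔤}
    (hY : ∀ k < n, coeffMap k Y = 0) (q : ℕ) :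
    (∀ k < n, coeffMap k ((shiftedConn W μ ^ q) Y) = 0) ∧
      coeffMap n ((shiftedConn W μ ^ q) Y) = (indicial W μ n ^ q) (coeffMap n Y) := by
  induction q with
  | zero => exact ⟨hY, rfl⟩
  | succ q ih =>
    simp only [pow_succ', Module.End.mul_apply, ← ih.2]
    exact coeffMap_shiftedConn_of_order ih.1

variable [FiniteDimensional ℂ 𝔤]

theorem coeffMap_ext {X Y : PowerSeries ℂ ⊗[ℂ] 𝔤} (h : ∀ n, coeffMap n X = coeffMap n Y) :
    X = Y := by
  let v := Module.finBasis ℂ 𝔤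
  refine (TensorProduct.equivFinsuppOfBasisRight (M := PowerSeries ℂ) v).injective
    (Finsupp.ext fun i => PowerSeries.ext fun n => ?_)
  have key (X : PowerSeries ℂ ⊗[ℂ] 𝔤) : PowerSeries.coeff n
      (TensorProduct.equivFinsuppOfBasisRight (M := PowerSeries ℂ) v X i) =
        v.repr (coeffMap n X) i := by
    induction X using TensorProduct.induction_on with
    | zero => simp
    | add X X' hX hX' => simp only [map_add, Finsupp.add_apply, hX, hX']
    | tmul f x => simp [coeffMap_tmul, mul_comm]
  rw [key, key, h]

theorem exists_coeffMap_eq (a : ℕ → 𝔤) : ∃ X : PowerSeries ℂ ⊗[ℂ] 𝔤, ∀ n, coeffMap n X = a n := by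
  let v := Module.finBasis ℂ 𝔤
  refine ⟨∑ i, PowerSeries.mk (fun n => v.repr (a n) i) ⊗ₜ v i, fun n => ?_⟩
  simp only [map_sum, coeffMap_tmul, PowerSeries.coeff_mk]
  exact v.sum_repr (a n)

/-- In high order the equation `(t d/dt + ad W - μ) Z = R` is solved recursively. -/
theorem exists_shiftedConn_eq {n : ℕ} (hn : ∀ k ≥ n, Function.Surjective (indicial W μ k))
    {R : PowerSeries ℂ ⊗[ℂ] 𝔤} (hR : ∀ k < n, coeffMap k R = 0) :
    ∃ Z, (∀ k < n, coeffMap k Z = 0) ∧ shiftedConn W μ Z = R := by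
  have hn' (k : ℕ) : ∃ g : 𝔤 → 𝔤, n ≤ k → ∀ y, indicial W μ k (g y) = y := by
    by_cases hk : n ≤ k
    · obtain ⟨g, hg⟩ := (hn k hk).hasRightInverse
      exact ⟨g, fun _ => hg⟩
    · exact ⟨id, fun h => absurd h hk⟩
  choose g hg using hn'
  let F (k : ℕ) (z : (j : ℕ) → j < k → 𝔤) : 𝔤 := if n ≤ k then
    g k (coeffMap k R - ∑ j : Fin k, ⁅coeffMap (j + 1) W, z (k - (j + 1)) (by omega)⁆) else 0
  let a : ℕ → 𝔤 := WellFounded.fix Nat.lt_wfRel.wf F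
  have ha (k : ℕ) : a k = F k fun j _ => a j := WellFounded.fix_eq _ _ _
  obtain ⟨Z, hZ⟩ := exists_coeffMap_eq a
  have hZ0 (k : ℕ) (hk : k < n) : coeffMap k Z = 0 := by
    rw [hZ, ha]
    exact if_neg (by omega)
  refine ⟨Z, hZ0, coeffMap_ext fun k => ?_⟩
  by_cases hk : n ≤ k
  · rw [coeffMap_shiftedConn, hZ k, ha]
    simp only [F, if_pos hk]
    rw [hg k hk, Finset.sum_range]
    simp only [hZ, sub_add_cancel]
  · rw [(coeffMap_shiftedConn_of_order hZ0).1 k (by omega), hR k (by omega)]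

theorem exists_shiftedConn_pow_eq {n : ℕ} (hn : ∀ k ≥ n, Function.Surjective (indicial W μ k))
    (q : ℕ) {R : PowerSeries ℂ ⊗[ℂ] 𝔤} (hR : ∀ k < n, coeffMap k R = 0) :
    ∃ Z, (∀ k < n, coeffMap k Z = 0) ∧ (shiftedConn W μ ^ q) Z = R := by
  induction q generalizing R with
  | zero => exact ⟨R, hR, rfl⟩
  | succ q ih =>
    obtain ⟨Z, hZ, rfl⟩ := exists_shiftedConn_eq hn hR
    obtain ⟨Z', hZ', rfl⟩ := ih hZ
    exact ⟨Z', hZ', by rw [pow_succ', Module.End.mul_apply]⟩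

variable (W μ) in
/-- For large `k` the number `μ - k` is not an eigenvalue of the residue. -/
theorem exists_forall_surjective_indicial :
    ∃ n, ∀ k ≥ n, Function.Surjective (indicial W μ k) := by
  have hfin : {k : ℕ | (LieAlgebra.ad ℂ 𝔤 (evalZero W)).HasEigenvalue (μ - k)}.Finite :=
    ((LieAlgebra.ad ℂ 𝔤 (evalZero W)).finite_hasEigenvalue).preimage
      (fun k _ l _ h => by simpa using h)
  obtain ⟨N, hN⟩ := hfin.bddAbove
  refine ⟨N + 1, fun k hk => LinearMap.injective_iff_surjective.1 ?_⟩
  rw [← LinearMap.ker_eq_bot]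
  by_contra h
  have := hN (a := k) (by
    rw [Set.mem_ofPred_eq, Module.End.hasEigenvalue_iff, Module.End.eigenspace_def]
    exact h)
  omega

/-- Every generalized eigenvector of the residue extends to a formal solution of the equation
`(t d/dt + ad W - μ)^q Y = 0`. -/
theorem exists_shiftedConn_pow_eq_zero {v : 𝔤} {m : ℕ}
    (hv : ((LieAlgebra.ad ℂ 𝔤 (evalZero W) - μ • 1) ^ m) v = 0) :
    ∃ (Y : PowerSeries ℂ ⊗[ℂ] 𝔤) (q : ℕ), evalZero Y = v ∧ (shiftedConn W μ ^ q) Y = 0 := by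
  have key (n : ℕ) : ∃ (Y : PowerSeries ℂ ⊗[ℂ] 𝔤) (q : ℕ), evalZero Y = v ∧
      ∀ k < n + 1, coeffMap k ((shiftedConn W μ ^ q) Y) = 0 := by
    induction n with
    | zero =>
      refine ⟨1 ⊗ₜ v, m, evalZero_one_tmul v, fun k hk => ?_⟩
      obtain rfl : k = 0 := by omega
      have h1 := (coeffMap_shiftedConn_pow_of_order (W := W) (μ := μ) (n := 0)
        (Y := (1 : PowerSeries ℂ) ⊗ₜ v) (by simp) m).2
      rw [h1, coeffMap_zero, evalZero_one_tmul]
      simpa [indicial] using hv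
    | succ n ih =>
      obtain ⟨Y, q, hY, h⟩ := ih
      let N := indicial W μ (n + 1)
      -- The leading coefficient is split by the Fitting decomposition of `N`.
      obtain ⟨c0, hc0, c1, hc1, e⟩ := Submodule.mem_sup.1
        ((LinearMap.isCompl_iSup_ker_pow_iInf_range_pow N).sup_eq_top ▸
          Submodule.mem_top (x := coeffMap (n + 1) ((shiftedConn W μ ^ q) Y)))
      obtain ⟨p, hp⟩ := (Submodule.mem_iSup_of_directed _
        (monotone_nat_of_le_succ fun k => by
          intro x hx
          rw [LinearMap.mem_ker] at hx ⊢
          rw [pow_succ', Module.End.mul_apply, hx, map_zero]).directed_le).1 hc0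
      obtain ⟨z, hz⟩ := (Submodule.mem_iInf _).1 hc1 q
      obtain ⟨Z, hZ⟩ := exists_coeffMap_eq (fun k => if k = n + 1 then z else 0)
      have hZ0 : ∀ k < n + 1, coeffMap k Z = 0 := fun k hk => by rw [hZ, if_neg (by omega)]
      have hZ1 := coeffMap_shiftedConn_pow_of_order (W := W) (μ := μ) hZ0 q
      have h2 : ∀ k < n + 1, coeffMap k ((shiftedConn W μ ^ q) (Y - Z)) = 0 := fun k hk => by
        rw [map_sub, map_sub, h k hk, hZ1.1 k hk, sub_zero]
      have h3 : coeffMap (n + 1) ((shiftedConn W μ ^ q) (Y - Z)) = c0 := by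
        rw [map_sub, map_sub, hZ1.2, hZ, if_pos rfl, hz, ← e, add_sub_cancel_right]
      have h4 := coeffMap_shiftedConn_pow_of_order (W := W) (μ := μ) h2 p
      refine ⟨Y - Z, p + q, ?_, fun k hk => ?_⟩
      · rw [map_sub, hY, ← coeffMap_zero, hZ0 0 (by omega), sub_zero]
      · rw [pow_add, Module.End.mul_apply]
        obtain hk | rfl : k < n + 1 ∨ k = n + 1 := by omega
        · exact h4.1 k hk
        · rw [h4.2, h3]
          exact hp
  obtain ⟨n, hn⟩ := exists_forall_surjective_indicial W μ
  obtain ⟨Y, q, hY, h⟩ := key n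
  obtain ⟨Z, hZ, hZ'⟩ := exists_shiftedConn_pow_eq (n := n + 1) (fun k hk => hn k (by omega)) q h
  refine ⟨Y - Z, q, ?_, by rw [map_sub, hZ', sub_self]⟩
  rw [map_sub, hY, ← coeffMap_zero, hZ 0 (by omega), sub_zero]

end Frobenius

/-! ### Horizontal sections and monodromy -/

section CovariantDerivative

variable {R 𝔤 : Type*} [CommRing R] [Algebra ℂ R] [LieRing 𝔤] [LieAlgebra ℂ 𝔤]

/-- The operator `δ + ad B` on `𝔤(R)`, where `δ` is a derivation of `R`. -/
def covDeriv (δ : R →ₗ[ℂ] R) (B : R ⊗[ℂ] 𝔤) : Module.End ℂ (R ⊗[ℂ] 𝔤) :=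
  δ.rTensor 𝔤 + LieAlgebra.ad ℂ (R ⊗[ℂ] 𝔤) B

theorem covDeriv_apply (δ : R →ₗ[ℂ] R) (B X : R ⊗[ℂ] 𝔤) :
    covDeriv δ B X = δ.rTensor 𝔤 X + ⁅B, X⁆ := rfl

variable {δ : R →ₗ[ℂ] R} (hδ : ∀ a c, δ (a * c) = δ a * c + a * δ c)
include hδ

theorem covDeriv_smul (B : R ⊗[ℂ] 𝔤) (a : R) (X : R ⊗[ℂ] 𝔤) :
    covDeriv δ B (a • X) = δ a • X + a • covDeriv δ B X := by
  rw [covDeriv_apply, covDeriv_apply, rTensor_derivation_smul hδ, lie_smul, smul_add, add_assoc]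

/-- In a horizontal frame `δ + ad B` becomes `δ`. -/
theorem covDeriv_map {B : R ⊗[ℂ] 𝔤} {Φ : R ⊗[ℂ] 𝔤 →ₗ[R] R ⊗[ℂ] 𝔤}
    (hΦ : ∀ x : 𝔤, covDeriv δ B (Φ (1 ⊗ₜ x)) = 0) (X : R ⊗[ℂ] 𝔤) :
    covDeriv δ B (Φ X) = Φ (δ.rTensor 𝔤 X) := by
  induction X using TensorProduct.induction_on with
  | zero => simp
  | add X Y hX hY => simp only [map_add, hX, hY]
  | tmul a x =>
    have h (c : R) : c ⊗ₜ[ℂ] x = c • ((1 : R) ⊗ₜ[ℂ] x) := by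
      rw [TensorProduct.smul_tmul', smul_eq_mul, mul_one]
    rw [LinearMap.rTensor_tmul, h a, h (δ a), Φ.map_smul, Φ.map_smul, covDeriv_smul hδ, hΦ, smul_zero,
      add_zero]

end CovariantDerivative

namespace MultiSeries

variable {𝔤 : Type*} [LieRing 𝔤] [LieAlgebra ℂ 𝔤]

theorem tdt_rTensor_ofLaurent (z : Laurent ⊗[ℂ] 𝔤) :
    tdt.rTensor 𝔤 (ofLaurent.rTensor 𝔤 z) = ofLaurent.rTensor 𝔤 (Laurent.t • dt z) := by
  induction z using TensorProduct.induction_on with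
  | zero => simp
  | add X Y hX hY => simp only [map_add, smul_add, hX, hY]
  | tmul a x =>
    rw [LinearMap.rTensor_tmul, LinearMap.rTensor_tmul, tdt_ofLaurent, dt_tmul,
      TensorProduct.smul_tmul', smul_eq_mul, LinearMap.rTensor_tmul]

theorem continuation_rTensor_ofLaurent (z : Laurent ⊗[ℂ] 𝔤) :
    continuation.rTensor 𝔤 (ofLaurent.rTensor 𝔤 z) = ofLaurent.rTensor 𝔤 z := by
  induction z using TensorProduct.induction_on with
  | zero => simp
  | add X Y hX hY => simp only [map_add, hX, hY]
  | tmul a x =>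
    rw [LinearMap.rTensor_tmul, LinearMap.rTensor_tmul, continuation_ofLaurent]

theorem covDeriv_ofLaurent (B z : Laurent ⊗[ℂ] 𝔤) :
    covDeriv tdt (ofLaurent.rTensor 𝔤 B) (ofLaurent.rTensor 𝔤 z) =
      ofLaurent.rTensor 𝔤 (Laurent.t • dt z + ⁅B, z⁆) := by
  rw [covDeriv_apply, tdt_rTensor_ofLaurent, ← rTensor_hom_lie ofLaurent_mul, map_add]

theorem isUnit_monomial (a : ℂ) : IsUnit (monomial a 1) :=
  IsUnit.of_mul_eq_one (monomial (-a) 1) (by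
    rw [monomial_mul, add_neg_cancel, mul_one, monomial_zero_one])

variable [FiniteDimensional ℂ 𝔤]

theorem ofLaurent_rTensor_injective :
    Function.Injective ((ofLaurent : Laurent →ₗ[ℂ] MultiSeries).rTensor 𝔤) :=
  Module.Flat.rTensor_preserves_injective_linearMap _ ofLaurent_injective

theorem one_tmul_injective :
    Function.Injective fun x : 𝔤 => (1 : MultiSeries) ⊗ₜ[ℂ] x := by
  intro x y hxy
  have h : ofLaurent.rTensor 𝔤 ((1 : Laurent) ⊗ₜ x) = ofLaurent.rTensor 𝔤 (1 ⊗ₜ y) := by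
    simpa only [LinearMap.rTensor_tmul, ofLaurent_one] using hxy
  exact FormalOper.one_tmul_injective Laurent (ofLaurent_rTensor_injective h)

/-- The constants of the derivation `t d/dt` on `𝔤`-valued multivalued series are the elements
of `𝔤`. -/
theorem exists_eq_one_tmul {r : MultiSeries ⊗[ℂ] 𝔤} (h : tdt.rTensor 𝔤 r = 0) :
    ∃ v : 𝔤, r = 1 ⊗ₜ v := by
  let v := Module.finBasis ℂ 𝔤
  let E := TensorProduct.equivFinsuppOfBasisRight (M := MultiSeries) v
  have key (i) : tdt (E r i) = 0 := by
    have h1 (r : MultiSeries ⊗[ℂ] 𝔤) : E (tdt.rTensor 𝔤 r) i = tdt (E r i) := by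
      induction r using TensorProduct.induction_on with
      | zero => simp
      | add X Y hX hY => simp only [map_add, Finsupp.add_apply, hX, hY]
      | tmul a x => simp [E]
    rw [← h1, h, map_zero, Finsupp.zero_apply]
  choose c hc using fun i => exists_eq_algebraMap_of_tdt_eq_zero (key i)
  refine ⟨∑ i, c i • v i, E.injective (Finsupp.ext fun i => ?_)⟩
  rw [hc]
  simp [E, TensorProduct.tmul_sum, Finsupp.single_apply, Algebra.algebraMap_eq_smul_one]

/-- A fundamental solution identifies the horizontal sections with `𝔤`. -/
theorem exists_eq_of_covDeriv_eq_zero {B : MultiSeries ⊗[ℂ] 𝔤}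
    {Φ : (MultiSeries ⊗[ℂ] 𝔤) ≃ₗ[MultiSeries] (MultiSeries ⊗[ℂ] 𝔤)}
    (hΦ : ∀ x : 𝔤, covDeriv tdt B (Φ (1 ⊗ₜ x)) = 0) {s : MultiSeries ⊗[ℂ] 𝔤}
    (hs : covDeriv tdt B s = 0) : ∃ v : 𝔤, s = Φ (1 ⊗ₜ v) := by
  have h := covDeriv_map tdt_mul (Φ := Φ.toLinearMap) hΦ (Φ.symm s)
  rw [LinearEquiv.coe_coe, Φ.apply_symm_apply, hs] at h
  obtain ⟨v, hv⟩ := exists_eq_one_tmul (Φ.map_eq_zero_iff.1 h.symm)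
  exact ⟨v, by rw [← hv, Φ.apply_symm_apply]⟩

end MultiSeries

section IntegralSections

variable {𝔤 : Type*} [LieRing 𝔤] [LieAlgebra ℂ 𝔤]

theorem ofIntegral_euler (Y : PowerSeries ℂ ⊗[ℂ] 𝔤) :
    ofIntegral (euler Y) = Laurent.t • dt (ofIntegral Y) := by
  induction Y using TensorProduct.induction_on with
  | zero => simp
  | add X Y hX hY => simp only [map_add, smul_add, hX, hY]
  | tmul f x =>
    rw [euler_tmul, ofIntegral_tmul, ofIntegral_tmul, dt_tmul, Laurent.ofPowerSeries_mul,
      Laurent.ofPowerSeries_X, Laurent.deriv_ofPowerSeries, TensorProduct.smul_tmul', smul_eq_mul]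

theorem ofIntegral_shiftedConn (W Y : PowerSeries ℂ ⊗[ℂ] 𝔤) (μ : ℂ) :
    ofIntegral (shiftedConn W μ Y) =
      Laurent.t • dt (ofIntegral Y) + ⁅ofIntegral W, ofIntegral Y⁆ - μ • ofIntegral Y := by
  rw [shiftedConn_apply, map_sub, map_add, ofIntegral_euler, ofIntegral_lie, map_smul]

end IntegralSections

section IntegralExponents

open MultiSeries

variable {𝔤 : Type*} [LieRing 𝔤] [LieAlgebra ℂ 𝔤] [FiniteDimensional ℂ 𝔤]

/-- If the monodromy is unipotent, then every solution of the form `t^{-μ} z` with `z ∈ 𝔤((t))` is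
univalued. -/
theorem exists_int_of_hasUnipotentMonodromy {A z : Laurent ⊗[ℂ] 𝔤} (hA : HasUnipotentMonodromy A)
    (hz : z ≠ 0) {μ : ℂ} (h : Laurent.t • (dt z + ⁅A, z⁆) = μ • z) : ∃ n : ℤ, μ = n := by
  obtain ⟨Φ, M, hΦ, hM, hN⟩ := hA
  let B := ofLaurent.rTensor 𝔤 (Laurent.t • A)
  let s := monomial (-μ) 1 • ofLaurent.rTensor 𝔤 z
  have hs : covDeriv tdt B s = 0 := by
    have h1 : Laurent.t • dt z + ⁅Laurent.t • A, z⁆ = μ • z := by rw [← h, smul_add, smul_lie]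
    rw [covDeriv_smul tdt_mul, covDeriv_ofLaurent, h1, tdt_monomial, map_smul,
      Polynomial.derivative_one, add_zero, ← smul_monomial, smul_comm (monomial (-μ) 1), smul_assoc,
      neg_smul, neg_add_cancel]
  have hs0 : s ≠ 0 := fun h0 => hz (ofLaurent_rTensor_injective (by
    rwa [map_zero, ← (isUnit_monomial (-μ)).smul_eq_zero]))
  obtain ⟨v, hv⟩ := exists_eq_of_covDeriv_eq_zero (B := B) (Φ := Φ) hΦ hs
  have hc : continuation.rTensor 𝔤 s = Complex.exp (2 * Real.pi * Complex.I * -μ) • s := by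
    rw [rTensor_hom_smul continuation_mul, continuation_rTensor_ofLaurent, continuation_monomial,
      map_one, ← smul_monomial, smul_assoc]
  have h1 : M v = Complex.exp (2 * Real.pi * Complex.I * -μ) • v := by
    have h2 := hM v
    rw [← hv, hc, hv] at h2
    have h3 : Φ ((1 : MultiSeries) ⊗ₜ (Complex.exp (2 * Real.pi * Complex.I * -μ) • v)) =
        Complex.exp (2 * Real.pi * Complex.I * -μ) • Φ (1 ⊗ₜ v) := by
      rw [TensorProduct.tmul_smul]
      exact Φ.toLinearMap.map_smul_of_tower _ _
    rw [← h3] at h2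
    exact (MultiSeries.one_tmul_injective (Φ.injective h2)).symm
  have hv0 : v ≠ 0 := by
    rintro rfl
    rw [TensorProduct.tmul_zero, map_zero] at hv
    exact hs0 hv
  obtain ⟨k, hk⟩ := hN
  have h2 (n : ℕ) : (((M : Module.End ℂ 𝔤) - 1) ^ n) v =
      (Complex.exp (2 * Real.pi * Complex.I * -μ) - 1) ^ n • v := by
    induction n with
    | zero => simp
    | succ n ih =>
      rw [pow_succ', Module.End.mul_apply, ih, map_smul, LinearMap.sub_apply, LinearEquiv.coe_coe, h1,
        Module.End.one_apply, pow_succ, mul_smul, sub_smul _ 1 v, one_smul]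
  have h3 := h2 k
  rw [hk, LinearMap.zero_apply] at h3
  have h4 := eq_zero_of_pow_eq_zero ((smul_eq_zero.1 h3.symm).resolve_right hv0)
  obtain ⟨n, hn⟩ := Complex.exp_eq_one_iff.1 (sub_eq_zero.1 h4)
  refine ⟨-n, ?_⟩
  rw [mul_comm (n : ℂ)] at hn
  have := mul_left_cancel₀ Complex.two_pi_I_ne_zero hn
  rw [Int.cast_neg, ← this, neg_neg]

/-- If a connection with a simple pole is gauge equivalent to one with unipotent monodromy, then the
eigenvalues of its residue are integers. -/
theorem hasIntegralSpectrum_of_isGauge {W : PowerSeries ℂ ⊗[ℂ] 𝔤} {A' : Laurent ⊗[ℂ] 𝔤}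
    {g : (Laurent ⊗[ℂ] 𝔤) ≃ₗ[Laurent] (Laurent ⊗[ℂ] 𝔤)} (h : IsGauge g (conn W) A')
    (hA' : HasUnipotentMonodromy A') : HasIntegralSpectrum (evalZero W) := by
  intro μ hμ
  obtain ⟨v, hv⟩ := hμ.exists_hasEigenvector
  have h1 : ((LieAlgebra.ad ℂ 𝔤 (evalZero W) - μ • (1 : Module.End ℂ 𝔤)) ^ 1) v = 0 := by
    rw [pow_one, LinearMap.sub_apply, hv.apply_eq_smul]
    simp
  obtain ⟨Y, q, hY, hq⟩ := exists_shiftedConn_pow_eq_zero h1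
  have hY0 : Y ≠ 0 := by
    rintro rfl
    rw [map_zero] at hY
    exact hv.2 hY.symm
  have h2 : ∃ Z, Z ≠ 0 ∧ shiftedConn W μ Z = 0 := by
    clear hY
    induction q generalizing Y with
    | zero => exact absurd hq hY0
    | succ q ih =>
      by_cases h0 : shiftedConn W μ Y = 0
      · exact ⟨Y, hY0, h0⟩
      · exact ih _ (by rwa [pow_succ, Module.End.mul_apply] at hq) h0
  obtain ⟨Z, hZ0, hZ⟩ := h2
  have h3 := ofIntegral_shiftedConn W Z μ
  rw [hZ, map_zero, eq_comm, sub_eq_zero] at h3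
  refine exists_int_of_hasUnipotentMonodromy hA' (z := g (ofIntegral Z)) ?_ (μ := μ) ?_
  · rw [Ne, g.map_eq_zero_iff]
    exact fun h0 => hZ0 (ofIntegral_injective (h0.trans (map_zero _).symm))
  · rw [← h, ← map_smul, smul_add, conn, smul_lie, smul_inv_smul₀ Laurent.t_ne_zero, h3]
    exact g.toLinearMap.map_smul_of_tower _ _

end IntegralExponents

/-! ### The Killing form and horizontal sections -/

section KillingForm

variable {R 𝔤 : Type*} [CommRing R] [Algebra ℂ R] [LieRing 𝔤] [LieAlgebra ℂ 𝔤]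

variable (R 𝔤) in
/-- The `R`-bilinear extension of the Killing form of `𝔤` to `𝔤(R)`. -/
def kappa : LinearMap.BilinForm R (R ⊗[ℂ] 𝔤) := (killingForm ℂ 𝔤).baseChange R

theorem kappa_tmul (a c : R) (x y : 𝔤) :
    kappa R 𝔤 (a ⊗ₜ x) (c ⊗ₜ y) = killingForm ℂ 𝔤 x y • (a * c) :=
  LinearMap.BilinForm.baseChange_tmul _ _ _ _ _

theorem kappa_lie (B X Y : R ⊗[ℂ] 𝔤) : kappa R 𝔤 ⁅B, X⁆ Y + kappa R 𝔤 X ⁅B, Y⁆ = 0 := by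
  induction B using TensorProduct.induction_on with
  | zero => simp
  | add B B' h h' =>
    rw [add_lie, add_lie, map_add, map_add, LinearMap.add_apply, add_add_add_comm, h, h', add_zero]
  | tmul b z =>
    induction X using TensorProduct.induction_on with
    | zero => simp
    | add X X' h h' =>
      rw [lie_add, map_add, map_add, LinearMap.add_apply, LinearMap.add_apply, add_add_add_comm, h,
        h', add_zero]
    | tmul a x =>
      induction Y using TensorProduct.induction_on with
      | zero => simp
      | add Y Y' h h' => rw [lie_add, map_add, map_add, add_add_add_comm, h, h', add_zero]
      | tmul c y =>
        rw [LieAlgebra.ExtendScalars.bracket_tmul, LieAlgebra.ExtendScalars.bracket_tmul, kappa_tmul,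
          kappa_tmul, LieModule.traceForm_apply_lie_apply', neg_smul, mul_left_comm a b c, mul_assoc,
          neg_add_cancel]

theorem derivation_kappa {δ : R →ₗ[ℂ] R} (hδ : ∀ a c, δ (a * c) = δ a * c + a * δ c)
    (X Y : R ⊗[ℂ] 𝔤) :
    δ (kappa R 𝔤 X Y) = kappa R 𝔤 (δ.rTensor 𝔤 X) Y + kappa R 𝔤 X (δ.rTensor 𝔤 Y) := by
  induction X using TensorProduct.induction_on with
  | zero => simp
  | add X X' h h' => simp only [map_add, LinearMap.add_apply, h, h']; abel
  | tmul a x =>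
    induction Y using TensorProduct.induction_on with
    | zero => simp
    | add Y Y' h h' => simp only [map_add, h, h']; abel
    | tmul c y =>
      simp only [LinearMap.rTensor_tmul, kappa_tmul, map_smul, hδ, smul_add]

theorem hom_kappa {ε : R →ₗ[ℂ] R} (hε : ∀ a c, ε (a * c) = ε a * ε c) (X Y : R ⊗[ℂ] 𝔤) :
    ε (kappa R 𝔤 X Y) = kappa R 𝔤 (ε.rTensor 𝔤 X) (ε.rTensor 𝔤 Y) := by
  induction X using TensorProduct.induction_on with
  | zero => simp
  | add X X' h h' => simp only [map_add, LinearMap.add_apply, h, h']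
  | tmul a x =>
    induction Y using TensorProduct.induction_on with
    | zero => simp
    | add Y Y' h h' => simp only [map_add, h, h']
    | tmul c y => simp only [LinearMap.rTensor_tmul, kappa_tmul, map_smul, hε]

/-- The Killing form of two horizontal sections is constant. -/
theorem derivation_kappa_eq_zero {δ : R →ₗ[ℂ] R} (hδ : ∀ a c, δ (a * c) = δ a * c + a * δ c)
    {B X Y : R ⊗[ℂ] 𝔤} (hX : covDeriv δ B X = 0) (hY : covDeriv δ B Y = 0) :
    δ (kappa R 𝔤 X Y) = 0 := by
  rw [covDeriv_apply, ← eq_neg_iff_add_eq_zero] at hX hY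
  rw [derivation_kappa hδ, hX, hY, map_neg, map_neg, LinearMap.neg_apply, ← neg_add, kappa_lie,
    neg_zero]

theorem repr_rTensor {S κ : Type*} [CommRing S] [Algebra ℂ S] (v : Module.Basis κ ℂ 𝔤)
    (φ : R →ₗ[ℂ] S) (X : R ⊗[ℂ] 𝔤) (i : κ) :
    (Algebra.TensorProduct.basis S v).repr (φ.rTensor 𝔤 X) i =
      φ ((Algebra.TensorProduct.basis R v).repr X i) := by
  induction X using TensorProduct.induction_on with
  | zero => simp
  | add X Y h h' => simp only [map_add, Finsupp.add_apply, h, h']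
  | tmul a x =>
    simp only [LinearMap.rTensor_tmul, Algebra.TensorProduct.basis_repr_tmul, Finsupp.smul_apply,
      Finsupp.mapRange_apply, smul_eq_mul, Algebra.algebraMap_eq_smul_one, mul_smul_comm, mul_one,
      map_smul]

theorem isUnit_det_kappa [FiniteDimensional ℂ 𝔤] [LieAlgebra.IsKilling ℂ 𝔤] {κ : Type*} [Fintype κ]
    [DecidableEq κ] (v : Module.Basis κ ℂ 𝔤) :
    IsUnit (LinearMap.BilinForm.toMatrix (Algebra.TensorProduct.basis R v) (kappa R 𝔤)).det := by
  have h := (LinearMap.BilinForm.nondegenerate_iff_det_ne_zero v).1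
    (LieAlgebra.IsKilling.killingForm_nondegenerate ℂ 𝔤)
  have e : LinearMap.BilinForm.toMatrix (Algebra.TensorProduct.basis R v) (kappa R 𝔤) =
      (algebraMap ℂ R).mapMatrix (LinearMap.BilinForm.toMatrix v (killingForm ℂ 𝔤)) := by
    ext i j
    simp only [LinearMap.BilinForm.toMatrix_apply, Algebra.TensorProduct.basis_apply, kappa_tmul,
      RingHom.mapMatrix_apply, Matrix.map_apply, mul_one, Algebra.algebraMap_eq_smul_one]
  rw [e, ← RingHom.map_det]
  exact (IsUnit.mk0 _ h).map _

/-- Two families with the same Gram matrix are bases simultaneously. -/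
theorem isUnit_det_of_kappa_eq [FiniteDimensional ℂ 𝔤] [LieAlgebra.IsKilling ℂ 𝔤] {κ : Type*}
    [Fintype κ] [DecidableEq κ] (v : Module.Basis κ ℂ 𝔤) {β σ : R ⊗[ℂ] 𝔤 →ₗ[R] R ⊗[ℂ] 𝔤}
    (h : ∀ i j, kappa R 𝔤 (σ (1 ⊗ₜ v i)) (σ (1 ⊗ₜ v j)) =
      kappa R 𝔤 (β (1 ⊗ₜ v i)) (β (1 ⊗ₜ v j)))
    (hβ : IsUnit (LinearMap.toMatrix (Algebra.TensorProduct.basis R v)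
      (Algebra.TensorProduct.basis R v) β).det) :
    IsUnit (LinearMap.toMatrix (Algebra.TensorProduct.basis R v)
      (Algebra.TensorProduct.basis R v) σ).det := by
  have e : (kappa R 𝔤).comp σ σ = (kappa R 𝔤).comp β β := by
    refine LinearMap.BilinForm.ext_basis (Algebra.TensorProduct.basis R v) fun i j => ?_
    simpa only [LinearMap.BilinForm.comp_apply, Algebra.TensorProduct.basis_apply] using h i j
  have h1 := congrArg (fun B => (LinearMap.BilinForm.toMatrix (Algebra.TensorProduct.basis R v) B).det) e
  simp only [LinearMap.BilinForm.toMatrix_comp (Algebra.TensorProduct.basis R v)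
    (Algebra.TensorProduct.basis R v), Matrix.det_mul, Matrix.det_transpose] at h1
  have h2 := (hβ.mul (isUnit_det_kappa v)).mul hβ
  rw [← h1] at h2
  exact isUnit_of_mul_isUnit_right h2

end KillingForm

/-! ### Fundamental solutions -/

namespace MultiSeries

/-- The specialization `log t = 0`. -/
def logZero : MultiSeries →ₗ[ℂ] MultiSeries :=
  coeffwise fun _ => Algebra.linearMap ℂ (Polynomial ℂ) ∘ₗ
    (Polynomial.aeval (0 : ℂ) : Polynomial ℂ →ₐ[ℂ] ℂ).toLinearMap

theorem logZero_mul (f g : MultiSeries) : logZero (f * g) = logZero f * logZero g :=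
  coeffwise_mul (fun a b x y => by simp) f g

theorem logZero_monomial (a : ℂ) (p : Polynomial ℂ) :
    logZero (monomial a p) = monomial a (Polynomial.C (p.eval 0)) := by
  rw [logZero, coeffwise_monomial]
  simp

theorem logZero_ofLaurent (f : Laurent) : logZero (ofLaurent f) = ofLaurent f := by
  refine (ext_ofLaurent (fun n => ?_) fun a ha => ?_).symm
  · rw [logZero, coeff_coeffwise, coeff_ofLaurent]
    simp
  · rw [logZero, coeff_coeffwise, coeff_ofLaurent_of_forall_ne _ ha, map_zero]

theorem logZero_algebraMap (c : ℂ) :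
    logZero (algebraMap ℂ MultiSeries c) = algebraMap ℂ MultiSeries c := by
  rw [algebraMap_eq, logZero_monomial, Polynomial.eval_C]

theorem continuation_tdt (f : MultiSeries) : continuation (tdt f) = tdt (continuation f) := by
  ext1 a
  simp only [continuation, tdt, coeff_coeffwise]
  simp only [LinearMap.smul_apply, LinearMap.add_apply, LinearMap.id_apply, map_add, map_smul,
    AlgHom.toLinearMap_apply, ← Polynomial.comp_eq_aeval, Polynomial.derivative_comp]
  simp [smul_comm a, smul_add]

variable {𝔤 : Type*} [LieRing 𝔤] [LieAlgebra ℂ 𝔤]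

theorem logZero_rTensor_ofLaurent (z : Laurent ⊗[ℂ] 𝔤) :
    logZero.rTensor 𝔤 (ofLaurent.rTensor 𝔤 z) = ofLaurent.rTensor 𝔤 z := by
  rw [← LinearMap.comp_apply, ← LinearMap.rTensor_comp]
  congr 2
  exact LinearMap.ext logZero_ofLaurent

theorem continuation_rTensor_tdt (s : MultiSeries ⊗[ℂ] 𝔤) :
    continuation.rTensor 𝔤 (tdt.rTensor 𝔤 s) = tdt.rTensor 𝔤 (continuation.rTensor 𝔤 s) := by
  rw [← LinearMap.comp_apply, ← LinearMap.rTensor_comp, ← LinearMap.comp_apply,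
    ← LinearMap.rTensor_comp]
  congr 2
  exact LinearMap.ext continuation_tdt

/-- The continuation of a horizontal section is horizontal. -/
theorem covDeriv_continuation {B : Laurent ⊗[ℂ] 𝔤} {s : MultiSeries ⊗[ℂ] 𝔤}
    (hs : covDeriv tdt (ofLaurent.rTensor 𝔤 B) s = 0) :
    covDeriv tdt (ofLaurent.rTensor 𝔤 B) (continuation.rTensor 𝔤 s) = 0 := by
  have h := congrArg (continuation.rTensor 𝔤) hs
  rwa [covDeriv_apply, map_add, rTensor_hom_lie continuation_mul, continuation_rTensor_ofLaurent,
    continuation_rTensor_tdt, map_zero] at h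

/-- The polynomial `(-X)ⁿ / n!`. -/
def expCoeff (n : ℕ) : Polynomial ℂ := Polynomial.C ((-1) ^ n / n.factorial : ℂ) * Polynomial.X ^ n

theorem derivative_expCoeff_zero : Polynomial.derivative (expCoeff 0) = 0 := by simp [expCoeff]

theorem derivative_expCoeff_succ (n : ℕ) :
    Polynomial.derivative (expCoeff (n + 1)) = -expCoeff n := by
  rw [expCoeff, Polynomial.derivative_C_mul_X_pow, expCoeff, ← neg_mul, ← Polynomial.C_neg,
    add_tsub_cancel_right]
  congr 2
  have h : (n.factorial : ℂ) ≠ 0 := Nat.cast_ne_zero.2 n.factorial_ne_zero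
  have h' : (n + 1 : ℂ) ≠ 0 := Nat.cast_add_one_ne_zero n
  rw [Nat.factorial_succ]
  push_cast
  field_simp
  ring

/-- The solution `t^{-μ} exp (-log t · T) Y`, truncated, where `T = t d/dt + ad W - μ`. -/
def solution (W : PowerSeries ℂ ⊗[ℂ] 𝔤) (μ : ℂ) (Y : PowerSeries ℂ ⊗[ℂ] 𝔤) (q : ℕ) :
    MultiSeries ⊗[ℂ] 𝔤 :=
  ∑ k ∈ Finset.range (q + 1), monomial (-μ) (expCoeff k) •
    ofLaurent.rTensor 𝔤 (ofIntegral ((shiftedConn W μ ^ k) Y))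

variable {W Y : PowerSeries ℂ ⊗[ℂ] 𝔤} {μ : ℂ} {q : ℕ}

theorem covDeriv_monomial_smul (p : Polynomial ℂ) (Z : PowerSeries ℂ ⊗[ℂ] 𝔤) :
    covDeriv tdt (ofLaurent.rTensor 𝔤 (ofIntegral W))
      (monomial (-μ) p • ofLaurent.rTensor 𝔤 (ofIntegral Z)) =
      monomial (-μ) (Polynomial.derivative p) • ofLaurent.rTensor 𝔤 (ofIntegral Z) +
        monomial (-μ) p • ofLaurent.rTensor 𝔤 (ofIntegral (shiftedConn W μ Z)) := by
  rw [covDeriv_smul tdt_mul, covDeriv_ofLaurent, ofIntegral_shiftedConn, map_sub, smul_sub,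
    tdt_monomial, monomial_add, ← smul_monomial, add_smul, neg_smul, neg_smul, map_smul, smul_assoc,
    smul_comm (monomial (-μ) p) μ]
  abel

theorem covDeriv_solution (h : (shiftedConn W μ ^ q) Y = 0) :
    covDeriv tdt (ofLaurent.rTensor 𝔤 (ofIntegral W)) (solution W μ Y q) = 0 := by
  have key (n : ℕ) : covDeriv tdt (ofLaurent.rTensor 𝔤 (ofIntegral W)) (solution W μ Y n) =
      monomial (-μ) (expCoeff n) • ofLaurent.rTensor 𝔤 (ofIntegral ((shiftedConn W μ ^ (n + 1)) Y)) := by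
    have h0 : monomial (-μ) 0 = 0 := by
      have := smul_monomial (-μ) 0 1
      rwa [zero_smul, zero_smul, eq_comm] at this
    have hneg (p : Polynomial ℂ) : monomial (-μ) (-p) = -monomial (-μ) p := by
      have := smul_monomial (-μ) (-1) p
      rwa [neg_one_smul, neg_one_smul, eq_comm] at this
    induction n with
    | zero =>
      rw [solution, Finset.sum_range_one, covDeriv_monomial_smul, derivative_expCoeff_zero, h0,
        zero_smul, zero_add, pow_zero, pow_one, Module.End.one_apply]
    | succ n ih =>
      rw [solution, Finset.sum_range_succ, map_add]
      change covDeriv tdt _ (solution W μ Y n) + _ = _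
      rw [ih, covDeriv_monomial_smul, derivative_expCoeff_succ, hneg, neg_smul, add_neg_cancel_left,
        pow_succ' _ (n + 1), Module.End.mul_apply]
  rw [key, pow_succ', Module.End.mul_apply, h, map_zero, map_zero, map_zero, smul_zero]

theorem logZero_solution : logZero.rTensor 𝔤 (solution W μ Y q) =
    monomial (-μ) 1 • ofLaurent.rTensor 𝔤 (ofIntegral Y) := by
  rw [solution, map_sum, Finset.sum_eq_single 0]
  · rw [rTensor_hom_smul logZero_mul, logZero_rTensor_ofLaurent, logZero_monomial]
    simp [expCoeff]
  · intro k _ hk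
    rw [rTensor_hom_smul logZero_mul, logZero_monomial]
    have := smul_monomial (-μ) 0 1
    rw [zero_smul, zero_smul] at this
    simp [expCoeff, hk, ← this]
  · simp

/-- Continuation decreases the degree in `log t` of series with integral exponents. -/
theorem continuation_sub_one_pow (n : ℤ) (z : Laurent ⊗[ℂ] 𝔤) {N : ℕ} {p : Polynomial ℂ}
    (hp : p.degree < N) :
    ((continuation.rTensor 𝔤 - 1 : Module.End ℂ (MultiSeries ⊗[ℂ] 𝔤)) ^ N)
      (monomial n p • ofLaurent.rTensor 𝔤 z) = 0 := by
  have h0 : monomial (n : ℂ) 0 = 0 := by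
    have := smul_monomial (n : ℂ) 0 1
    rwa [zero_smul, zero_smul, eq_comm] at this
  induction N generalizing p with
  | zero =>
    have : p = 0 := by
      rw [← Polynomial.degree_eq_bot]
      simpa using hp
    rw [this, h0, zero_smul, map_zero]
  | succ N ih =>
    have e : (continuation.rTensor 𝔤 - 1 : Module.End ℂ (MultiSeries ⊗[ℂ] 𝔤))
        (monomial n p • ofLaurent.rTensor 𝔤 z) =
        monomial n (Polynomial.taylor (2 * Real.pi * Complex.I) p - p) • ofLaurent.rTensor 𝔤 z := by
      have h1 : Complex.exp (2 * Real.pi * Complex.I * n) = 1 :=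
        Complex.exp_eq_one_iff.2 ⟨n, by ring⟩
      have h2 : monomial (n : ℂ) (Polynomial.taylor (2 * Real.pi * Complex.I) p - p) =
          monomial (n : ℂ) (Polynomial.taylor (2 * Real.pi * Complex.I) p) - monomial (n : ℂ) p := by
        rw [eq_sub_iff_add_eq, ← monomial_add, sub_add_cancel]
      rw [h2, sub_smul, LinearMap.sub_apply, rTensor_hom_smul continuation_mul,
        continuation_rTensor_ofLaurent, continuation_monomial, h1, one_smul,
        ← Polynomial.comp_eq_aeval, ← Polynomial.taylor_apply, Module.End.one_apply]
    rw [pow_succ, Module.End.mul_apply, e]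
    by_cases hp0 : p = 0
    · rw [hp0, map_zero, sub_zero, h0, zero_smul, map_zero]
    · refine ih (lt_of_lt_of_le (Polynomial.degree_sub_lt_right (Polynomial.degree_taylor p _) hp0
        (Polynomial.leadingCoeff_taylor ..)) ?_)
      exact Order.lt_succ_iff.1 hp

end MultiSeries

theorem evalZero_mem {𝔤 : Type*} [LieRing 𝔤] [LieAlgebra ℂ 𝔤] {p : Submodule ℂ 𝔤}
    {X : PowerSeries ℂ ⊗[ℂ] 𝔤} (hX : X ∈ p.baseChange (PowerSeries ℂ)) : evalZero X ∈ p := by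
  induction hX using baseChange_induction with
  | zero => rw [map_zero]; exact zero_mem _
  | add x y _ _ hx hy => rw [map_add]; exact add_mem hx hy
  | tmul a x hx => rw [evalZero_tmul]; exact p.smul_mem _ hx

/-! ### Unipotent monodromy -/

section UnipotentMonodromy

open MultiSeries

variable {𝔤 : Type*} [LieRing 𝔤] [LieAlgebra ℂ 𝔤] [FiniteDimensional ℂ 𝔤]

/-- The space `𝔤` has a basis of generalized eigenvectors of `ad x`. -/
theorem exists_basis_generalized_eigenvectors (x : 𝔤) :
    ∃ (κ : Type) (_ : Fintype κ) (v : Module.Basis κ ℂ 𝔤) (μ : κ → ℂ),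
      ∀ j, v j ≠ 0 ∧ ∃ m : ℕ, ((LieAlgebra.ad ℂ 𝔤 x - μ j • 1) ^ m) (v j) = 0 := by
  let S : Set 𝔤 := ⋃ μ : ℂ, (LieAlgebra.ad ℂ 𝔤 x).maxGenEigenspace μ
  have hS : ⊤ ≤ Submodule.span ℂ S := by
    rw [← (LieAlgebra.ad ℂ 𝔤 x).iSup_maxGenEigenspace_eq_top]
    exact iSup_le fun μ y hy => Submodule.subset_span (Set.mem_iUnion.2 ⟨μ, hy⟩)
  let v := Module.Basis.ofSpan hS
  let _ := FiniteDimensional.fintypeBasisIndex v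
  let v' := v.reindex (Fintype.equivFin _)
  have hv (j) : ∃ μ : ℂ, v' j ∈ (LieAlgebra.ad ℂ 𝔤 x).maxGenEigenspace μ := by
    rw [Module.Basis.reindex_apply]
    exact Set.mem_iUnion.1 (Module.Basis.ofSpan_subset hS ⟨_, rfl⟩)
  choose μ hμ using hv
  exact ⟨_, inferInstance, v', μ, fun j =>
    ⟨v'.ne_zero j, (Module.End.mem_maxGenEigenspace _ _ _).1 (hμ j)⟩⟩

/-- A family of elements of `𝔤[[t]]` whose values at `0` form a basis of `𝔤`, twisted by powers of
`t`, is a basis. -/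
theorem isUnit_det_of_evalZero_eq {κ : Type*} [Fintype κ] [DecidableEq κ] (v : Module.Basis κ ℂ 𝔤)
    {Y : κ → PowerSeries ℂ ⊗[ℂ] 𝔤} (hY : ∀ j, evalZero (Y j) = v j) (μ : κ → ℂ)
    {β : MultiSeries ⊗[ℂ] 𝔤 →ₗ[MultiSeries] MultiSeries ⊗[ℂ] 𝔤}
    (hβ : ∀ j, β (1 ⊗ₜ v j) = monomial (-μ j) 1 • ofLaurent.rTensor 𝔤 (ofIntegral (Y j))) :
    IsUnit (LinearMap.toMatrix (Algebra.TensorProduct.basis MultiSeries v)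
      (Algebra.TensorProduct.basis MultiSeries v) β).det := by
  let F : Matrix κ κ (PowerSeries ℂ) :=
    Matrix.of fun i j => (Algebra.TensorProduct.basis (PowerSeries ℂ) v).repr (Y j) i
  let φ : PowerSeries ℂ →+* MultiSeries :=
    { toFun f := ofLaurent (Laurent.ofPowerSeries f)
      map_one' := by rw [Laurent.ofPowerSeries_one, ofLaurent_one]
      map_mul' f g := by rw [Laurent.ofPowerSeries_mul, ofLaurent_mul]
      map_zero' := by rw [map_zero, map_zero]
      map_add' f g := by rw [map_add, map_add] }
  have hF : IsUnit F.det := by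
    rw [PowerSeries.isUnit_iff_constantCoeff, RingHom.map_det]
    have e : PowerSeries.constantCoeff.mapMatrix F = 1 := by
      ext i j
      have h1 : evalZero (Y j) = TensorProduct.lid ℂ 𝔤
          ((PowerSeries.coeff (R := ℂ) 0).rTensor 𝔤 (Y j)) := rfl
      have h2 := repr_rTensor v (PowerSeries.coeff (R := ℂ) 0) (Y j) i
      have h3 (X : ℂ ⊗[ℂ] 𝔤) : (Algebra.TensorProduct.basis ℂ v).repr X i =
          v.repr (TensorProduct.lid ℂ 𝔤 X) i := by
        obtain ⟨x, rfl⟩ := (TensorProduct.lid ℂ 𝔤).symm.surjective X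
        simp
      rw [h3, ← h1, hY, v.repr_self] at h2
      change PowerSeries.constantCoeff ((Algebra.TensorProduct.basis (PowerSeries ℂ) v).repr (Y j) i) = _
      rw [← PowerSeries.coeff_zero_eq_constantCoeff_apply, ← h2, Finsupp.single_apply, Matrix.one_apply]
      simp only [eq_comm]
    rw [e, Matrix.det_one]
    exact isUnit_one
  have e : LinearMap.toMatrix (Algebra.TensorProduct.basis MultiSeries v)
      (Algebra.TensorProduct.basis MultiSeries v) β =
      Matrix.of fun i j => monomial (-μ j) 1 * (φ.mapMatrix F) i j := by
    ext1 i j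
    rw [LinearMap.toMatrix_apply, Algebra.TensorProduct.basis_apply, hβ, map_smul, Finsupp.smul_apply,
      smul_eq_mul, repr_rTensor, ofIntegral, repr_rTensor]
    rfl
  rw [e, Matrix.det_mul_row, ← RingHom.map_det]
  exact (IsUnit.prod_univ_iff.2 fun j => isUnit_monomial _).mul (hF.map φ)

/-- A connection with a simple pole whose residue has integral eigenvalues has unipotent
monodromy. -/
theorem hasUnipotentMonodromy_conn [LieAlgebra.IsKilling ℂ 𝔤] {W : PowerSeries ℂ ⊗[ℂ] 𝔤}
    (hW : HasIntegralSpectrum (evalZero W)) : HasUnipotentMonodromy (conn W) := by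
  classical
  obtain ⟨κ, _, v, μ, hv⟩ := exists_basis_generalized_eigenvectors (evalZero W)
  choose hv0 m hm using hv
  choose Y q' hY hq' using fun j => exists_shiftedConn_pow_eq_zero (hm j)
  let q : ℕ := ∑ j, q' j
  have hq (j : κ) : (shiftedConn W (μ j) ^ q) (Y j) = 0 := by
    obtain ⟨d, hd⟩ : ∃ d, q = d + q' j :=
      ⟨q - q' j, (Nat.sub_add_cancel (Finset.single_le_sum (f := q') (fun _ _ => Nat.zero_le _)
        (Finset.mem_univ j))).symm⟩
    rw [hd, pow_add, Module.End.mul_apply, hq', map_zero]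
  have hμ (j : κ) : ∃ n : ℤ, μ j = n := by
    refine hW _ fun h0 => hv0 j ?_
    have h0' : LinearMap.ker (LieAlgebra.ad ℂ 𝔤 (evalZero W) - μ j • 1) = ⊥ := by
      rw [← Module.End.eigenspace_def]
      exact h0
    have h1 := (LinearMap.ker_eq_bot.1 h0').iterate (m j)
    rw [← Module.End.coe_pow] at h1
    exact h1 ((hm j).trans (map_zero _).symm)
  choose n hn using hμ
  let vR := Algebra.TensorProduct.basis MultiSeries v
  let β : MultiSeries ⊗[ℂ] 𝔤 →ₗ[MultiSeries] MultiSeries ⊗[ℂ] 𝔤 := vR.constr MultiSeries fun j =>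
    monomial (-μ j) 1 • ofLaurent.rTensor 𝔤 (ofIntegral (Y j))
  let σ : MultiSeries ⊗[ℂ] 𝔤 →ₗ[MultiSeries] MultiSeries ⊗[ℂ] 𝔤 := vR.constr MultiSeries fun j =>
    solution W (μ j) (Y j) q
  have hβ (j : κ) : β (1 ⊗ₜ v j) = monomial (-μ j) 1 • ofLaurent.rTensor 𝔤 (ofIntegral (Y j)) := by
    rw [← Algebra.TensorProduct.basis_apply]
    exact vR.constr_basis MultiSeries _ j
  have hσ (j : κ) : σ (1 ⊗ₜ v j) = solution W (μ j) (Y j) q := by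
    rw [← Algebra.TensorProduct.basis_apply]
    exact vR.constr_basis MultiSeries _ j
  have hσβ (j : κ) : logZero.rTensor 𝔤 (σ (1 ⊗ₜ v j)) = β (1 ⊗ₜ v j) := by
    rw [hσ, hβ, logZero_solution]
  have hσ0 (j : κ) : covDeriv tdt (ofLaurent.rTensor 𝔤 (ofIntegral W)) (σ (1 ⊗ₜ v j)) = 0 := by
    rw [hσ]
    exact covDeriv_solution (hq j)
  -- The Gram matrix of horizontal sections is constant, so that it may be computed at `log t = 0`.
  have hdet := isUnit_det_of_kappa_eq v (β := β) (σ := σ) (fun i j => by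
      obtain ⟨c, hc⟩ := exists_eq_algebraMap_of_tdt_eq_zero
        (derivation_kappa_eq_zero tdt_mul (hσ0 i) (hσ0 j))
      have h1 := hom_kappa logZero_mul (σ (1 ⊗ₜ v i)) (σ (1 ⊗ₜ v j))
      rwa [hc, logZero_algebraMap, ← hc, hσβ, hσβ] at h1)
    (isUnit_det_of_evalZero_eq v hY μ hβ)
  let Φ : (MultiSeries ⊗[ℂ] 𝔤) ≃ₗ[MultiSeries] (MultiSeries ⊗[ℂ] 𝔤) := LinearEquiv.ofIsUnitDet hdet
  let e : 𝔤 →ₗ[ℂ] MultiSeries ⊗[ℂ] 𝔤 :=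
    (Φ.toLinearMap.restrictScalars ℂ) ∘ₗ TensorProduct.mk ℂ MultiSeries 𝔤 1
  have he (x : 𝔤) : e x = Φ (1 ⊗ₜ x) := rfl
  have hbasis {T : 𝔤 →ₗ[ℂ] MultiSeries ⊗[ℂ] 𝔤} (h : ∀ j, T (v j) = 0) : T = 0 := v.ext h
  have hΦ (x : 𝔤) : covDeriv tdt (ofLaurent.rTensor 𝔤 (ofIntegral W)) (Φ (1 ⊗ₜ x)) = 0 :=
    LinearMap.congr_fun (hbasis (T := covDeriv tdt (ofLaurent.rTensor 𝔤 (ofIntegral W)) ∘ₗ e) hσ0) x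
  have hinj : Function.Injective e := fun x y hxy => MultiSeries.one_tmul_injective (Φ.injective hxy)
  -- The continuation of a horizontal section is horizontal, which defines the monodromy.
  choose M hM using fun x => exists_eq_of_covDeriv_eq_zero hΦ (covDeriv_continuation (hΦ x))
  let L : Module.End ℂ 𝔤 :=
    { toFun := M
      map_add' x y := hinj (by
        simp only [map_add, he, ← hM, TensorProduct.tmul_add])
      map_smul' c x := hinj (by
        have h1 (x : 𝔤) : e (M x) = continuation.rTensor 𝔤 (e x) := (hM x).symm
        rw [h1, map_smul, map_smul, RingHom.id_apply, map_smul, h1]) }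
  let Δ : Module.End ℂ (MultiSeries ⊗[ℂ] 𝔤) := continuation.rTensor 𝔤 - 1
  have hL (x : 𝔤) : e ((L - 1) x) = Δ (e x) := by
    rw [LinearMap.sub_apply, map_sub]
    exact congrArg (· - e x) (hM x).symm
  have hLN (N : ℕ) (x : 𝔤) : e (((L - 1) ^ N) x) = (Δ ^ N) (e x) := by
    induction N with
    | zero => rfl
    | succ N ih => rw [pow_succ', Module.End.mul_apply, hL, ih, pow_succ', Module.End.mul_apply]
  have hΔ : (Δ ^ (q + 1)) ∘ₗ e = 0 := hbasis fun j => by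
    change (Δ ^ (q + 1)) (σ (1 ⊗ₜ v j)) = 0
    rw [hσ, solution, map_sum]
    refine Finset.sum_eq_zero fun k hk => ?_
    rw [hn j, ← Int.cast_neg]
    refine continuation_sub_one_pow _ _ (lt_of_le_of_lt (Polynomial.degree_C_mul_X_pow_le _ _) ?_)
    exact_mod_cast Finset.mem_range.1 hk
  have hnil : IsNilpotent (L - 1) := ⟨q + 1, LinearMap.ext fun x => hinj (by
    rw [hLN, LinearMap.zero_apply, map_zero]
    exact LinearMap.congr_fun hΔ x)⟩
  have hunit : IsUnit L := by
    have := hnil.isUnit_add_one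
    rwa [sub_add_cancel] at this
  refine ⟨Φ, LinearEquiv.ofBijective L ((Module.End.isUnit_iff L).1 hunit), fun x => ?_, hM, hnil⟩
  have h1 : Laurent.t • conn W = ofIntegral W := smul_inv_smul₀ Laurent.t_ne_zero _
  rw [h1]
  exact hΦ x

end UnipotentMonodromy

end FormalOper

end

open FormalOper in
theorem lemma8p2 {ι 𝔤 : Type*} [Fintype ι] [LieRing 𝔤] [LieAlgebra ℂ 𝔤] [FiniteDimensional ℂ 𝔤]
    [LieAlgebra.IsSimple ℂ 𝔤] {𝔥 : LieSubalgebra ℂ 𝔤} (b : LieAlgebra.Basis ι 𝔥) :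
    (∀ χ : Op b, toLoc b χ ∈ LocRSuni b → χ ∈ ⋃ c ∈ integralPoints b, OpRS b c) ∧
    toLoc b ⁻¹' LocRSuni b = ⋃ c ∈ integralPoints b, OpRS b c ∧
    (integralPoints b).PairwiseDisjoint (OpRS b) := by
  have hsub : ∀ χ : Op b, toLoc b χ ∈ LocRSuni b → χ ∈ ⋃ c ∈ integralPoints b, OpRS b c := by
    rintro χ ⟨A', hA', hmon, e⟩
    obtain ⟨A, rfl⟩ := Quotient.exists_rep χ
    obtain ⟨g, hg, h⟩ := Quotient.exact e.symm
    rw [adjointPoints_eq] at hg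
    obtain ⟨g', hg', v, hv, h'⟩ := exists_normalForm_of_isGauge A.2 hA' hg h
    have e1 : Laurent.t⁻¹ • ((1 : Laurent) ⊗ₜ[ℂ] pMinusOne b + ofIntegral v) =
        conn (1 ⊗ₜ pMinusOne b + v) := by
      rw [conn, map_add, ofIntegral_one_tmul]
    have hspec : HasIntegralSpectrum (pMinusOne b + evalZero v) := by
      have h1 := h.mul h'.inv
      rw [e1] at h1
      have h2 := hasIntegralSpectrum_of_isGauge h1 hmon
      rwa [map_add, evalZero_one_tmul] at h2
    have hB := A.2.of_isGauge hg' h'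
    have hr : (gaugeSetoid (borelPoints Laurent b)).r A.1
        (Laurent.t⁻¹ • ((1 : Laurent) ⊗ₜ[ℂ] pMinusOne b + ofIntegral v)) :=
      ⟨g', by rwa [borelPoints_eq], h'⟩
    exact Set.mem_iUnion₂.2 ⟨_, varpi_mem_integralPoints b (evalZero_mem hv) hspec,
      ⟨_, hB⟩, v, hv, rfl, rfl, (Quotient.sound (s := operSetoid b) (a := A) (b := ⟨_, hB⟩) hr).symm⟩
  refine ⟨hsub, Set.Subset.antisymm hsub ?_, ?_⟩
  · intro χ hχ
    obtain ⟨c, ⟨ν, hν, rfl⟩, A, v, hv, hA, hc, rfl⟩ := Set.mem_iUnion₂.1 hχ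
    have e1 : A.1 = conn (1 ⊗ₜ pMinusOne b + v) := by
      rw [hA, conn, map_add, ofIntegral_one_tmul]
    refine ⟨A.1, ⟨_, e1⟩, ?_, rfl⟩
    rw [e1]
    refine hasUnipotentMonodromy_conn ?_
    rw [map_add, evalZero_one_tmul]
    exact hasIntegralSpectrum_of_varpi_eq b hc.symm (hasIntegralSpectrum_of_mem_coweightLattice b hν)
  · intro c _ c' _ hcc'
    refine Set.disjoint_left.2 ?_
    rintro χ ⟨A, v, hv, hA, rfl, rfl⟩ ⟨A', v', hv', hA', rfl, e⟩
    obtain ⟨g, hg, h⟩ := Quotient.exact e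
    rw [borelPoints_eq] at hg
    have e1 : A.1 = conn (1 ⊗ₜ pMinusOne b + v) := by
      rw [hA, conn, map_add, ofIntegral_one_tmul]
    have e1' : A'.1 = conn (1 ⊗ₜ pMinusOne b + v') := by
      rw [hA', conn, map_add, ofIntegral_one_tmul]
    rw [e1, e1'] at h
    have := varpi_eq_of_isGauge hg ⟨v', hv', rfl⟩ ⟨v, hv, rfl⟩ h
    rw [map_add, map_add, evalZero_one_tmul] at this
    exact hcc' this.symm
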